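/- Let $n\ge 3$. For a $C^\infty$ function $u$ in an open set $\Omega\subset\mathbb R^n$ and a closed ball $\overline B(x,r)\subset\Omega$, $r>0$, put $$E_u(x,r)=\int_{B(x,r)}\Big(\tfrac12|\nabla u|^2-\tfrac{n-2}{2n}|u|^{\frac{2n}{n-2}}\Big)dy+\frac{n-2}{4}\,r^{-1}\int_{\partial B(x,r)}u^2\,ds .$$ There is $\bar\varepsilon>0$ depending only on $n$ such that for every open $\Omega\subset\mathbb R^n$ there is a constant $c>0$ (depending only on $n$ and $\Omega$), and for every $\Lambda\ge 0$ a constant $C>0$ (depending only on $n$, $\Omega$ and $\Lambda$), such that the following holds for all $\varepsilon_0\in(0,\bar\varepsilon]$ and all $r_0>0$. Let $(u_i)$ be a sequence of $C^\infty$ solutions of $-\Delta u=u|u|^{4/(n-2)}$ in $\Omega$ with $\|u_i\|_{H^1(\Omega)}+\|u_i\|_{L^{2n/(n-2)}(\Omega)}\le\Lambda$ for all $i$, converging weakly in $H^1(\Omega)\cap L^{2n/(n-2)}(\Omega)$ to a function $u$, and such that the measures $$\eta_i=\Big(\tfrac12|\nabla u_i|^2+\tfrac{n-2}{2n}|u_i|^{\frac{2n}{n-2}}\Big)dx$$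 converge to a Radon measure $\eta$ on $\Omega$, i.e. $\int\phi\,d\eta_i\to\int\phi\,d\eta$ for all $\phi\in C_c(\Omega)$. Let $$\Sigma=\bigcap_{0<r<r_0}\big\{x\in\Omega:\ \liminf_{i\to\infty}E_{u_i}(x,r)\ge\varepsilon_0\big\},$$ where for each $x$ only the radii $r$ with $\overline B(x,r)\subset\Omega$ are taken into account. Then the defect measure $$\nu=\eta-\Big(\tfrac12|\nabla u|^2+\tfrac{n-2}{2n}|u|^{\frac{2n}{n-2}}\Big)dx$$ is a (well-defined) non-negative measure on $\Omega$, and: (i) $\Sigma\subset\operatorname{spt}\nu$, and moreover $\operatorname{spt}\nu\cap\Omega\subset\Sigma$; (ii) there is a measurable function $\Theta$, upper semicontinuous on $\Omega$, such that $\nu=\Theta\,\mathcal H^0\lfloor\Sigma$ and $$c\,\varepsilon_0<\Theta(x)<C\qquad\text{for }\mathcal H^0\text{-a.e. }x\in\Sigma .$$ -/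

import Mathlib

open MeasureTheory Filter Topology
open scoped ENNReal NNReal ContDiff

noncomputable section

namespace CriticalYamabe

/-- Euclidean space `ℝⁿ`. -/
abbrev Eu (n : ℕ) : Type := EuclideanSpace ℝ (Fin n)

/-- The critical Sobolev exponent `2n/(n-2)`, as a real number. -/
def critExp (n : ℕ) : ℝ := 2 * (n : ℝ) / ((n : ℝ) - 2)

/-- `u` is a (classical) smooth solution of `-Δu = u |u|^{4/(n-2)}` in the open set `Ω`. -/
structure IsSmoothSolution {n : ℕ} (Ω : Set (Eu n)) (u : Eu n → ℝ) : Prop where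
  smooth : ContDiffOn ℝ ∞ u Ω
  equation : ∀ x ∈ Ω, -(Laplacian.laplacian u x) = u x * |u x| ^ (4 / ((n : ℝ) - 2))

/-- The `L^p(Ω)` norm (an extended non-negative real). -/
def lpNormOn {n : ℕ} {F : Type*} [NormedAddCommGroup F] (Ω : Set (Eu n)) (p : ℝ)
    (f : Eu n → F) : ℝ≥0∞ :=
  eLpNorm f (ENNReal.ofReal p) (volume.restrict Ω)

/-- `f ∈ L^p(Ω)`. -/
def InLpOn {n : ℕ} {F : Type*} [NormedAddCommGroup F] (Ω : Set (Eu n)) (p : ℝ)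
    (f : Eu n → F) : Prop :=
  MemLp f (ENNReal.ofReal p) (volume.restrict Ω)

/-- The `H¹(Ω)` norm `(‖u‖² + ‖∇u‖²)^{1/2}` of a function that is smooth in `Ω`. -/
def h1NormOn {n : ℕ} (Ω : Set (Eu n)) (u : Eu n → ℝ) : ℝ≥0∞ :=
  (lpNormOn Ω 2 u ^ 2 + lpNormOn Ω 2 (gradient u) ^ 2) ^ (1 / 2 : ℝ)

/-- `G` is the weak gradient of `u` in `Ω` (for locally integrable `u` and `G`):
`∫ u ∇φ = - ∫ φ G` for all test functions `φ ∈ C_c^∞(Ω)`. -/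
def HasWeakGradientOn {n : ℕ} (Ω : Set (Eu n)) (u : Eu n → ℝ) (G : Eu n → Eu n) : Prop :=
  ∀ φ : Eu n → ℝ, ContDiff ℝ ∞ φ → HasCompactSupport φ → tsupport φ ⊆ Ω →
    ∫ x in Ω, u x • gradient φ x = -∫ x in Ω, φ x • G x

/-- The functions `u i`, smooth in `Ω`, converge weakly in `H¹(Ω) ∩ L^{2n/(n-2)}(Ω)` to the
function `v`, whose weak gradient is `G`.  Weak convergence is tested against the dual exponents
(`2` for the function and its gradient, `2n/(n+2)` for the `L^{2n/(n-2)}` part). -/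
structure WeakLimitOn {n : ℕ} (Ω : Set (Eu n)) (u : ℕ → Eu n → ℝ) (v : Eu n → ℝ)
    (G : Eu n → Eu n) : Prop where
  memL2 : InLpOn Ω 2 v
  memCrit : InLpOn Ω (critExp n) v
  gradMemL2 : InLpOn Ω 2 G
  weakGradient : HasWeakGradientOn Ω v G
  tendstoL2 : ∀ ψ : Eu n → ℝ, InLpOn Ω 2 ψ →
    Tendsto (fun i => ∫ x in Ω, u i x * ψ x) atTop (𝓝 (∫ x in Ω, v x * ψ x))
  tendstoGrad : ∀ Ψ : Eu n → Eu n, InLpOn Ω 2 Ψ →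
    Tendsto (fun i => ∫ x in Ω, inner ℝ (gradient (u i) x) (Ψ x)) atTop
      (𝓝 (∫ x in Ω, inner ℝ (G x) (Ψ x)))
  tendstoCrit : ∀ ψ : Eu n → ℝ, InLpOn Ω (2 * (n : ℝ) / ((n : ℝ) + 2)) ψ →
    Tendsto (fun i => ∫ x in Ω, u i x * ψ x) atTop (𝓝 (∫ x in Ω, v x * ψ x))

/-- The energy measure `(½|G|² + (n-2)/(2n) |u|^{2n/(n-2)}) dx` on `Ω`, where `G` is the gradient
of `u`. -/
def energyMeasure {n : ℕ} (Ω : Set (Eu n)) (u : Eu n → ℝ) (G : Eu n → Eu n) : Measure (Eu n) :=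
  (volume.restrict Ω).withDensity fun x =>
    ENNReal.ofReal (1 / 2 * ‖G x‖ ^ 2 + ((n : ℝ) - 2) / (2 * n) * |u x| ^ critExp n)

/-- `η` is a Radon measure on the open set `Ω` (represented as a Borel measure on `ℝⁿ` that does
not charge the complement of `Ω`) and `μ i ⇀ η` in `Ω`, tested against `C_c(Ω)`. -/
structure MeasureLimitOn {n : ℕ} (Ω : Set (Eu n)) (μ : ℕ → Measure (Eu n))
    (η : Measure (Eu n)) : Prop where
  compl_null : η Ωᶜ = 0
  finite_compact : ∀ K : Set (Eu n), IsCompact K → K ⊆ Ω → η K < ⊤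
  tendsto : ∀ φ : Eu n → ℝ, Continuous φ → HasCompactSupport φ → tsupport φ ⊆ Ω →
    Tendsto (fun i => ∫ x, φ x ∂(μ i)) atTop (𝓝 (∫ x, φ x ∂η))

/-- The defect measure `ν = η - (½|G|² + (n-2)/(2n) |v|^{2n/(n-2)}) dx`.  The subtraction is
Mathlib's truncated difference of measures; it is the true difference as soon as the second
measure is finite and bounded by the first. -/
def defectMeasure {n : ℕ} (Ω : Set (Eu n)) (η : Measure (Eu n)) (v : Eu n → ℝ)
    (G : Eu n → Eu n) : Measure (Eu n) :=
  η - energyMeasure Ω v G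

/-- The surface integral `∫_{∂B(x,r)} f ds`, for `r > 0`. -/
def sphereIntegral {n : ℕ} (f : Eu n → ℝ) (x : Eu n) (r : ℝ) : ℝ :=
  r ^ (n - 1) *
    ∫ z : Metric.sphere (0 : Eu n) 1, f (x + r • (z : Eu n))
      ∂((volume : Measure (Eu n)).toSphere)

/-- The monotone quantity
`E_u(x,r) = ∫_{B(x,r)} (½|∇u|² - (n-2)/(2n) |u|^{2n/(n-2)}) dy + (n-2)/4 r⁻¹ ∫_{∂B(x,r)} u² ds`. -/
def monotoneEnergy {n : ℕ} (u : Eu n → ℝ) (x : Eu n) (r : ℝ) : ℝ :=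
  (∫ y in Metric.ball x r,
      (1 / 2 * ‖gradient u y‖ ^ 2 - ((n : ℝ) - 2) / (2 * n) * |u y| ^ critExp n)) +
    ((n : ℝ) - 2) / 4 * r⁻¹ * sphereIntegral (fun y => u y ^ 2) x r

/-- The concentration set
`Σ = ⋂_{0 < r < r₀} {x ∈ Ω : liminf_i E_{u_i}(x,r) ≥ ε₀}`; the radii that count for `x` are those
for which `E_{u_i}(x,r)` makes sense, i.e. the closed ball lies in `Ω`.  The lower limit is taken
in the extended reals. -/
def concentrationSet {n : ℕ} (Ω : Set (Eu n)) (u : ℕ → Eu n → ℝ) (ε₀ r₀ : ℝ) : Set (Eu n) :=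
  {x | x ∈ Ω ∧ ∀ r : ℝ, 0 < r → r < r₀ → Metric.closedBall x r ⊆ Ω →
    (ε₀ : EReal) ≤ liminf (fun i => (monotoneEnergy (u i) x r : EReal)) atTop}

end CriticalYamabe

end

/-! Write `q` for the critical exponent. Two estimates carry the theorem: one says that no energy is
lost where the critical integral is small, the other compares smallness of the monotone energy with
smallness of the ordinary energy.

No loss below a threshold (`exists_isCompactnessConst`). Test the equation for `w = u_i - u_j` with
`ζ² w`. The nonlinear term is bounded by the weight `|u_i|^(q-2) + |u_j|^(q-2)` times `(ζ w)²`. By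
Hölder and Sobolev it is absorbed into `∫ |∇(ζ w)|²` as soon as `∫ |u_i|^q ≤ δ` and `∫ |u_j|^q ≤ δ`
on the support of `ζ`, which leaves `∫ |∇(ζ w)|² ≤ 2 ∫ |∇ζ|² w²` (`exists_smallness_const`). The
right side tends to zero by Rellich. Since the energy density is convex, this Cauchy property and
weak convergence give `η ≤` energy of the limit on the half ball; the opposite inequality is weak
lower semicontinuity. Hence `ν` vanishes there, without any pointwise regularity theory.

Monotone energy. The Pohozaev identity makes `E(x,r)` nondecreasing in `r`. With `g(r) = r⁻¹
∫_{∂B(x,r)} u²` one also has `E = (1/n) ∫_{B(x,r)} |u|^q + (r/4) g'`. If `E(x,r)` is small while `∫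
|u|^q` is not small on a far smaller ball, then `g' ≤ -4κ/t` on a long logarithmic range of radii
`t`, and a nonnegative `g` of bounded initial value cannot decrease that much. So small `E` forces a
small critical integral at a smaller scale (`integral_abs_rpow_le`). Conversely small energy on
`B(x,2r)` forces small `E(x,r)`, through a good radius in `[r,2r]` and monotonicity
(`monotoneEnergy_le_of_integrals`).

Conclusion. Put `a = (n-2)/(2n) δ`. A point with `η{x} < a` has a neighbourhood where the critical
integrals are eventually at most `δ`, so it is off the support of `ν`. A point of `Σ` has `η{x} >
0`. A point of `Ω` outside `Σ` has a subsequence with small `E`, so `ν` vanishes near it. Since the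
limit energy has no atoms, `ν{x} = η{x}`, and `Σ`, `spt ν ∩ Ω` and the set of points of `Ω` with
`η{x} ≥ a` all coincide. This set is finite because `η` is finite. Thus `ν` is a finite sum of point
masses, each at least `a` and at most the total mass of `η`; a nonnegative function vanishing off a
finite set is upper semicontinuous. -/

namespace CriticalYamabe

/-! ### Polar coordinates and spherical integrals. -/

open Set Metric

/-- Integration in polar coordinates centred at the origin. -/
theorem integral_eq_integral_Ioi_sphere {n : ℕ} [Nontrivial (Eu n)] {f : Eu n → ℝ}
    (hf : Integrable f) :
    ∫ y, f y = ∫ ρ in Ioi (0 : ℝ), ρ ^ (n - 1) *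
      ∫ z : sphere (0 : Eu n) 1, f (ρ • (z : Eu n)) ∂((volume : Measure (Eu n)).toSphere) := by
  have hdim : Module.finrank ℝ (Eu n) = n := by simp
  have hmp := (volume : Measure (Eu n)).measurePreserving_homeomorphUnitSphereProd
  rw [hdim] at hmp
  set g : sphere (0 : Eu n) 1 × Ioi (0 : ℝ) → ℝ := fun p => f (p.2.1 • (p.1 : Eu n)) with hg
  have hcomp : ∀ y : ({0}ᶜ : Set (Eu n)), g (homeomorphUnitSphereProd (Eu n) y) = f y := by
    intro y
    have : ‖(y : Eu n)‖ ≠ 0 := norm_ne_zero_iff.2 y.2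
    simp [hg, smul_smul, this]
  have hint : Integrable (fun y : ({0}ᶜ : Set (Eu n)) => f y)
      ((volume : Measure (Eu n)).comap (↑)) := by
    have := (integrableOn_iff_comap_subtypeVal (μ := (volume : Measure (Eu n))) (f := f)
      (s := ({0}ᶜ : Set (Eu n))) (measurableSet_singleton _).compl).1 hf.integrableOn
    exact this
  have hgint : Integrable g
      ((volume : Measure (Eu n)).toSphere.prod (Measure.volumeIoiPow (n - 1))) := by
    rw [← hmp.integrable_comp_emb (Homeomorph.measurableEmbedding _)]
    exact hint.congr (Eventually.of_forall fun y => (hcomp y).symm)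
  calc ∫ y, f y = ∫ y : ({0}ᶜ : Set (Eu n)), f y ∂((volume : Measure (Eu n)).comap (↑)) := by
        rw [integral_subtype_comap (measurableSet_singleton _).compl f, restrict_compl_singleton]
    _ = ∫ p, g p ∂((volume : Measure (Eu n)).toSphere.prod (Measure.volumeIoiPow (n - 1))) := by
        rw [← hmp.integral_comp (Homeomorph.measurableEmbedding _)]
        exact integral_congr_ae (Eventually.of_forall fun y => (hcomp y).symm)
    _ = ∫ ρ : Ioi (0 : ℝ), ∫ z : sphere (0 : Eu n) 1, f (ρ.1 • (z : Eu n))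
          ∂((volume : Measure (Eu n)).toSphere) ∂(Measure.volumeIoiPow (n - 1)) :=
        integral_prod_symm _ hgint
    _ = _ := by
        simp only [Measure.volumeIoiPow, ENNReal.ofReal]
        rw [integral_withDensity_eq_integral_smul]
        · rw [integral_subtype_comap measurableSet_Ioi fun a : ℝ => Real.toNNReal (a ^ (n - 1)) •
            ∫ z : sphere (0 : Eu n) 1, f (a • (z : Eu n)) ∂((volume : Measure (Eu n)).toSphere)]
          refine setIntegral_congr_fun measurableSet_Ioi fun x hx => ?_
          simp only [NNReal.smul_def, smul_eq_mul]
          rw [Real.coe_toNNReal _ (pow_nonneg (le_of_lt hx) _)]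
        · exact (measurable_subtype_coe.pow_const _).real_toNNReal

theorem integral_eq_integral_Ioi_sphereIntegral {n : ℕ} [Nontrivial (Eu n)] {f : Eu n → ℝ}
    (hf : Integrable f) (x : Eu n) :
    ∫ y, f y = ∫ ρ in Ioi (0 : ℝ), sphereIntegral f x ρ := by
  have h := integral_eq_integral_Ioi_sphere (f := fun y => f (x + y)) (hf.comp_add_left x)
  rw [← integral_add_left_eq_self f x, h]
  rfl

theorem sphereIntegral_congr {n : ℕ} {f g : Eu n → ℝ} {x : Eu n} {ρ : ℝ} (hρ : 0 ≤ ρ)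
    (h : ∀ y, dist y x = ρ → f y = g y) : sphereIntegral f x ρ = sphereIntegral g x ρ := by
  unfold sphereIntegral
  congr 1
  refine integral_congr_ae (Eventually.of_forall fun z => h _ ?_)
  have hz : ‖(z : Eu n)‖ = 1 := by simp
  simp [dist_eq_norm, norm_smul, hz, abs_of_nonneg hρ]

theorem add_smul_mem_closedBall {n : ℕ} {x : Eu n} {ρ R : ℝ} (hρ : 0 ≤ ρ) (hR : ρ ≤ R)
    (z : sphere (0 : Eu n) 1) : x + ρ • (z : Eu n) ∈ closedBall x R := by
  have hz : ‖(z : Eu n)‖ = 1 := by simp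
  simpa [dist_eq_norm, norm_smul, hz, abs_of_nonneg hρ] using hR

theorem continuousOn_sphereIntegral {n : ℕ} {f : Eu n → ℝ} {x : Eu n} {R : ℝ}
    (hf : ContinuousOn f (closedBall x R)) :
    ContinuousOn (sphereIntegral f x) (Icc 0 R) := by
  unfold sphereIntegral
  refine (continuous_pow _).continuousOn.mul ?_
  rw [continuousOn_iff_continuous_domRestrict]
  have hc : Continuous (Function.uncurry fun (ρ : Icc (0 : ℝ) R) (z : sphere (0 : Eu n) 1) =>
      f (x + ρ.1 • (z : Eu n))) := by
    have h1 : Continuous fun p : Icc (0 : ℝ) R × sphere (0 : Eu n) 1 =>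
        x + p.1.1 • (p.2 : Eu n) := by fun_prop
    exact hf.comp_continuous h1 fun p => add_smul_mem_closedBall p.1.2.1 p.1.2.2 p.2
  have := continuous_parametric_integral_of_continuous
    (μ := (volume : Measure (Eu n)).toSphere) hc isCompact_univ
  simpa [Set.domRestrict_def] using this

theorem setIntegral_ball_eq {n : ℕ} [Nontrivial (Eu n)] {f : Eu n → ℝ} {x : Eu n} {r : ℝ}
    (hr : 0 ≤ r) (hf : ContinuousOn f (closedBall x r)) :
    ∫ y in ball x r, f y = ∫ ρ in (0 : ℝ)..r, sphereIntegral f x ρ := by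
  have hint : IntegrableOn f (ball x r) :=
    (hf.integrableOn_compact (isCompact_closedBall x r)).mono_set ball_subset_closedBall
  rw [← integral_indicator measurableSet_ball,
    integral_eq_integral_Ioi_sphereIntegral (hint.integrable_indicator measurableSet_ball) x,
    intervalIntegral.integral_of_le hr, ← integral_Ioc_eq_integral_Ioo.symm,
    ← integral_indicator measurableSet_Ioi, ← integral_indicator measurableSet_Ioo]
  congr 1
  ext ρ
  by_cases h0 : 0 < ρ
  · by_cases h1 : ρ < r
    · rw [indicator_of_mem (mem_Ioi.2 h0), indicator_of_mem (mem_Ioo.2 ⟨h0, h1⟩)]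
      refine sphereIntegral_congr h0.le fun y hy => indicator_of_mem ?_ _
      rw [mem_ball, hy]; exact h1
    · rw [indicator_of_mem (mem_Ioi.2 h0), indicator_of_notMem fun h => h1 h.2,
        sphereIntegral_congr (g := fun _ => 0) h0.le]
      · simp [sphereIntegral]
      · intro y hy
        refine indicator_of_notMem ?_ _
        rw [mem_ball, hy]; exact h1
  · rw [indicator_of_notMem (s := Ioi (0 : ℝ)) h0, indicator_of_notMem fun h => h0 h.1]

/-- In polar coordinates this is the fundamental theorem of calculus. The margin `r < R` gives
continuity of the spherical integral on both sides of `r`. -/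
theorem hasDerivAt_setIntegral_ball {n : ℕ} [Nontrivial (Eu n)] {f : Eu n → ℝ} {x : Eu n} {r R : ℝ}
    (hr : 0 < r) (hrR : r < R) (hf : ContinuousOn f (closedBall x R)) :
    HasDerivAt (fun ρ => ∫ y in ball x ρ, f y) (sphereIntegral f x r) r := by
  have hc := continuousOn_sphereIntegral hf
  have h1 : HasDerivAt (fun ρ => ∫ t in (0 : ℝ)..ρ, sphereIntegral f x t)
      (sphereIntegral f x r) r := by
    refine intervalIntegral.integral_hasDerivAt_right ?_ ?_ ?_
    · refine ContinuousOn.intervalIntegrable (hc.mono ?_)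
      rw [uIcc_of_le hr.le]
      exact Icc_subset_Icc le_rfl hrR.le
    · exact (hc.mono Ioo_subset_Icc_self).stronglyMeasurableAtFilter isOpen_Ioo r ⟨hr, hrR⟩
    · exact hc.continuousAt (Icc_mem_nhds hr hrR)
  refine h1.congr_of_eventuallyEq ?_
  filter_upwards [Ioo_mem_nhds hr hrR] with ρ hρ
  exact setIntegral_ball_eq hρ.1.le (hf.mono (closedBall_subset_closedBall hρ.2.le))

end CriticalYamabe

/-! ### Divergence, gradient and Laplacian. -/

namespace CriticalYamabe

open Set Metric

/-- Solutions are controlled only in `Ω`; multiplying by a cutoff makes them global, since off the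
support of the cutoff the product is locally zero. The case `k = 0` also serves for continuity. -/
theorem contDiff_smul_of_tsupport_subset {n : ℕ} {F : Type*} [NormedAddCommGroup F]
    [NormedSpace ℝ F] {k : WithTop ℕ∞} {Ω : Set (Eu n)} (hΩ : IsOpen Ω) {χ : Eu n → ℝ}
    (hχ : ContDiff ℝ k χ) (hs : tsupport χ ⊆ Ω) {f : Eu n → F} (hf : ContDiffOn ℝ k f Ω) :
    ContDiff ℝ k fun y => χ y • f y := by
  rw [contDiff_iff_contDiffAt]
  intro y
  by_cases hy : y ∈ tsupport χ
  · exact hχ.contDiffAt.smul (hf.contDiffAt (hΩ.mem_nhds (hs hy)))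
  · have : (fun y => χ y • f y) =ᶠ[𝓝 y] fun _ => 0 := by
      filter_upwards [notMem_tsupport_iff_eventuallyEq.1 hy] with z hz
      simp [hz]
    exact contDiffAt_const.congr_of_eventuallyEq this

/-- The divergence of a vector field on `ℝⁿ`. -/
noncomputable def divergence {n : ℕ} (F : Eu n → Eu n) (x : Eu n) : ℝ :=
  ∑ i, inner ℝ (EuclideanSpace.basisFun (Fin n) ℝ i)
    (fderiv ℝ F x (EuclideanSpace.basisFun (Fin n) ℝ i))

theorem inner_gradient {n : ℕ} (f : Eu n → ℝ) (x v : Eu n) :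
    inner ℝ (gradient f x) v = fderiv ℝ f x v := by
  rw [← toDual_gradient, InnerProductSpace.toDual_apply_apply]

theorem continuous_divergence {n : ℕ} {F : Eu n → Eu n} (hF : ContDiff ℝ 1 F) :
    Continuous (divergence F) := by
  unfold divergence
  have := hF.continuous_fderiv (by norm_num)
  fun_prop

theorem divergence_congr {n : ℕ} {F G : Eu n → Eu n} {x : Eu n} (h : F =ᶠ[𝓝 x] G) :
    divergence F x = divergence G x := by
  simp [divergence, h.fderiv_eq]

theorem divergence_eq_zero_of_notMem_tsupport {n : ℕ} {F : Eu n → Eu n} {x : Eu n}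
    (h : x ∉ tsupport F) : divergence F x = 0 := by
  rw [divergence_congr (G := fun _ => 0) (notMem_tsupport_iff_eventuallyEq.1 h)]
  simp [divergence]

theorem hasCompactSupport_divergence {n : ℕ} {F : Eu n → Eu n} (hF : HasCompactSupport F) :
    HasCompactSupport (divergence F) :=
  HasCompactSupport.intro hF fun _ hx => divergence_eq_zero_of_notMem_tsupport hx

theorem integrable_divergence {n : ℕ} {F : Eu n → Eu n} (hF : ContDiff ℝ 1 F)
    (hc : HasCompactSupport F) : Integrable (divergence F) :=
  (continuous_divergence hF).integrable_of_hasCompactSupport (hasCompactSupport_divergence hc)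

theorem integral_divergence_eq_zero {n : ℕ} {F : Eu n → Eu n} (hF : ContDiff ℝ 1 F)
    (hc : HasCompactSupport F) : ∫ x, divergence F x = 0 := by
  have hcont := hF.continuous_fderiv (by norm_num)
  have hint : ∀ v, Integrable fun x => fderiv ℝ F x v := fun v =>
    (hcont.clm_apply continuous_const).integrable_of_hasCompactSupport
      (hc.fderiv_apply (𝕜 := ℝ) v)
  have hz : ∀ v, ∫ x, fderiv ℝ F x v = 0 := by
    intro v
    -- Integration by parts against the constant function `1`.
    have := integral_smul_fderiv_eq_neg_fderiv_smul_of_integrable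
      (μ := (volume : Measure (Eu n))) (𝕜 := ℝ) (f := fun _ : Eu n => (1 : ℝ)) (g := F) (v := v)
      (by simp) (by simpa using hint v)
      (by simpa using hF.continuous.integrable_of_hasCompactSupport hc)
      (by simp) (fun x _ => (hF.differentiable (by norm_num)).differentiableAt)
    simpa using this
  unfold divergence
  rw [integral_finsetSum _ fun i _ => (hint _).const_inner _]
  refine Finset.sum_eq_zero fun i _ => ?_
  rw [integral_inner (hint _), hz, inner_zero_right]

theorem divergence_smul {n : ℕ} {ψ : Eu n → ℝ} {F : Eu n → Eu n} {x : Eu n}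
    (hψ : DifferentiableAt ℝ ψ x) (hF : DifferentiableAt ℝ F x) :
    divergence (fun y => ψ y • F y) x = ψ x * divergence F x + fderiv ℝ ψ x (F x) := by
  have h1 : fderiv ℝ ψ x (F x) = ∑ i, fderiv ℝ ψ x (EuclideanSpace.basisFun (Fin n) ℝ i) *
      inner ℝ (EuclideanSpace.basisFun (Fin n) ℝ i) (F x) := by
    conv_lhs => rw [← (EuclideanSpace.basisFun (Fin n) ℝ).sum_repr' (F x)]
    rw [map_sum]
    refine Finset.sum_congr rfl fun i _ => ?_
    rw [map_smul, smul_eq_mul, mul_comm]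
  unfold divergence
  rw [fderiv_fun_smul hψ hF, h1, Finset.mul_sum, ← Finset.sum_add_distrib]
  refine Finset.sum_congr rfl fun i _ => ?_
  rw [add_apply, smul_apply,
    ContinuousLinearMap.smulRight_apply, inner_add_right, inner_smul_right, inner_smul_right]

theorem divergence_sub {n : ℕ} {F G : Eu n → Eu n} {x : Eu n}
    (hF : DifferentiableAt ℝ F x) (hG : DifferentiableAt ℝ G x) :
    divergence (fun y => F y - G y) x = divergence F x - divergence G x := by
  unfold divergence
  rw [fderiv_fun_sub hF hG, ← Finset.sum_sub_distrib]
  exact Finset.sum_congr rfl fun i _ => by rw [sub_apply, inner_sub_right]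

theorem divergence_sub_const {n : ℕ} (x y : Eu n) : divergence (fun y => y - x) y = n := by
  simp [divergence, fderiv_sub_const]

theorem gradient_eq_sum {n : ℕ} (u : Eu n → ℝ) :
    gradient u = fun y => ∑ i, fderiv ℝ u y (EuclideanSpace.basisFun (Fin n) ℝ i) •
      EuclideanSpace.basisFun (Fin n) ℝ i := by
  ext1 y
  rw [← (EuclideanSpace.basisFun (Fin n) ℝ).sum_repr' (gradient u y)]
  refine Finset.sum_congr rfl fun i _ => ?_
  rw [real_inner_comm, inner_gradient]

theorem contDiffAt_gradient {n : ℕ} {u : Eu n → ℝ} {x : Eu n} (hu : ContDiffAt ℝ 2 u x) :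
    ContDiffAt ℝ 1 (gradient u) x := by
  rw [gradient_eq_sum]
  have := hu.fderiv_right (m := 1) (by norm_num)
  fun_prop

/-- Identifies the derivative of the gradient with the Hessian, so that symmetry of second
derivatives can be used in the Pohozaev computation and the trace is the Laplacian. -/
theorem inner_fderiv_gradient {n : ℕ} {u : Eu n → ℝ} {x : Eu n} (hu : ContDiffAt ℝ 2 u x)
    (v w : Eu n) : inner ℝ (fderiv ℝ (gradient u) x v) w = fderiv ℝ (fderiv ℝ u) x v w := by
  have hd : DifferentiableAt ℝ (fderiv ℝ u) x :=
    (hu.fderiv_right (m := 1) (by norm_num)).differentiableAt (by norm_num)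
  have hg := (contDiffAt_gradient hu).differentiableAt (by norm_num)
  have h1 : HasFDerivAt (fun y => inner ℝ (gradient u y) w)
      (fderiv ℝ (fun y => inner ℝ (gradient u y) w) x) x :=
    (hg.inner ℝ (differentiableAt_const w)).hasFDerivAt
  have h2 : fderiv ℝ (fun y => inner ℝ (gradient u y) w) x v =
      inner ℝ (fderiv ℝ (gradient u) x v) w := by
    rw [fderiv_inner_apply ℝ hg (differentiableAt_const w)]
    simp
  rw [← h2]
  simp only [inner_gradient]
  rw [fderiv_clm_apply hd (differentiableAt_const w)]
  simp

theorem divergence_gradient {n : ℕ} {u : Eu n → ℝ} {x : Eu n} (hu : ContDiffAt ℝ 2 u x) :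
    divergence (gradient u) x = Laplacian.laplacian u x := by
  rw [InnerProductSpace.laplacian_eq_iteratedFDeriv_orthonormalBasis u
    (EuclideanSpace.basisFun (Fin n) ℝ)]
  unfold divergence
  refine Finset.sum_congr rfl fun i _ => ?_
  rw [real_inner_comm, inner_fderiv_gradient hu, iteratedFDeriv_two_apply]
  simp

theorem continuous_sphereIntegral {n : ℕ} {f : Eu n → ℝ} (hf : Continuous f) (x : Eu n) :
    Continuous (sphereIntegral f x) := by
  unfold sphereIntegral
  refine (continuous_pow _).mul ?_
  have := continuous_parametric_integral_of_continuous
    (μ := (volume : Measure (Eu n)).toSphere)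
    (f := fun (ρ : ℝ) (z : sphere (0 : Eu n) 1) => f (x + ρ • (z : Eu n)))
    (by fun_prop) isCompact_univ
  simpa using this

theorem sphereIntegral_const_mul {n : ℕ} (c : ℝ) (f : Eu n → ℝ) (x : Eu n) (ρ : ℝ) :
    sphereIntegral (fun y => c * f y) x ρ = c * sphereIntegral f x ρ := by
  unfold sphereIntegral
  rw [integral_const_mul]
  ring

theorem sphereIntegral_radial_mul {n : ℕ} (h : ℝ → ℝ) (f : Eu n → ℝ) (x : Eu n) {ρ : ℝ}
    (hρ : 0 ≤ ρ) :
    sphereIntegral (fun y => h ‖y - x‖ * f y) x ρ = h ρ * sphereIntegral f x ρ := by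
  rw [← sphereIntegral_const_mul]
  refine sphereIntegral_congr hρ fun y hy => ?_
  rw [← dist_eq_norm, hy]

end CriticalYamabe

/-! ### The divergence theorem on balls, by radial test functions. -/

namespace CriticalYamabe

open Set Metric

theorem setIntegral_ball_eq_of_continuous {n : ℕ} [Nontrivial (Eu n)] {f : Eu n → ℝ} {x : Eu n}
    {r : ℝ} (hr : 0 ≤ r) (hf : Continuous f) :
    ∫ y in ball x r, f y = ∫ ρ in (0 : ℝ)..r, sphereIntegral f x ρ :=
  setIntegral_ball_eq hr hf.continuousOn

/-- The norm is not differentiable at its centre; a profile vanishing near `0` removes the problem.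
-/
theorem radial_primitive_eventuallyEq_zero {n : ℕ} {ψ : ℝ → ℝ} {δ : ℝ} (hδ : 0 < δ)
    (h0 : ∀ t, t < δ → ψ t = 0) (x : Eu n) :
    (fun y : Eu n => ∫ t in (0 : ℝ)..‖y - x‖, ψ t) =ᶠ[𝓝 x] fun _ => 0 := by
  filter_upwards [ball_mem_nhds x hδ] with z hz
  rw [mem_ball, dist_eq_norm] at hz
  refine intervalIntegral.integral_zero_ae (Eventually.of_forall fun t ht => h0 t ?_)
  rw [uIoc_of_le (norm_nonneg _)] at ht
  exact ht.2.trans_lt hz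

/-- A radial cutoff profile `t ↦ ∫₀ᵗ ψ` with `ψ` vanishing near `0`, composed with the distance to
`x`. -/
theorem contDiff_radial_primitive {n : ℕ} {ψ : ℝ → ℝ} (hψ : Continuous ψ) {δ : ℝ} (hδ : 0 < δ)
    (h0 : ∀ t, t < δ → ψ t = 0) (x : Eu n) :
    ContDiff ℝ 1 (fun y : Eu n => ∫ t in (0 : ℝ)..‖y - x‖, ψ t) := by
  have hΦ : ContDiff ℝ 1 fun s : ℝ => ∫ t in (0 : ℝ)..s, ψ t := by
    rw [contDiff_one_iff_deriv]
    have hd : ∀ s : ℝ, HasDerivAt (fun s : ℝ => ∫ t in (0 : ℝ)..s, ψ t) (ψ s) s := fun s =>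
      hψ.integral_hasStrictDerivAt 0 s |>.hasDerivAt
    refine ⟨fun s => (hd s).differentiableAt, ?_⟩
    rwa [show deriv (fun s : ℝ => ∫ t in (0 : ℝ)..s, ψ t) = ψ from funext fun s => (hd s).deriv]
  rw [contDiff_iff_contDiffAt]
  intro y
  by_cases hy : y = x
  · rw [hy]
    exact contDiffAt_const.congr_of_eventuallyEq (radial_primitive_eventuallyEq_zero hδ h0 x)
  · have hne : y - x ≠ 0 := sub_ne_zero.2 hy
    have h1 : ContDiffAt ℝ 1 (fun y : Eu n => ‖y - x‖) y :=
      (contDiffAt_norm ℝ hne).comp y (contDiffAt_id.sub contDiffAt_const)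
    exact hΦ.contDiffAt.comp y h1

theorem fderiv_radial_primitive {n : ℕ} {ψ : ℝ → ℝ} (hψ : Continuous ψ) {x y : Eu n}
    (hy : y ≠ x) (v : Eu n) :
    fderiv ℝ (fun y : Eu n => ∫ t in (0 : ℝ)..‖y - x‖, ψ t) y v =
      ψ ‖y - x‖ / ‖y - x‖ * inner ℝ v (y - x) := by
  have hne : y - x ≠ 0 := sub_ne_zero.2 hy
  have hn : ‖y - x‖ ≠ 0 := norm_ne_zero_iff.2 hne
  have h1 : HasFDerivAt (fun y : Eu n => ‖y - x‖ ^ 2)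
      (2 • (innerSL ℝ (y - x)).comp (ContinuousLinearMap.id ℝ (Eu n))) y :=
    ((hasFDerivAt_id y).sub_const x).norm_sq
  have h2 : HasFDerivAt (fun y : Eu n => Real.sqrt (‖y - x‖ ^ 2)) _ y :=
    h1.sqrt (pow_ne_zero 2 hn)
  simp only [Real.sqrt_sq (norm_nonneg _)] at h2
  have h3 := (hψ.integral_hasStrictDerivAt 0 ‖y - x‖).hasDerivAt.comp_hasFDerivAt y h2
  have h4 : (fun y : Eu n => ∫ t in (0 : ℝ)..‖y - x‖, ψ t) =
      (fun s : ℝ => ∫ t in (0 : ℝ)..s, ψ t) ∘ fun y => ‖y - x‖ := rfl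
  rw [h4, h3.fderiv]
  change ψ ‖y - x‖ * (1 / (2 * ‖y - x‖) * (2 • inner ℝ (y - x) v)) = _
  rw [real_inner_comm v, nsmul_eq_mul]
  push_cast
  field_simp

/-- Testing the divergence of a compactly supported field against a radial function. -/
theorem integral_radial_divergence {n : ℕ} [Nontrivial (Eu n)] {F : Eu n → Eu n}
    (hF : ContDiff ℝ 1 F) (hc : HasCompactSupport F) (x : Eu n) {ψ : ℝ → ℝ} (hψ : Continuous ψ)
    {δ : ℝ} (hδ : 0 < δ) (h0 : ∀ t, t < δ → ψ t = 0) :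
    (∫ ρ in Ioi (0 : ℝ), (∫ t in (0 : ℝ)..ρ, ψ t) * sphereIntegral (divergence F) x ρ) +
      ∫ ρ in Ioi (0 : ℝ), ψ ρ *
        (sphereIntegral (fun y => inner ℝ (F y) (y - x)) x ρ / ρ) = 0 := by
  obtain ⟨φ, hφ⟩ : ∃ φ : Eu n → ℝ, φ = fun y => ∫ t in (0 : ℝ)..‖y - x‖, ψ t := ⟨_, rfl⟩
  have hrad : ContDiff ℝ 1 φ := hφ ▸ contDiff_radial_primitive hψ hδ h0 x
  have hV : ContDiff ℝ 1 fun y => φ y • F y := hrad.smul hF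
  have hVc : HasCompactSupport fun y => φ y • F y :=
    hc.mono fun y hy h => hy (by simp only [h, smul_zero])
  have hdiv := integral_divergence_eq_zero hV hVc
  have hi1 : Integrable fun y => φ y * divergence F y :=
    (hrad.continuous.mul (continuous_divergence hF)).integrable_of_hasCompactSupport
      (hasCompactSupport_divergence hc).mul_left
  have heq : ∀ y, divergence (fun y => φ y • F y) y =
      φ y * divergence F y + ψ ‖y - x‖ / ‖y - x‖ * inner ℝ (F y) (y - x) := by
    intro y
    rw [divergence_smul (hrad.differentiable (by norm_num) y)
      (hF.differentiable (by norm_num) y)]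
    congr 1
    by_cases hy : y = x
    · have h1 := (radial_primitive_eventuallyEq_zero hδ h0 x).fderiv_eq (𝕜 := ℝ)
      rw [hy, hφ, h1]
      simp
    · rw [hφ]
      exact fderiv_radial_primitive hψ hy _
  have hi2 : Integrable fun y => ψ ‖y - x‖ / ‖y - x‖ * inner ℝ (F y) (y - x) := by
    refine ((integrable_divergence hV hVc).sub hi1).congr (Eventually.of_forall fun y => ?_)
    simp only [Pi.sub_apply]
    rw [heq y]
    ring
  rw [integral_congr_ae (Eventually.of_forall heq), integral_add hi1 hi2,
    integral_eq_integral_Ioi_sphereIntegral hi1 x,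
    integral_eq_integral_Ioi_sphereIntegral hi2 x] at hdiv
  refine Eq.trans ?_ hdiv
  subst hφ
  congr 1
  · refine setIntegral_congr_fun measurableSet_Ioi fun ρ hρ => ?_
    exact (sphereIntegral_radial_mul (fun s => ∫ t in (0 : ℝ)..s, ψ t) _ x (le_of_lt hρ)).symm
  · refine setIntegral_congr_fun measurableSet_Ioi fun ρ hρ => ?_
    have := sphereIntegral_radial_mul (fun t => ψ t / t)
      (fun y => inner ℝ (F y) (y - x)) x (le_of_lt hρ)
    beta_reduce at this ⊢
    rw [this]
    ring

/-- The divergence theorem on balls for compactly supported fields. -/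
theorem sphereIntegral_inner_of_hasCompactSupport {n : ℕ} [Nontrivial (Eu n)] {F : Eu n → Eu n}
    (hF : ContDiff ℝ 1 F) (hc : HasCompactSupport F) (x : Eu n) {r : ℝ} (hr : 0 < r) :
    sphereIntegral (fun y => inner ℝ (F y) (y - x)) x r = r * ∫ y in ball x r, divergence F y := by
  set T : ℝ → ℝ := sphereIntegral (fun y => inner ℝ (F y) (y - x)) x with hT
  set S : ℝ → ℝ := sphereIntegral (divergence F) x with hS
  set D : ℝ → ℝ := fun ρ => ∫ t in (0 : ℝ)..ρ, S t with hD
  have hFc := hF.continuous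
  have hTc : Continuous T := continuous_sphereIntegral (by fun_prop) x
  have hSc : Continuous S := continuous_sphereIntegral (continuous_divergence hF) x
  have hDd : ∀ ρ, HasDerivAt D (S ρ) ρ := fun ρ => (hSc.integral_hasStrictDerivAt 0 ρ).hasDerivAt
  have hDc : Continuous D := continuous_iff_continuousAt.2 fun ρ => (hDd ρ).continuousAt
  obtain ⟨M₀, hM₀⟩ := hc.isCompact.isBounded.subset_ball x
  -- Large enough that `F` lives in `B(x,M)` and that `r` is interior to `(0,M)`.
  set M : ℝ := max M₀ (r + 1) with hM
  have hrM : r < M := by have := le_max_right M₀ (r + 1); linarith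
  have hM0 : 0 < M := hr.trans hrM
  have hsub : tsupport F ⊆ ball x M := hM₀.trans (ball_subset_ball (le_max_left _ _))
  -- The total divergence integrates to zero; this kills the boundary term at `M` in the integration
  -- by parts `e3`.
  have hDM : D M = 0 := by
    rw [hD]
    simp only [hS]
    rw [← setIntegral_ball_eq_of_continuous hM0.le (continuous_divergence hF),
      setIntegral_eq_integral_of_forall_compl_eq_zero, integral_divergence_eq_zero hF hc]
    exact fun y hy => divergence_eq_zero_of_notMem_tsupport fun h => hy (hsub h)
  have hS0 : ∀ ρ, M ≤ ρ → S ρ = 0 := by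
    intro ρ hρ
    rw [hS, sphereIntegral_congr (g := fun _ => 0) (hM0.le.trans hρ)]
    · simp [sphereIntegral]
    · intro y hy
      refine divergence_eq_zero_of_notMem_tsupport fun h => ?_
      have := hsub h
      rw [mem_ball, hy] at this
      linarith
  -- The claim `T r = r * D r` is first proved weakly: `T t / t - D t` is orthogonal to every test
  -- function on `(0,M)`. It then vanishes almost everywhere, hence everywhere by continuity.
  have key : ∀ ψ : ℝ → ℝ, ContDiff ℝ ∞ ψ → HasCompactSupport ψ → tsupport ψ ⊆ Ioo 0 M →
      ∫ t, ψ t • (T t / t - D t) = 0 := by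
    intro ψ hψ hψc hψs
    have hψcont := hψ.continuous
    obtain ⟨δ, hδ, h0⟩ : ∃ δ > 0, ∀ t, t < δ → ψ t = 0 := by
      by_cases hne : (tsupport ψ).Nonempty
      · obtain ⟨m, hm, hmin⟩ := hψc.isCompact.exists_isMinOn hne continuousOn_id
        refine ⟨m, (hψs hm).1, fun t ht => ?_⟩
        by_contra hne
        exact absurd (hmin (subset_tsupport _ hne)) (not_le.2 ht)
      · refine ⟨1, one_pos, fun t _ => ?_⟩
        by_contra hne'
        exact hne ⟨t, subset_tsupport _ hne'⟩
    have hψM : ∀ t, M ≤ t → ψ t = 0 := fun t ht => by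
      by_contra hne
      exact absurd (hψs (subset_tsupport _ hne)).2 (not_lt.2 ht)
    set Φ : ℝ → ℝ := fun s => ∫ t in (0 : ℝ)..s, ψ t with hΦ
    have hΦd : ∀ s, HasDerivAt Φ (ψ s) s := fun s =>
      (hψcont.integral_hasStrictDerivAt 0 s).hasDerivAt
    have hΦc : Continuous Φ := continuous_iff_continuousAt.2 fun ρ => (hΦd ρ).continuousAt
    have hdiv := integral_radial_divergence hF hc x hψcont hδ h0
    have e1 : ∫ ρ in Ioi (0 : ℝ), Φ ρ * S ρ = ∫ ρ in (0 : ℝ)..M, Φ ρ * S ρ := by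
      rw [intervalIntegral.integral_of_le hM0.le]
      refine (setIntegral_eq_of_subset_of_forall_sdiff_eq_zero measurableSet_Ioi
        Ioc_subset_Ioi_self fun ρ hρ => ?_)
      rw [hS0 ρ, mul_zero]
      by_contra h
      exact hρ.2 ⟨hρ.1, (not_le.1 h).le⟩
    have e2 : ∫ ρ in Ioi (0 : ℝ), ψ ρ * (T ρ / ρ) = ∫ ρ in (0 : ℝ)..M, ψ ρ * (T ρ / ρ) := by
      rw [intervalIntegral.integral_of_le hM0.le]
      refine (setIntegral_eq_of_subset_of_forall_sdiff_eq_zero measurableSet_Ioi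
        Ioc_subset_Ioi_self fun ρ hρ => ?_)
      rw [hψM ρ, zero_mul]
      by_contra h
      exact hρ.2 ⟨hρ.1, (not_le.1 h).le⟩
    have e3 : ∫ ρ in (0 : ℝ)..M, Φ ρ * S ρ = -∫ ρ in (0 : ℝ)..M, ψ ρ * D ρ := by
      rw [intervalIntegral.integral_mul_deriv_eq_deriv_mul (fun s _ => hΦd s) (fun s _ => hDd s)
        (hψcont.intervalIntegrable _ _) (hSc.intervalIntegrable _ _), hDM]
      simp [hD]
    -- Since `ψ` vanishes below `δ`, the singular quotient by `t` may be replaced by a continuous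
    -- one.
    have hquot : ∀ t, ψ t * (T t / t) = (ψ t / max t δ) * T t := by
      intro t
      by_cases ht : t < δ
      · simp [h0 t ht]
      · rw [max_eq_left (not_lt.1 ht)]; ring
    have hqc : Continuous fun t => ψ t * (T t / t) := by
      simp_rw [hquot]
      refine (hψcont.div (by fun_prop) fun t => ?_).mul hTc
      exact (lt_of_lt_of_le hδ (le_max_right _ _)).ne'
    rw [e1, e2, e3] at hdiv
    have e4 : ∫ t, ψ t • (T t / t - D t) = ∫ ρ in (0 : ℝ)..M, (ψ ρ * (T ρ / ρ) - ψ ρ * D ρ) := by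
      rw [intervalIntegral.integral_of_le hM0.le, ← setIntegral_eq_integral_of_forall_compl_eq_zero
        (s := Ioc 0 M)]
      · simp only [smul_eq_mul, mul_sub]
      · intro t ht
        by_cases h : t ≤ 0
        · rw [h0 t (h.trans_lt hδ), zero_smul]
        · rw [hψM t, zero_smul]
          by_contra h'
          exact ht ⟨not_le.1 h, (not_le.1 h').le⟩
    rw [e4, intervalIntegral.integral_sub (hqc.intervalIntegrable _ _)
      ((show Continuous fun t => ψ t * D t from hψcont.mul hDc).intervalIntegrable _ _)]
    linarith
  have hHc : ContinuousOn (fun t => T t / t - D t) (Ioo 0 M) :=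
    (hTc.continuousOn.div continuousOn_id fun t ht => ht.1.ne').sub hDc.continuousOn
  have hae := isOpen_Ioo.ae_eq_zero_of_integral_contDiff_smul_eq_zero
    (hHc.locallyIntegrableOn measurableSet_Ioo) key
  have heq : EqOn (fun t => T t / t - D t) (fun _ => 0) (Ioo 0 M) := by
    refine Measure.eqOn_open_of_ae_eq (μ := volume) ?_ isOpen_Ioo hHc continuousOn_const
    rw [EventuallyEq, ae_restrict_iff' measurableSet_Ioo]
    exact hae
  have hfin : T r / r - D r = 0 := heq ⟨hr, hrM⟩
  rw [setIntegral_ball_eq_of_continuous hr.le (continuous_divergence hF)]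
  change T r = r * D r
  field_simp at hfin
  linarith

/-- The divergence theorem on balls. -/
theorem sphereIntegral_inner_eq {n : ℕ} [Nontrivial (Eu n)] {F : Eu n → Eu n} {Ω : Set (Eu n)}
    (hΩ : IsOpen Ω) (hF : ContDiffOn ℝ 1 F Ω) {x : Eu n} {r : ℝ} (hr : 0 < r)
    (hsub : closedBall x r ⊆ Ω) :
    sphereIntegral (fun y => inner ℝ (F y) (y - x)) x r = r * ∫ y in ball x r, divergence F y := by
  obtain ⟨δ, hδ, hδs⟩ := (isCompact_closedBall x r).exists_cthickening_subset_open hΩ hsub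
  rw [cthickening_closedBall hδ.le hr.le] at hδs
  let χ : ContDiffBump x := ⟨r + δ / 3, r + δ / 2, by positivity, by linarith⟩
  have hχs : tsupport χ ⊆ Ω := by
    rw [χ.tsupport_eq]
    exact (closedBall_subset_closedBall (by change r + δ / 2 ≤ δ + r; linarith)).trans hδs
  have hG : ContDiff ℝ 1 fun y => χ y • F y :=
    contDiff_smul_of_tsupport_subset hΩ χ.contDiff hχs hF
  have hGeq : ∀ y ∈ closedBall x r, (fun y => χ y • F y) =ᶠ[𝓝 y] F := by
    intro y hy
    have : ball x (r + δ / 3) ∈ 𝓝 y := isOpen_ball.mem_nhds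
      (closedBall_subset_ball (by linarith) hy)
    filter_upwards [this] with z hz
    rw [χ.one_of_mem_closedBall (ball_subset_closedBall hz), one_smul]
  have h := sphereIntegral_inner_of_hasCompactSupport hG χ.hasCompactSupport.smul_right x hr
  rw [setIntegral_congr_fun measurableSet_ball fun y hy =>
    divergence_congr (hGeq y (ball_subset_closedBall hy))] at h
  rw [← h]
  refine sphereIntegral_congr hr.le fun y hy => ?_
  rw [(hGeq y (mem_closedBall.2 hy.le)).eq_of_nhds]

end CriticalYamabe

/-! ### Pointwise identities for solutions: the fields `u ∇u` and Pohozaev's. -/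

namespace CriticalYamabe

open Set Metric

theorem nontrivial_eu {n : ℕ} (hn : 3 ≤ n) : Nontrivial (Eu n) := by
  have : Nonempty (Fin n) := ⟨⟨0, by omega⟩⟩
  infer_instance

theorem natCast_sub_two_pos {n : ℕ} (hn : 3 ≤ n) : (0 : ℝ) < (n : ℝ) - 2 := by
  have : (3 : ℝ) ≤ n := by exact_mod_cast hn
  linarith

theorem two_lt_critExp {n : ℕ} (hn : 3 ≤ n) : 2 < critExp n := by
  have := natCast_sub_two_pos hn
  rw [critExp, lt_div_iff₀ this]
  linarith

theorem critExp_pos {n : ℕ} (hn : 3 ≤ n) : 0 < critExp n := by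
  linarith [two_lt_critExp hn]

theorem critExp_sub_two {n : ℕ} (hn : 3 ≤ n) : critExp n - 2 = 4 / ((n : ℝ) - 2) := by
  have := natCast_sub_two_pos hn
  rw [critExp]
  field_simp
  ring

theorem coeff_mul_critExp {n : ℕ} (hn : 3 ≤ n) : ((n : ℝ) - 2) / (2 * n) * critExp n = 1 := by
  have := natCast_sub_two_pos hn
  have h2 : (0 : ℝ) < n := by linarith
  rw [critExp]
  field_simp

theorem IsSmoothSolution.contDiffAt {n : ℕ} {Ω : Set (Eu n)} {u : Eu n → ℝ}
    (hu : IsSmoothSolution Ω u) (hΩ : IsOpen Ω) {y : Eu n} (hy : y ∈ Ω) : ContDiffAt ℝ ∞ u y :=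
  hu.smooth.contDiffAt (hΩ.mem_nhds hy)

theorem IsSmoothSolution.contDiffAt_two {n : ℕ} {Ω : Set (Eu n)} {u : Eu n → ℝ}
    (hu : IsSmoothSolution Ω u) (hΩ : IsOpen Ω) {y : Eu n} (hy : y ∈ Ω) : ContDiffAt ℝ 2 u y :=
  (hu.contDiffAt hΩ hy).of_le (by norm_cast)

theorem IsSmoothSolution.contDiffAt_one {n : ℕ} {Ω : Set (Eu n)} {u : Eu n → ℝ}
    (hu : IsSmoothSolution Ω u) (hΩ : IsOpen Ω) {y : Eu n} (hy : y ∈ Ω) : ContDiffAt ℝ 1 u y :=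
  (hu.contDiffAt hΩ hy).of_le (by exact_mod_cast le_top)

theorem IsSmoothSolution.contDiffOn_gradient {n : ℕ} {Ω : Set (Eu n)} {u : Eu n → ℝ}
    (hu : IsSmoothSolution Ω u) (hΩ : IsOpen Ω) : ContDiffOn ℝ 1 (gradient u) Ω :=
  fun _ hy => (contDiffAt_gradient (hu.contDiffAt_two hΩ hy)).contDiffWithinAt

theorem IsSmoothSolution.continuousOn_gradient {n : ℕ} {Ω : Set (Eu n)} {u : Eu n → ℝ}
    (hu : IsSmoothSolution Ω u) (hΩ : IsOpen Ω) : ContinuousOn (gradient u) Ω :=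
  (hu.contDiffOn_gradient hΩ).continuousOn

/-- The Lagrangian density `½|∇u|² - (n-2)/(2n) |u|^{2n/(n-2)}`. -/
noncomputable def lagrangian {n : ℕ} (u : Eu n → ℝ) (y : Eu n) : ℝ :=
  1 / 2 * ‖gradient u y‖ ^ 2 - ((n : ℝ) - 2) / (2 * n) * |u y| ^ critExp n

theorem hasFDerivAt_abs_rpow_comp {n : ℕ} {u : Eu n → ℝ} {y : Eu n} {s : ℝ} (hs : 1 < s)
    (hu : DifferentiableAt ℝ u y) :
    HasFDerivAt (fun z => |u z| ^ s) ((s * |u y| ^ (s - 2) * u y) • fderiv ℝ u y) y :=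
  (hasDerivAt_abs_rpow (u y) hs).comp_hasFDerivAt y hu.hasFDerivAt

theorem contDiffAt_abs_rpow_comp {n : ℕ} {u : Eu n → ℝ} {y : Eu n} {s : ℝ} (hs : 1 < s)
    (hu : ContDiffAt ℝ 1 u y) : ContDiffAt ℝ 1 (fun z => |u z| ^ s) y := by
  have := (contDiff_norm_rpow (E := ℝ) hs).contDiffAt (x := u y)
  exact this.comp y hu

theorem IsSmoothSolution.contDiffAt_lagrangian {n : ℕ} (hn : 3 ≤ n) {Ω : Set (Eu n)}
    {u : Eu n → ℝ} (hu : IsSmoothSolution Ω u) (hΩ : IsOpen Ω) {y : Eu n} (hy : y ∈ Ω) :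
    ContDiffAt ℝ 1 (lagrangian u) y := by
  have h1 := contDiffAt_gradient (hu.contDiffAt_two hΩ hy)
  have h2 := contDiffAt_abs_rpow_comp (s := critExp n) (by linarith [two_lt_critExp hn])
    (hu.contDiffAt_one hΩ hy)
  unfold lagrangian
  exact (contDiffAt_const.mul (h1.norm_sq ℝ)).sub (contDiffAt_const.mul h2)

theorem IsSmoothSolution.fderiv_lagrangian {n : ℕ} (hn : 3 ≤ n) {Ω : Set (Eu n)}
    {u : Eu n → ℝ} (hu : IsSmoothSolution Ω u) (hΩ : IsOpen Ω) {y : Eu n} (hy : y ∈ Ω)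
    (v : Eu n) : fderiv ℝ (lagrangian u) y v = inner ℝ (fderiv ℝ (gradient u) y v) (gradient u y) -
      u y * |u y| ^ (4 / ((n : ℝ) - 2)) * inner ℝ (gradient u y) v := by
  have h1 := ((contDiffAt_gradient (hu.contDiffAt_two hΩ hy)).differentiableAt
    (by norm_num)).hasFDerivAt
  have h2 := hasFDerivAt_abs_rpow_comp (s := critExp n) (by linarith [two_lt_critExp hn])
    ((hu.contDiffAt_one hΩ hy).differentiableAt (by norm_num))
  have h3 := (h1.norm_sq.const_mul (1 / 2)).sub (h2.const_mul (((n : ℝ) - 2) / (2 * n)))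
  have h4 : HasFDerivAt (lagrangian u) _ y := h3
  rw [h4.fderiv, inner_gradient, critExp_sub_two hn]
  change 1 / 2 * (2 • inner ℝ (gradient u y) (fderiv ℝ (gradient u) y v)) -
    ((n : ℝ) - 2) / (2 * n) *
      ((critExp n * |u y| ^ (4 / ((n : ℝ) - 2)) * u y) * fderiv ℝ u y v) = _
  rw [real_inner_comm (gradient u y), nsmul_eq_mul]
  push_cast
  linear_combination (-(|u y| ^ (4 / ((n : ℝ) - 2)) * u y) * fderiv ℝ u y v) * coeff_mul_critExp hn

theorem mul_abs_rpow_mul_self {n : ℕ} (hn : 3 ≤ n) (t : ℝ) :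
    t * |t| ^ (4 / ((n : ℝ) - 2)) * t = |t| ^ critExp n := by
  have h := critExp_sub_two hn
  have h2 := two_lt_critExp hn
  by_cases ht : t = 0
  · simp [ht, Real.zero_rpow (critExp_pos hn).ne']
  · have hp : 0 < |t| := abs_pos.2 ht
    rw [show critExp n = 4 / ((n : ℝ) - 2) + 2 by linarith, Real.rpow_add hp]
    norm_num
    ring

theorem IsSmoothSolution.divergence_smul_gradient {n : ℕ} (hn : 3 ≤ n) {Ω : Set (Eu n)}
    {u : Eu n → ℝ} (hu : IsSmoothSolution Ω u) (hΩ : IsOpen Ω) {y : Eu n} (hy : y ∈ Ω) :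
    divergence (fun z => u z • gradient u z) y = ‖gradient u y‖ ^ 2 - |u y| ^ critExp n := by
  have h2 := hu.contDiffAt_two hΩ hy
  rw [divergence_smul (h2.differentiableAt (by norm_num))
    ((contDiffAt_gradient h2).differentiableAt (by norm_num)), divergence_gradient h2,
    ← inner_gradient, real_inner_self_eq_norm_sq, ← mul_abs_rpow_mul_self hn]
  linear_combination (-u y) * hu.equation y hy

/-- The vector field whose divergence gives the Pohozaev identity. -/
noncomputable def pohozaevField {n : ℕ} (u : Eu n → ℝ) (x y : Eu n) : Eu n :=
  inner ℝ (gradient u y) (y - x) • gradient u y - lagrangian u y • (y - x)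

theorem IsSmoothSolution.contDiffOn_pohozaevField {n : ℕ} (hn : 3 ≤ n) {Ω : Set (Eu n)}
    {u : Eu n → ℝ} (hu : IsSmoothSolution Ω u) (hΩ : IsOpen Ω) (x : Eu n) :
    ContDiffOn ℝ 1 (pohozaevField u x) Ω := by
  intro y hy
  have h1 := contDiffAt_gradient (hu.contDiffAt_two hΩ hy)
  have h2 := hu.contDiffAt_lagrangian hn hΩ hy
  have h3 : ContDiffAt ℝ 1 (fun y => y - x) y := contDiffAt_id.sub contDiffAt_const
  exact (((h1.inner ℝ h3).smul h1).sub (h2.smul h3)).contDiffWithinAt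

/-- The two Hessian terms cancel by symmetry, and the terms containing `Δu` and the nonlinearity
cancel by the equation. What is left is `|∇u|² - n L`, where `L` is the Lagrangian density.
Criticality of the exponent makes this a multiple of the divergence of `u ∇u`. -/
theorem IsSmoothSolution.divergence_pohozaevField {n : ℕ} (hn : 3 ≤ n) {Ω : Set (Eu n)}
    {u : Eu n → ℝ} (hu : IsSmoothSolution Ω u) (hΩ : IsOpen Ω) (x : Eu n) {y : Eu n}
    (hy : y ∈ Ω) : divergence (pohozaevField u x) y =
      -(((n : ℝ) - 2) / 2) * (‖gradient u y‖ ^ 2 - |u y| ^ critExp n) := by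
  have hu2 := hu.contDiffAt_two hΩ hy
  have h1 := (contDiffAt_gradient hu2).differentiableAt (by norm_num)
  have h2 := (hu.contDiffAt_lagrangian hn hΩ hy).differentiableAt (by norm_num)
  have h3 : DifferentiableAt ℝ (fun y => y - x) y := differentiableAt_id.sub_const x
  have h4 : DifferentiableAt ℝ (fun y => inner ℝ (gradient u y) (y - x)) y := h1.inner ℝ h3
  have hsymm : inner ℝ (fderiv ℝ (gradient u) y (gradient u y)) (y - x) =
      inner ℝ (fderiv ℝ (gradient u) y (y - x)) (gradient u y) := by
    rw [inner_fderiv_gradient hu2, inner_fderiv_gradient hu2]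
    exact hu2.isSymmSndFDerivAt (by simp) _ _
  have h5 : DifferentiableAt ℝ (fun y => inner ℝ (gradient u y) (y - x) • gradient u y) y :=
    h4.smul h1
  have h6 : DifferentiableAt ℝ (fun y => lagrangian u y • (y - x)) y := h2.smul h3
  unfold pohozaevField
  rw [divergence_sub h5 h6, divergence_smul h4 h1, divergence_smul h2 h3,
    divergence_gradient hu2, divergence_sub_const, hu.fderiv_lagrangian hn hΩ hy,
    fderiv_inner_apply ℝ h1 h3, fderiv_sub_const, hsymm]
  simp only [fderiv_fun_id, ContinuousLinearMap.id_apply, real_inner_self_eq_norm_sq]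
  have hL : Laplacian.laplacian u y = -(u y * |u y| ^ (4 / ((n : ℝ) - 2))) := by
    linarith [hu.equation y hy]
  have hn2 := natCast_sub_two_pos hn
  have hn0 : (n : ℝ) ≠ 0 := by linarith
  rw [hL, lagrangian]
  field_simp
  ring

end CriticalYamabe

/-! ### The Pohozaev identity and the monotonicity formula. -/

namespace CriticalYamabe

open Set Metric

theorem integrable_sphere {n : ℕ} {f : Eu n → ℝ} {x : Eu n} {r : ℝ} (hr : 0 ≤ r)
    (hf : ContinuousOn f (closedBall x r)) :
    Integrable (fun z : sphere (0 : Eu n) 1 => f (x + r • (z : Eu n)))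
      ((volume : Measure (Eu n)).toSphere) := by
  have hc : Continuous fun z : sphere (0 : Eu n) 1 => f (x + r • (z : Eu n)) :=
    hf.comp_continuous (by fun_prop) fun z => add_smul_mem_closedBall hr le_rfl z
  rw [← integrableOn_univ]
  exact hc.continuousOn.integrableOn_compact isCompact_univ

theorem sphereIntegral_add {n : ℕ} {f g : Eu n → ℝ} {x : Eu n} {r : ℝ} (hr : 0 ≤ r)
    (hf : ContinuousOn f (closedBall x r)) (hg : ContinuousOn g (closedBall x r)) :
    sphereIntegral (fun y => f y + g y) x r = sphereIntegral f x r + sphereIntegral g x r := by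
  unfold sphereIntegral
  rw [integral_add (integrable_sphere hr hf) (integrable_sphere hr hg), mul_add]

theorem sphereIntegral_nonneg {n : ℕ} {f : Eu n → ℝ} {x : Eu n} {r : ℝ} (hr : 0 ≤ r)
    (hf : ∀ y, 0 ≤ f y) : 0 ≤ sphereIntegral f x r :=
  mul_nonneg (pow_nonneg hr _) (integral_nonneg fun _ => hf _)

section Identities

variable {n : ℕ} {Ω : Set (Eu n)} {u : Eu n → ℝ} {x : Eu n} {r R : ℝ}

/-- `u (y - x)·∇u`. -/
noncomputable def radialProduct (u : Eu n → ℝ) (x y : Eu n) : ℝ :=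
  u y * inner ℝ (gradient u y) (y - x)

/-- `((y - x)·∇u)²`. -/
noncomputable def radialSquare (u : Eu n → ℝ) (x y : Eu n) : ℝ :=
  inner ℝ (gradient u y) (y - x) ^ 2

theorem IsSmoothSolution.continuousOn (hu : IsSmoothSolution Ω u) : ContinuousOn u Ω :=
  hu.smooth.continuousOn

theorem IsSmoothSolution.continuousOn_sq (hu : IsSmoothSolution Ω u) :
    ContinuousOn (fun y => u y ^ 2) Ω :=
  hu.continuousOn.pow 2

theorem IsSmoothSolution.continuousOn_abs_rpow (hn : 3 ≤ n) (hu : IsSmoothSolution Ω u) :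
    ContinuousOn (fun y => |u y| ^ critExp n) Ω :=
  hu.continuousOn.abs.rpow_const fun _ _ => Or.inr (critExp_pos hn).le

theorem IsSmoothSolution.continuousOn_radialProduct (hu : IsSmoothSolution Ω u) (hΩ : IsOpen Ω) :
    ContinuousOn (radialProduct u x) Ω :=
  hu.continuousOn.mul (ContinuousOn.inner (𝕜 := ℝ) (hu.continuousOn_gradient hΩ)
    (continuous_id.sub continuous_const).continuousOn)

theorem IsSmoothSolution.continuousOn_radialSquare (hu : IsSmoothSolution Ω u) (hΩ : IsOpen Ω) :
    ContinuousOn (radialSquare u x) Ω :=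
  (ContinuousOn.inner (𝕜 := ℝ) (hu.continuousOn_gradient hΩ)
    (continuous_id.sub continuous_const).continuousOn).pow 2

theorem IsSmoothSolution.continuousOn_lagrangian (hn : 3 ≤ n) (hu : IsSmoothSolution Ω u)
    (hΩ : IsOpen Ω) : ContinuousOn (lagrangian u) Ω :=
  fun _ hy => (hu.contDiffAt_lagrangian hn hΩ hy).continuousAt.continuousWithinAt

theorem IsSmoothSolution.sphereIntegral_radialProduct (hn : 3 ≤ n) (hu : IsSmoothSolution Ω u)
    (hΩ : IsOpen Ω) (hr : 0 < r) (hsub : closedBall x r ⊆ Ω) :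
    sphereIntegral (radialProduct u x) x r =
      r * ∫ y in ball x r, (‖gradient u y‖ ^ 2 - |u y| ^ critExp n) := by
  have := nontrivial_eu hn
  have hF : ContDiffOn ℝ 1 (fun z => u z • gradient u z) Ω :=
    (hu.smooth.of_le (by norm_cast)).smul (hu.contDiffOn_gradient hΩ)
  have h := sphereIntegral_inner_eq hΩ hF hr hsub
  rw [setIntegral_congr_fun measurableSet_ball fun y hy =>
    hu.divergence_smul_gradient hn hΩ (hsub (ball_subset_closedBall hy))] at h
  rw [← h]
  refine sphereIntegral_congr hr.le fun y _ => ?_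
  rw [real_inner_smul_left, radialProduct]

/-- The Pohozaev field and `u ∇u` have proportional divergences, so the ball integrals can be
eliminated and only spherical integrals remain. -/
theorem IsSmoothSolution.pohozaev_identity (hn : 3 ≤ n) (hu : IsSmoothSolution Ω u)
    (hΩ : IsOpen Ω) (hr : 0 < r) (hsub : closedBall x r ⊆ Ω) :
    sphereIntegral (radialSquare u x) x r - r ^ 2 * sphereIntegral (lagrangian u) x r =
      -(((n : ℝ) - 2) / 2) * sphereIntegral (radialProduct u x) x r := by
  have := nontrivial_eu hn
  have h := sphereIntegral_inner_eq hΩ (hu.contDiffOn_pohozaevField hn hΩ x) hr hsub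
  rw [setIntegral_congr_fun measurableSet_ball fun y hy =>
    hu.divergence_pohozaevField hn hΩ x (hsub (ball_subset_closedBall hy)),
    integral_const_mul] at h
  rw [hu.sphereIntegral_radialProduct hn hΩ hr hsub]
  have h1 : sphereIntegral (fun y => inner ℝ (pohozaevField u x y) (y - x)) x r =
      sphereIntegral (fun y => radialSquare u x y + (-r ^ 2) * lagrangian u y) x r := by
    refine sphereIntegral_congr hr.le fun y hy => ?_
    rw [pohozaevField, inner_sub_left, real_inner_smul_left, real_inner_smul_left,
      real_inner_self_eq_norm_sq, ← dist_eq_norm, hy, radialSquare]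
    ring
  have hc : ContinuousOn (fun y => -r ^ 2 * lagrangian u y) (closedBall x r) :=
    continuousOn_const.mul ((hu.continuousOn_lagrangian hn hΩ).mono hsub)
  rw [h1, sphereIntegral_add hr.le ((hu.continuousOn_radialSquare hΩ).mono hsub) hc,
    sphereIntegral_const_mul] at h
  linarith

/-- Divergence theorem for `u² (y - x)`. It turns the boundary mass into a ball integral, whose
derivative in the radius is already known. -/
theorem IsSmoothSolution.sphereIntegral_sq (hn : 3 ≤ n) (hu : IsSmoothSolution Ω u)
    (hΩ : IsOpen Ω) (hr : 0 < r) (hsub : closedBall x r ⊆ Ω) :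
    r ^ 2 * sphereIntegral (fun y => u y ^ 2) x r =
      r * ∫ y in ball x r, (n * u y ^ 2 + 2 * radialProduct u x y) := by
  have := nontrivial_eu hn
  have hc : ContDiffOn ℝ 1 u Ω := hu.smooth.of_le (by norm_cast)
  have hF : ContDiffOn ℝ 1 (fun z => (u z ^ 2) • (z - x)) Ω :=
    (hc.pow 2).smul (contDiffOn_id.sub contDiffOn_const)
  have h := sphereIntegral_inner_eq hΩ hF hr hsub
  have hdiv : ∀ y ∈ Ω, divergence (fun z => (u z ^ 2) • (z - x)) y =
      n * u y ^ 2 + 2 * radialProduct u x y := by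
    intro y hy
    have h1 := (hu.contDiffAt_one hΩ hy).differentiableAt (by norm_num)
    have h2 : HasFDerivAt (fun z => u z ^ 2) _ y := h1.hasFDerivAt.pow 2
    have h3 : DifferentiableAt ℝ (fun z => z - x) y := differentiableAt_id.sub_const x
    rw [divergence_smul h2.differentiableAt h3,
      divergence_sub_const, h2.fderiv, radialProduct, inner_gradient]
    simp
    ring
  rw [setIntegral_congr_fun measurableSet_ball fun y hy =>
    hdiv y (hsub (ball_subset_closedBall hy))] at h
  rw [← h, ← sphereIntegral_const_mul]
  refine sphereIntegral_congr hr.le fun y hy => ?_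
  rw [real_inner_smul_left, real_inner_self_eq_norm_sq, ← dist_eq_norm, hy]
  ring

/-- The scaled boundary mass `r⁻¹ ∫_{∂B(x,r)} u²`. -/
noncomputable def boundaryMass (u : Eu n → ℝ) (x : Eu n) (r : ℝ) : ℝ :=
  r⁻¹ * sphereIntegral (fun y => u y ^ 2) x r

theorem boundaryMass_nonneg (u : Eu n → ℝ) (x : Eu n) (hr : 0 ≤ r) : 0 ≤ boundaryMass u x r :=
  mul_nonneg (inv_nonneg.2 hr) (sphereIntegral_nonneg hr fun _ => sq_nonneg _)

theorem IsSmoothSolution.hasDerivAt_boundaryMass (hn : 3 ≤ n) (hu : IsSmoothSolution Ω u)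
    (hΩ : IsOpen Ω) (hr : 0 < r) (hrR : r < R) (hsub : closedBall x R ⊆ Ω) :
    HasDerivAt (boundaryMass u x) (((n : ℝ) - 2) * (r ^ 2)⁻¹ * sphereIntegral (fun y => u y ^ 2) x r
      + 2 * (r ^ 2)⁻¹ * sphereIntegral (radialProduct u x) x r) r := by
  have := nontrivial_eu hn
  have hcb : closedBall x r ⊆ Ω := (closedBall_subset_closedBall hrR.le).trans hsub
  have hc1 : ContinuousOn (fun y => n * u y ^ 2) (closedBall x r) :=
    continuousOn_const.mul (hu.continuousOn_sq.mono hcb)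
  have hc2 : ContinuousOn (fun y => 2 * radialProduct u x y) (closedBall x r) :=
    continuousOn_const.mul ((hu.continuousOn_radialProduct hΩ).mono hcb)
  have hcont : ContinuousOn (fun y => n * u y ^ 2 + 2 * radialProduct u x y) (closedBall x R) :=
    ((continuousOn_const.mul hu.continuousOn_sq).add
      (continuousOn_const.mul (hu.continuousOn_radialProduct hΩ))).mono hsub
  have h1 := hasDerivAt_setIntegral_ball hr hrR hcont
  have h2 := ((hasDerivAt_pow 2 r).inv (pow_ne_zero 2 hr.ne')).mul h1
  have heq := hu.sphereIntegral_sq hn hΩ hr hcb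
  rw [sphereIntegral_add hr.le hc1 hc2, sphereIntegral_const_mul, sphereIntegral_const_mul] at h2
  -- The product rule is applied to this representation of the boundary mass by a ball integral.
  have hev : boundaryMass u x =ᶠ[𝓝 r] (fun ρ : ℝ => ρ ^ 2)⁻¹ *
      fun ρ => ∫ y in ball x ρ, (n * u y ^ 2 + 2 * radialProduct u x y) := by
    filter_upwards [Ioo_mem_nhds hr hrR] with ρ hρ
    have := hu.sphereIntegral_sq hn hΩ hρ.1 ((closedBall_subset_closedBall hρ.2.le).trans hsub)
    have hρ0 := hρ.1.ne'
    simp only [Pi.mul_apply, Pi.inv_apply]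
    rw [boundaryMass]
    field_simp
    refine mul_left_cancel₀ hρ0 ?_
    linear_combination this
  refine (h2.congr_of_eventuallyEq hev).congr_deriv ?_
  set I := ∫ y in ball x r, (n * u y ^ 2 + 2 * radialProduct u x y)
  have hI : I = r * sphereIntegral (fun y => u y ^ 2) x r := by
    refine mul_left_cancel₀ hr.ne' ?_
    linear_combination -heq
  simp only [Pi.inv_apply]
  rw [hI]
  field_simp
  norm_num
  ring

theorem monotoneEnergy_eq_add_boundaryMass (u : Eu n → ℝ) (x : Eu n) (r : ℝ) :
    monotoneEnergy u x r =
      (∫ y in ball x r, lagrangian u y) + ((n : ℝ) - 2) / 4 * boundaryMass u x r := by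
  rw [monotoneEnergy, boundaryMass, mul_assoc]
  rfl

/-- The representation of the energy: `E = (1/n) ∫ |u|^{2n/(n-2)} + (r/4) g'`. -/
theorem IsSmoothSolution.monotoneEnergy_eq (hn : 3 ≤ n) (hu : IsSmoothSolution Ω u)
    (hΩ : IsOpen Ω) (hr : 0 < r) (hsub : closedBall x r ⊆ Ω) :
    monotoneEnergy u x r = (1 / n) * (∫ y in ball x r, |u y| ^ critExp n) +
      r / 4 * (((n : ℝ) - 2) * (r ^ 2)⁻¹ * sphereIntegral (fun y => u y ^ 2) x r
      + 2 * (r ^ 2)⁻¹ * sphereIntegral (radialProduct u x) x r) := by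
  have hi1 : IntegrableOn (fun y => ‖gradient u y‖ ^ 2) (ball x r) :=
    ((((hu.continuousOn_gradient hΩ).norm.pow 2).mono hsub).integrableOn_compact
      (isCompact_closedBall x r)).mono_set ball_subset_closedBall
  have hi2 : IntegrableOn (fun y => |u y| ^ critExp n) (ball x r) :=
    (((hu.continuousOn_abs_rpow hn).mono hsub).integrableOn_compact
      (isCompact_closedBall x r)).mono_set ball_subset_closedBall
  rw [monotoneEnergy_eq_add_boundaryMass,
    hu.sphereIntegral_radialProduct hn hΩ hr hsub, integral_sub hi1 hi2, boundaryMass]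
  unfold lagrangian
  rw [integral_sub (hi1.const_mul _) (hi2.const_mul _), integral_const_mul, integral_const_mul]
  have hn2 := natCast_sub_two_pos hn
  have hn0 : (n : ℝ) ≠ 0 := by linarith
  field_simp
  ring

/-- The monotonicity formula. -/
theorem IsSmoothSolution.hasDerivAt_monotoneEnergy (hn : 3 ≤ n) (hu : IsSmoothSolution Ω u)
    (hΩ : IsOpen Ω) (hr : 0 < r) (hrR : r < R) (hsub : closedBall x R ⊆ Ω) :
    HasDerivAt (monotoneEnergy u x) ((r ^ 2)⁻¹ * sphereIntegral
      (fun y => (inner ℝ (gradient u y) (y - x) + ((n : ℝ) - 2) / 2 * u y) ^ 2) x r) r := by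
  have := nontrivial_eu hn
  have hcb : closedBall x r ⊆ Ω := (closedBall_subset_closedBall hrR.le).trans hsub
  have h1 := hasDerivAt_setIntegral_ball hr hrR ((hu.continuousOn_lagrangian hn hΩ).mono hsub)
  have h2 := h1.add ((hu.hasDerivAt_boundaryMass hn hΩ hr hrR hsub).const_mul (((n : ℝ) - 2) / 4))
  have h3 : HasDerivAt (monotoneEnergy u x) _ r := h2.congr_of_eventuallyEq
    (Eventually.of_forall fun ρ => monotoneEnergy_eq_add_boundaryMass u x ρ)
  convert h3 using 1
  -- Pohozaev replaces the spherical integral of the Lagrangian; the remaining terms then form the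
  -- complete square expanded in `hexp`.
  have hP := hu.pohozaev_identity hn hΩ hr hcb
  have hc1 : ContinuousOn (radialSquare u x) (closedBall x r) :=
    (hu.continuousOn_radialSquare hΩ).mono hcb
  have hc2 : ContinuousOn (fun y => ((n : ℝ) - 2) * radialProduct u x y) (closedBall x r) :=
    continuousOn_const.mul ((hu.continuousOn_radialProduct hΩ).mono hcb)
  have hc3 : ContinuousOn (fun y => (((n : ℝ) - 2) / 2) ^ 2 * u y ^ 2) (closedBall x r) :=
    continuousOn_const.mul (hu.continuousOn_sq.mono hcb)
  have hc12 : ContinuousOn (fun y => radialSquare u x y + ((n : ℝ) - 2) * radialProduct u x y)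
      (closedBall x r) := hc1.add hc2
  have hexp : sphereIntegral
      (fun y => (inner ℝ (gradient u y) (y - x) + ((n : ℝ) - 2) / 2 * u y) ^ 2) x r =
      sphereIntegral (radialSquare u x) x r + ((n : ℝ) - 2) * sphereIntegral (radialProduct u x) x r
        + (((n : ℝ) - 2) / 2) ^ 2 * sphereIntegral (fun y => u y ^ 2) x r := by
    rw [← sphereIntegral_const_mul, ← sphereIntegral_const_mul,
      ← sphereIntegral_add hr.le hc1 hc2, ← sphereIntegral_add hr.le hc12 hc3]
    refine sphereIntegral_congr hr.le fun y _ => ?_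
    rw [radialSquare, radialProduct]
    ring
  rw [hexp]
  field_simp
  linear_combination 16 * hP

theorem IsSmoothSolution.monotoneEnergy_le (hn : 3 ≤ n) (hu : IsSmoothSolution Ω u)
    (hΩ : IsOpen Ω) {s : ℝ} (hs : 0 < s) (hsr : s ≤ r) (hsub : closedBall x r ⊆ Ω) :
    monotoneEnergy u x s ≤ monotoneEnergy u x r := by
  -- A slightly larger ball still lies in `Ω`, so the derivative formula holds up to the endpoint
  -- `r`.
  obtain ⟨δ, hδ, hδs⟩ := (isCompact_closedBall x r).exists_cthickening_subset_open hΩ hsub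
  rw [cthickening_closedBall hδ.le (hs.le.trans hsr)] at hδs
  have hd : ∀ ρ ∈ Icc s r, HasDerivAt (monotoneEnergy u x) ((ρ ^ 2)⁻¹ * sphereIntegral
      (fun y => (inner ℝ (gradient u y) (y - x) + ((n : ℝ) - 2) / 2 * u y) ^ 2) x ρ) ρ :=
    fun ρ hρ => hu.hasDerivAt_monotoneEnergy hn hΩ (hs.trans_le hρ.1) (R := δ + r)
      (by linarith [hρ.2]) hδs
  refine monotoneOn_of_deriv_nonneg (convex_Icc s r)
    (fun ρ hρ => (hd ρ hρ).continuousAt.continuousWithinAt)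
    (fun ρ hρ => (hd ρ (interior_subset hρ)).differentiableAt.differentiableWithinAt)
    (fun ρ hρ => ?_) (left_mem_Icc.2 hsr) (right_mem_Icc.2 hsr) hsr
  have hρ' := interior_subset hρ
  rw [(hd ρ hρ').deriv]
  exact mul_nonneg (by positivity)
    (sphereIntegral_nonneg (hs.le.trans hρ'.1) fun _ => sq_nonneg _)

end Identities

end CriticalYamabe

/-! ### Comparing the monotone energy with integrals over balls. -/

namespace CriticalYamabe

open Set Metric

section Consequences

variable {n : ℕ} {Ω : Set (Eu n)} {u : Eu n → ℝ} {x : Eu n} {r : ℝ}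

theorem IsSmoothSolution.integrableOn_ball_sq (hu : IsSmoothSolution Ω u)
    (hsub : closedBall x r ⊆ Ω) : IntegrableOn (fun y => u y ^ 2) (ball x r) :=
  ((hu.continuousOn_sq.mono hsub).integrableOn_compact
    (isCompact_closedBall x r)).mono_set ball_subset_closedBall

theorem IsSmoothSolution.integrableOn_ball_abs_rpow (hn : 3 ≤ n) (hu : IsSmoothSolution Ω u)
    (hsub : closedBall x r ⊆ Ω) : IntegrableOn (fun y => |u y| ^ critExp n) (ball x r) :=
  (((hu.continuousOn_abs_rpow hn).mono hsub).integrableOn_compact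
    (isCompact_closedBall x r)).mono_set ball_subset_closedBall

theorem IsSmoothSolution.integrableOn_ball_gradient_sq (hu : IsSmoothSolution Ω u)
    (hΩ : IsOpen Ω) (hsub : closedBall x r ⊆ Ω) :
    IntegrableOn (fun y => ‖gradient u y‖ ^ 2) (ball x r) :=
  ((((hu.continuousOn_gradient hΩ).norm.pow 2).mono hsub).integrableOn_compact
    (isCompact_closedBall x r)).mono_set ball_subset_closedBall

/-- A good radius for the scaled boundary mass. -/
theorem IsSmoothSolution.exists_boundaryMass_le (hn : 3 ≤ n) (hu : IsSmoothSolution Ω u)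
    (hr : 0 < r) (hsub : closedBall x (2 * r) ⊆ Ω) :
    ∃ ρ ∈ Icc r (2 * r), boundaryMass u x ρ ≤ (r ^ 2)⁻¹ * ∫ y in ball x (2 * r), u y ^ 2 := by
  have := nontrivial_eu hn
  set S := sphereIntegral (fun y => u y ^ 2) x with hS
  have hc : ContinuousOn S (Icc 0 (2 * r)) :=
    continuousOn_sphereIntegral (hu.continuousOn_sq.mono hsub)
  have hr2 : r ≤ 2 * r := by linarith
  -- The minimum of the spherical integral over `[r,2r]` is at most its mean there.
  obtain ⟨ρ, hρ, hmin⟩ := isCompact_Icc.exists_isMinOn (nonempty_Icc.2 hr2)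
    (hc.mono (Icc_subset_Icc_left hr.le))
  have hρ0 : 0 < ρ := hr.trans_le hρ.1
  refine ⟨ρ, hρ, ?_⟩
  rw [setIntegral_ball_eq (by linarith) (hu.continuousOn_sq.mono hsub)]
  have hi : ∀ a b, 0 ≤ a → a ≤ b → b ≤ 2 * r → IntervalIntegrable S volume a b :=
    fun a b ha hab hb => (hc.mono (by
      rw [uIcc_of_le hab]; exact Icc_subset_Icc ha hb)).intervalIntegrable
  have hpos : ∀ t, 0 ≤ t → 0 ≤ S t := fun t ht => sphereIntegral_nonneg ht fun _ => sq_nonneg _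
  have h1 : r * S ρ ≤ ∫ t in r..(2 * r), S t := by
    have := intervalIntegral.integral_mono_on (f := fun _ => S ρ) hr2
      intervalIntegrable_const (hi r (2 * r) hr.le hr2 le_rfl) fun t ht => hmin ht
    rw [intervalIntegral.integral_const, smul_eq_mul] at this
    linarith
  have h2 : ∫ t in r..(2 * r), S t ≤ ∫ t in (0 : ℝ)..(2 * r), S t := by
    rw [← intervalIntegral.integral_add_adjacent_intervals (hi 0 r le_rfl hr.le hr2)
      (hi r (2 * r) hr.le hr2 le_rfl)]
    have := intervalIntegral.integral_nonneg (μ := volume) hr.le fun t (ht : t ∈ Icc 0 r) => hpos t ht.1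
    linarith
  have h3 : S ρ ≤ r⁻¹ * ∫ t in (0 : ℝ)..(2 * r), S t := by
    rw [inv_mul_eq_div, le_div_iff₀ hr]
    linarith
  calc boundaryMass u x ρ = ρ⁻¹ * S ρ := rfl
    _ ≤ r⁻¹ * (r⁻¹ * ∫ t in (0 : ℝ)..(2 * r), S t) := by
        gcongr
        · exact hpos ρ hρ0.le
        · exact hρ.1
    _ = _ := by ring

/-- The dimensional constant in the scaled Hölder inequality on balls. -/
noncomputable def holderConst (n : ℕ) : ℝ :=
  4 * volume.real (ball (0 : Eu n) 1) ^ (2 / (n : ℝ))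

theorem holderConst_nonneg (n : ℕ) : 0 ≤ holderConst n := by
  unfold holderConst
  positivity

theorem holderConjugate_critExp_half (hn : 3 ≤ n) :
    ((n : ℝ) / (n - 2)).HolderConjugate ((n : ℝ) / 2) := by
  have := natCast_sub_two_pos hn
  have hn0 : (0 : ℝ) < n := by linarith
  rw [Real.holderConjugate_iff, lt_div_iff₀ this]
  refine ⟨by linarith, ?_⟩
  field_simp
  ring

/-- Hölder with exponents `n/(n-2)` and `n/2`. The volume factor scales like `r²` and cancels the
weight, so the constant depends only on the dimension. -/
theorem IsSmoothSolution.scaled_integral_sq_le (hn : 3 ≤ n) (hu : IsSmoothSolution Ω u)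
    (hr : 0 < r) (hsub : closedBall x (2 * r) ⊆ Ω) :
    (r ^ 2)⁻¹ * ∫ y in ball x (2 * r), u y ^ 2 ≤
      holderConst n * (∫ y in ball x (2 * r), |u y| ^ critExp n) ^ (((n : ℝ) - 2) / n) := by
  have := nontrivial_eu hn
  have hn2 := natCast_sub_two_pos hn
  have hn0 : (0 : ℝ) < n := by linarith
  have hpow : ∀ t : ℝ, (t ^ 2) ^ ((n : ℝ) / (n - 2)) = |t| ^ critExp n := by
    intro t
    rw [← sq_abs, ← Real.rpow_natCast, ← Real.rpow_mul (abs_nonneg t), critExp]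
    congr 1
    push_cast
    ring
  have hmeas : AEStronglyMeasurable (fun y => u y ^ 2) (volume.restrict (ball x (2 * r))) :=
    (hu.integrableOn_ball_sq hsub).aestronglyMeasurable
  have hcj := holderConjugate_critExp_half hn
  have hfp : MemLp (fun y => u y ^ 2) (ENNReal.ofReal ((n : ℝ) / (n - 2)))
      (volume.restrict (ball x (2 * r))) := by
    rw [← integrable_norm_rpow_iff hmeas (by simpa using hcj.pos) ENNReal.ofReal_ne_top,
      ENNReal.toReal_ofReal hcj.nonneg]
    refine (hu.integrableOn_ball_abs_rpow hn hsub).congr (Eventually.of_forall fun y => ?_)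
    simp only [Real.norm_eq_abs]
    rw [abs_of_nonneg (sq_nonneg (u y)), hpow]
  have hfin : IsFiniteMeasure (volume.restrict (ball x (2 * r))) :=
    ⟨by simpa using measure_ball_lt_top⟩
  have hH := integral_mul_le_Lp_mul_Lq_of_nonneg hcj
    (μ := volume.restrict (ball x (2 * r))) (f := fun y => u y ^ 2) (g := fun _ => (1 : ℝ))
    (Eventually.of_forall fun y => sq_nonneg _) (Eventually.of_forall fun _ => zero_le_one)
    hfp (memLp_const 1)
  simp only [mul_one, hpow, Real.one_rpow, integral_const, smul_eq_mul, measureReal_restrict_apply_univ] at hH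
  have hvol : volume.real (ball x (2 * r)) = (2 * r) ^ n * volume.real (ball (0 : Eu n) 1) := by
    rw [measureReal_def, Measure.addHaar_ball _ _ (by linarith), ENNReal.toReal_mul,
      ENNReal.toReal_ofReal (by positivity), measureReal_def]
    simp
  have hvol2 : volume.real (ball x (2 * r)) ^ (1 / ((n : ℝ) / 2)) = r ^ 2 * holderConst n := by
    rw [hvol, Real.mul_rpow (by positivity) measureReal_nonneg, holderConst, one_div_div,
      ← Real.rpow_natCast, ← Real.rpow_mul (by positivity), mul_div_cancel₀ _ hn0.ne']
    norm_num
    ring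
  rw [hvol2, one_div_div] at hH
  rw [inv_mul_le_iff₀ (by positivity)]
  linarith

/-- The boundary term cannot be controlled at a prescribed radius. Monotonicity allows moving up to
a good radius in `[r,2r]`, where it can; the negative part of the Lagrangian is dropped. -/
theorem IsSmoothSolution.monotoneEnergy_le_of_integrals (hn : 3 ≤ n) (hu : IsSmoothSolution Ω u)
    (hΩ : IsOpen Ω) (hr : 0 < r) (hsub : closedBall x (2 * r) ⊆ Ω) :
    monotoneEnergy u x r ≤ 1 / 2 * (∫ y in ball x (2 * r), ‖gradient u y‖ ^ 2) +
      ((n : ℝ) - 2) / 4 * (holderConst n *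
        (∫ y in ball x (2 * r), |u y| ^ critExp n) ^ (((n : ℝ) - 2) / n)) := by
  have hn2 := natCast_sub_two_pos hn
  obtain ⟨ρ, hρ, hle⟩ := hu.exists_boundaryMass_le hn hr hsub
  have hρsub : closedBall x ρ ⊆ Ω := (closedBall_subset_closedBall hρ.2).trans hsub
  have h1 := hu.monotoneEnergy_le hn hΩ hr hρ.1 hρsub
  rw [monotoneEnergy_eq_add_boundaryMass u x ρ] at h1
  have h2 := hu.scaled_integral_sq_le hn hr hsub
  have hg := hu.integrableOn_ball_gradient_sq hΩ hρsub
  have h3 : ∫ y in ball x ρ, lagrangian u y ≤ 1 / 2 * ∫ y in ball x ρ, ‖gradient u y‖ ^ 2 := by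
    rw [← integral_const_mul]
    refine integral_mono (((((hu.continuousOn_lagrangian hn hΩ).mono hρsub).integrableOn_compact
      (isCompact_closedBall x ρ)).mono_set ball_subset_closedBall)) (hg.const_mul _) fun y => ?_
    have : 0 ≤ ((n : ℝ) - 2) / (2 * n) * |u y| ^ critExp n := by positivity
    simp only [lagrangian]
    linarith
  have h4 : ∫ y in ball x ρ, ‖gradient u y‖ ^ 2 ≤ ∫ y in ball x (2 * r), ‖gradient u y‖ ^ 2 :=
    setIntegral_mono_set (hu.integrableOn_ball_gradient_sq hΩ hsub)
      (Eventually.of_forall fun _ => sq_nonneg _) (ball_subset_ball hρ.2).eventuallyLE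
  have h5 : ((n : ℝ) - 2) / 4 * boundaryMass u x ρ ≤ ((n : ℝ) - 2) / 4 * (holderConst n *
        (∫ y in ball x (2 * r), |u y| ^ critExp n) ^ (((n : ℝ) - 2) / n)) := by
    gcongr
    exact hle.trans h2
  linarith

/-- Small monotone energy at one scale makes the critical integral small at a much smaller
scale. -/
theorem IsSmoothSolution.integral_abs_rpow_le (hn : 3 ≤ n) (hu : IsSmoothSolution Ω u)
    (hΩ : IsOpen Ω) {s : ℝ} (hs : 0 < s) (hsr : 2 * s < r) (hsub : closedBall x r ⊆ Ω) :
    ∫ y in ball x s, |u y| ^ critExp n ≤ n * (monotoneEnergy u x r + holderConst n *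
      (∫ y in ball x (2 * s), |u y| ^ critExp n) ^ (((n : ℝ) - 2) / n) /
        (4 * Real.log (r / (2 * s)))) := by
  have hn2 := natCast_sub_two_pos hn
  have hn0 : (0 : ℝ) < n := by linarith
  have hsub2 : closedBall x (2 * s) ⊆ Ω := (closedBall_subset_closedBall hsr.le).trans hsub
  obtain ⟨ρ, hρ, hle⟩ := hu.exists_boundaryMass_le hn hs hsub2
  have hρ0 : 0 < ρ := hs.trans_le hρ.1
  have hρr : ρ < r := hρ.2.trans_lt hsr
  have hK := hle.trans (hu.scaled_integral_sq_le hn hs hsub2)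
  set K := holderConst n * (∫ y in ball x (2 * s), |u y| ^ critExp n) ^ (((n : ℝ) - 2) / n)
  have hK0 : 0 ≤ K := (boundaryMass_nonneg u x hρ0.le).trans hK
  obtain ⟨δ, hδ, hδs⟩ := (isCompact_closedBall x r).exists_cthickening_subset_open hΩ hsub
  rw [cthickening_closedBall hδ.le (hρ0.le.trans hρr.le)] at hδs
  have hmono : ∀ a b, a ≤ b → b ≤ r →
      ∫ y in ball x a, |u y| ^ critExp n ≤ ∫ y in ball x b, |u y| ^ critExp n := fun a b hab hb =>
    setIntegral_mono_set
      (hu.integrableOn_ball_abs_rpow hn ((closedBall_subset_closedBall hb).trans hsub))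
      (Eventually.of_forall fun _ => by positivity) (ball_subset_ball hab).eventuallyLE
  set A := ∫ y in ball x ρ, |u y| ^ critExp n with hA
  -- The excess to be bounded. For `t` in `[ρ,r]` the formula for the energy and its monotonicity
  -- give `(t/4) g'(t) ≤ -κ`, where `g` is the boundary mass; hence `g + 4κ log` is nonincreasing.
  set κ := 1 / n * A - monotoneEnergy u x r with hκ
  have hanti : AntitoneOn (fun t => boundaryMass u x t + 4 * κ * Real.log t) (Icc ρ r) := by
    have hd : ∀ t ∈ Icc ρ r, HasDerivAt (fun t => boundaryMass u x t + 4 * κ * Real.log t)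
        (((n : ℝ) - 2) * (t ^ 2)⁻¹ * sphereIntegral (fun y => u y ^ 2) x t
      + 2 * (t ^ 2)⁻¹ * sphereIntegral (radialProduct u x) x t + 4 * κ * t⁻¹) t := fun t ht =>
      (hu.hasDerivAt_boundaryMass hn hΩ (hρ0.trans_le ht.1) (R := δ + r)
        (by linarith [ht.2]) hδs).add
        ((Real.hasDerivAt_log (hρ0.trans_le ht.1).ne').const_mul _)
    refine antitoneOn_of_deriv_nonpos (convex_Icc ρ r)
      (fun t ht => (hd t ht).continuousAt.continuousWithinAt)
      (fun t ht => (hd t (interior_subset ht)).differentiableAt.differentiableWithinAt)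
      fun t ht => ?_
    have ht' := interior_subset ht
    have ht0 : 0 < t := hρ0.trans_le ht'.1
    rw [(hd t ht').deriv]
    have htsub : closedBall x t ⊆ Ω := (closedBall_subset_closedBall ht'.2).trans hsub
    have e1 := hu.monotoneEnergy_eq hn hΩ ht0 htsub
    have e2 := hu.monotoneEnergy_le hn hΩ ht0 ht'.2 hsub
    have e3 : 1 / (n : ℝ) * A ≤ 1 / n * ∫ y in ball x t, |u y| ^ critExp n := by
      gcongr
      exact hmono ρ t ht'.1 ht'.2
    set D := ((n : ℝ) - 2) * (t ^ 2)⁻¹ * sphereIntegral (fun y => u y ^ 2) x t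
      + 2 * (t ^ 2)⁻¹ * sphereIntegral (radialProduct u x) x t
    have e4 : t / 4 * D + κ ≤ 0 := by linarith
    have e5 : D + 4 * κ * t⁻¹ = 4 / t * (t / 4 * D + κ) := by field_simp
    rw [e5]
    exact mul_nonpos_of_nonneg_of_nonpos (by positivity) e4
  have hcomp := hanti (left_mem_Icc.2 hρr.le) (right_mem_Icc.2 hρr.le) hρr.le
  simp only at hcomp
  have hg := boundaryMass_nonneg u x (hρ0.le.trans hρr.le)
  have hlog : 0 < Real.log (r / (2 * s)) :=
    Real.log_pos (by rw [one_lt_div (by linarith)]; exact hsr)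
  have hlog2 : Real.log (r / (2 * s)) ≤ Real.log r - Real.log ρ := by
    rw [← Real.log_div (hρ0.trans hρr).ne' hρ0.ne']
    refine Real.log_le_log (div_pos (hρ0.trans hρr) (by linarith)) ?_
    gcongr
    · exact (hρ0.trans hρr).le
    · exact hρ.2
  -- Compare the endpoints, using `g(r) ≥ 0` and `g(ρ) ≤ K`. The sign of `κ` matters when `log
  -- (r/ρ)` is replaced by the smaller `log (r/(2s))`.
  have hκle : κ ≤ K / (4 * Real.log (r / (2 * s))) := by
    by_cases h : κ ≤ 0
    · exact h.trans (by positivity)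
    · push Not at h
      rw [le_div_iff₀ (by positivity)]
      have := mul_le_mul_of_nonneg_left hlog2 h.le
      linarith
  have hfin : A ≤ n * (monotoneEnergy u x r + K / (4 * Real.log (r / (2 * s)))) := by
    have : A = n * (monotoneEnergy u x r + κ) := by
      rw [hκ]
      field_simp
      ring
    rw [this]
    gcongr
  exact (hmono s ρ hρ.1 hρr.le).trans hfin

end Consequences

end CriticalYamabe

/-! ### Sobolev's inequality and convexity inequalities for powers. -/

namespace CriticalYamabe

open Set Metric

theorem norm_fderiv_eq_norm_gradient {n : ℕ} (f : Eu n → ℝ) (x : Eu n) :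
    ‖fderiv ℝ f x‖ = ‖gradient f x‖ := by
  rw [← toDual_gradient, LinearIsometryEquiv.norm_map]

theorem hasCompactSupport_gradient {n : ℕ} {w : Eu n → ℝ} (hc : HasCompactSupport w) :
    HasCompactSupport (gradient w) := by
  refine (hc.fderiv (𝕜 := ℝ)).mono fun x hx h => hx ?_
  rw [← norm_eq_zero, ← norm_fderiv_eq_norm_gradient, h, norm_zero]

theorem continuous_gradient {n : ℕ} {w : Eu n → ℝ} (hw : ContDiff ℝ 1 w) :
    Continuous (gradient w) :=
  (InnerProductSpace.toDual ℝ (Eu n)).symm.continuous.comp (hw.continuous_fderiv (by norm_num))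

theorem integrable_gradient_sq {n : ℕ} {w : Eu n → ℝ} (hw : ContDiff ℝ 1 w)
    (hc : HasCompactSupport w) : Integrable fun x => ‖gradient w x‖ ^ 2 :=
  ((continuous_gradient hw).norm.pow 2).integrable_of_hasCompactSupport
    ((hasCompactSupport_gradient hc).mono fun x hx h => hx (by simp [h]))

theorem integrable_abs_rpow {n : ℕ} {w : Eu n → ℝ} (hw : Continuous w)
    (hc : HasCompactSupport w) {s : ℝ} (hs : 0 < s) : Integrable fun x => |w x| ^ s :=
  (hw.abs.rpow_const fun _ => Or.inr hs.le).integrable_of_hasCompactSupport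
    (hc.mono fun x hx h => hx (by simp [h, Real.zero_rpow hs.ne']))

/-- The Sobolev inequality in the form `(∫ |w|^q)^{2/q} ≤ C ∫ |∇w|²`. -/
theorem exists_sobolev_const {n : ℕ} (hn : 3 ≤ n) : ∃ C : ℝ, 0 < C ∧ ∀ w : Eu n → ℝ,
    ContDiff ℝ 1 w → HasCompactSupport w →
    (∫ x, |w x| ^ critExp n) ^ (((n : ℝ) - 2) / n) ≤ C * ∫ x, ‖gradient w x‖ ^ 2 := by
  have hn2 := natCast_sub_two_pos hn
  have hn0 : (0 : ℝ) < n := by linarith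
  have hq := critExp_pos hn
  set C₀ : ℝ≥0 := eLpNormLESNormFDerivOfEqInnerConst (volume : Measure (Eu n)) 2
  -- The norm inequality gets squared; the `+ 1` only makes the constant positive.
  refine ⟨(C₀ : ℝ) ^ 2 + 1, by positivity, fun w hw hc => ?_⟩
  have hS : eLpNorm w ((critExp n).toNNReal : ℝ≥0∞) volume ≤
      (C₀ : ℝ≥0∞) * eLpNorm (fderiv ℝ w) ((2 : ℝ≥0) : ℝ≥0∞) volume := eLpNorm_le_eLpNorm_fderiv_of_eq_inner (volume : Measure (Eu n)) hw hc
    (p := 2) (p' := (critExp n).toNNReal) (by norm_num) (by simp; omega) (by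
      rw [Real.coe_toNNReal _ hq.le, critExp]
      simp only [finrank_euclideanSpace, Fintype.card_fin]
      push_cast
      field_simp)
  have h1 : MemLp w ((critExp n).toNNReal : ℝ≥0∞) := by
    rw [← integrable_norm_rpow_iff hw.continuous.aestronglyMeasurable
      (by simpa using hq) ENNReal.coe_ne_top]
    simpa [hq.le] using integrable_abs_rpow hw.continuous hc hq
  have h2 : MemLp (fderiv ℝ w) ((2 : ℝ≥0) : ℝ≥0∞) := by
    rw [← integrable_norm_rpow_iff
      (hw.continuous_fderiv (by norm_num)).aestronglyMeasurable (by simp) ENNReal.coe_ne_top]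
    simpa [norm_fderiv_eq_norm_gradient] using integrable_gradient_sq hw hc
  rw [h1.eLpNorm_eq_integral_rpow_norm (by simpa using hq) ENNReal.coe_ne_top,
    h2.eLpNorm_eq_integral_rpow_norm (by simp) ENNReal.coe_ne_top,
    ← ENNReal.ofReal_coe_nnreal (p := C₀), ← ENNReal.ofReal_mul (by positivity),
    ENNReal.ofReal_le_ofReal_iff (by positivity)] at hS
  simp only [ENNReal.coe_toReal, Real.coe_toNNReal _ hq.le, Real.norm_eq_abs,
    norm_fderiv_eq_norm_gradient, NNReal.coe_ofNat, Real.rpow_ofNat] at hS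
  have hI : 0 ≤ ∫ x, |w x| ^ critExp n := integral_nonneg fun _ => by positivity
  have hJ : 0 ≤ ∫ x, ‖gradient w x‖ ^ 2 := integral_nonneg fun _ => by positivity
  have hsq := pow_le_pow_left₀ (by positivity) hS 2
  have e1 : ((∫ x, |w x| ^ critExp n) ^ (critExp n)⁻¹) ^ 2 =
      (∫ x, |w x| ^ critExp n) ^ (((n : ℝ) - 2) / n) := by
    rw [← Real.rpow_natCast, ← Real.rpow_mul hI, critExp]
    congr 1
    push_cast
    field_simp
  have e2 : ((C₀ : ℝ) * (∫ x, ‖gradient w x‖ ^ 2) ^ (2 : ℝ)⁻¹) ^ 2 =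
      (C₀ : ℝ) ^ 2 * ∫ x, ‖gradient w x‖ ^ 2 := by
    rw [mul_pow, ← Real.rpow_natCast (_ ^ (2 : ℝ)⁻¹), ← Real.rpow_mul hJ]
    norm_num
  rw [e1, e2] at hsq
  linarith

/-- The tangent line inequality for `|·|^s`. -/
theorem abs_rpow_tangent_le {s : ℝ} (hs : 1 < s) (a b : ℝ) :
    |a| ^ s + s * (a * |a| ^ (s - 2)) * (b - a) ≤ |b| ^ s := by
  have hcj := Real.HolderConjugate.conjExponent hs
  -- Young's inequality for `|b|` and `|a|^(s-1)` is the tangent line inequality up to signs.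
  have h1 := Real.young_inequality_of_nonneg (abs_nonneg b)
    (Real.rpow_nonneg (abs_nonneg a) (s - 1)) hcj
  rw [← Real.rpow_mul (abs_nonneg a), Real.conjExponent,
    mul_div_cancel₀ _ (by linarith : s - 1 ≠ 0)] at h1
  by_cases ha : a = 0
  · have : (0 : ℝ) ^ s = 0 := Real.zero_rpow (by linarith)
    simp [ha, this]
    positivity
  · have hp : 0 < |a| := abs_pos.2 ha
    have e1 : |a| ^ s = |a| ^ (s - 2) * |a| ^ 2 := by
      rw [← Real.rpow_natCast, ← Real.rpow_add hp]; norm_num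
    have e2 : |a| ^ (s - 1) = |a| ^ (s - 2) * |a| := by
      rw [← Real.rpow_add_one hp.ne']; ring_nf
    have h0 : 0 < |a| ^ (s - 2) := by positivity
    rw [e1, e2] at h1
    rw [e1]
    have hs0 : 0 < s := by linarith
    have h2 : s * (|b| * (|a| ^ (s - 2) * |a|)) ≤ |b| ^ s + (s - 1) * (|a| ^ (s - 2) * |a| ^ 2) := by
      have := mul_le_mul_of_nonneg_left h1 hs0.le
      calc _ ≤ _ := this
        _ = _ := by field_simp
    have h3 : a * b ≤ |b| * |a| := by rw [← abs_mul, mul_comm]; exact le_abs_self _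
    have h4 := mul_le_mul_of_nonneg_left h3 (mul_nonneg hs0.le h0.le)
    rw [sq_abs] at h2 ⊢
    nlinarith [h2, h4]

theorem abs_rpow_tangent_le_of_nonneg {s : ℝ} (hs : 1 < s) {a b : ℝ} (ha : 0 ≤ a) (hb : 0 ≤ b) :
    a ^ s - b ^ s ≤ s * a ^ (s - 1) * (a - b) := by
  have h := abs_rpow_tangent_le hs a b
  rw [abs_of_nonneg ha, abs_of_nonneg hb] at h
  have e : a * a ^ (s - 2) = a ^ (s - 1) := by
    rcases ha.eq_or_lt with rfl | ha'
    · rw [zero_mul, Real.zero_rpow (by linarith)]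
    · rw [mul_comm, ← Real.rpow_add_one ha'.ne']; ring_nf
  rw [e] at h
  linarith

theorem signed_rpow_sub_mul_le_of_nonneg {p : ℝ} (hp : 0 < p) {a b : ℝ} (ha : 0 ≤ a) (hb : 0 ≤ b) :
    (a * a ^ p - b * b ^ p) * (a - b) ≤ (p + 1) * (a ^ p + b ^ p) * (a - b) ^ 2 := by
  have ea : a * a ^ p = a ^ (p + 1) := by rw [Real.rpow_add_one' ha (by linarith), mul_comm]
  have eb : b * b ^ p = b ^ (p + 1) := by rw [Real.rpow_add_one' hb (by linarith), mul_comm]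
  have h1 := abs_rpow_tangent_le_of_nonneg (s := p + 1) (by linarith) ha hb
  have h2 := abs_rpow_tangent_le_of_nonneg (s := p + 1) (by linarith) hb ha
  rw [add_sub_cancel_right] at h1 h2
  have hap : 0 ≤ a ^ p := Real.rpow_nonneg ha p
  have hbp : 0 ≤ b ^ p := Real.rpow_nonneg hb p
  rw [ea, eb]
  rcases le_total b a with h | h
  · have := mul_le_mul_of_nonneg_right h1 (sub_nonneg.2 h)
    have : 0 ≤ (p + 1) * b ^ p * (a - b) ^ 2 := by positivity
    nlinarith
  · have := mul_le_mul_of_nonneg_right h2 (sub_nonneg.2 h)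
    have : 0 ≤ (p + 1) * a ^ p * (a - b) ^ 2 := by positivity
    nlinarith

/-- For equal signs the tangent line of `t^(p+1)` at the point of larger modulus suffices; for
opposite signs direct expansion does. This makes the nonlinear term in the equation for a difference
quadratic in that difference. -/
theorem signed_rpow_sub_mul_le {p : ℝ} (hp : 0 < p) (a b : ℝ) :
    (a * |a| ^ p - b * |b| ^ p) * (a - b) ≤ (p + 1) * (|a| ^ p + |b| ^ p) * (a - b) ^ 2 := by
  have key : ∀ a b : ℝ, 0 ≤ a → b ≤ 0 →
      (a * |a| ^ p - b * |b| ^ p) * (a - b) ≤ (p + 1) * (|a| ^ p + |b| ^ p) * (a - b) ^ 2 := by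
    intro a b ha hb
    have hap : 0 ≤ |a| ^ p := by positivity
    have hbp : 0 ≤ |b| ^ p := by positivity
    have h1 : a * |a| ^ p - b * |b| ^ p ≤ (|a| ^ p + |b| ^ p) * (a - b) := by
      nlinarith [mul_nonneg ha hbp, mul_nonneg (neg_nonneg.2 hb) hap]
    have h2 : 0 ≤ a - b := by linarith
    have h3 : 0 ≤ p * (|a| ^ p + |b| ^ p) * (a - b) ^ 2 := by positivity
    nlinarith [mul_le_mul_of_nonneg_right h1 h2]
  rcases le_total 0 a with ha | ha <;> rcases le_total 0 b with hb | hb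
  · simpa only [abs_of_nonneg ha, abs_of_nonneg hb] using
      signed_rpow_sub_mul_le_of_nonneg hp ha hb
  · exact key a b ha hb
  · have := key b a hb ha
    nlinarith
  · have := signed_rpow_sub_mul_le_of_nonneg hp (neg_nonneg.2 ha) (neg_nonneg.2 hb)
    rw [abs_of_nonpos ha, abs_of_nonpos hb]
    nlinarith

end CriticalYamabe

/-! ### The energy estimate for a difference of two solutions. -/

namespace CriticalYamabe

open Set Metric

theorem continuous_mul_of_tsupport_subset {n : ℕ} {Ω : Set (Eu n)} (hΩ : IsOpen Ω) {χ : Eu n → ℝ}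
    (hχ : Continuous χ) (hs : tsupport χ ⊆ Ω) {f : Eu n → ℝ} (hf : ContinuousOn f Ω) :
    Continuous fun y => χ y * f y :=
  (contDiff_smul_of_tsupport_subset (k := 0) hΩ (contDiff_zero.2 hχ) hs
    (contDiffOn_zero.2 hf)).continuous

theorem integrable_mul_of_tsupport_subset {n : ℕ} {Ω : Set (Eu n)} (hΩ : IsOpen Ω)
    {χ : Eu n → ℝ} (hχ : Continuous χ) (hc : HasCompactSupport χ) (hs : tsupport χ ⊆ Ω)
    {f : Eu n → ℝ} (hf : ContinuousOn f Ω) : Integrable fun y => χ y * f y :=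
  (continuous_mul_of_tsupport_subset hΩ hχ hs hf).integrable_of_hasCompactSupport
    (hc.mono fun y hy h => hy (by simp [h]))

theorem sq_rpow_eq_abs_rpow_critExp (n : ℕ) (t : ℝ) :
    (t ^ 2) ^ ((n : ℝ) / (n - 2)) = |t| ^ critExp n := by
  rw [← sq_abs, ← Real.rpow_natCast, ← Real.rpow_mul (abs_nonneg t), critExp]
  congr 1
  push_cast
  ring

theorem gradient_mul {n : ℕ} {f g : Eu n → ℝ} {x : Eu n} (hf : DifferentiableAt ℝ f x)
    (hg : DifferentiableAt ℝ g x) :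
    gradient (fun y => f y * g y) x = f x • gradient g x + g x • gradient f x := by
  refine ext_inner_right ℝ fun v => ?_
  rw [inner_gradient, fderiv_fun_mul hf hg, inner_add_left, real_inner_smul_left,
    real_inner_smul_left, inner_gradient, inner_gradient]
  rfl

theorem gradient_sub_apply {n : ℕ} {f g : Eu n → ℝ} {x : Eu n} (hf : DifferentiableAt ℝ f x)
    (hg : DifferentiableAt ℝ g x) :
    gradient (fun y => f y - g y) x = gradient f x - gradient g x := by
  refine ext_inner_right ℝ fun v => ?_
  rw [inner_gradient, fderiv_fun_sub hf hg, inner_sub_left, inner_gradient, inner_gradient]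
  rfl

theorem gradient_eq_zero_of_notMem_tsupport {n : ℕ} {f : Eu n → ℝ} {x : Eu n}
    (h : x ∉ tsupport f) : gradient f x = 0 := by
  rw [← norm_eq_zero, ← norm_fderiv_eq_norm_gradient, fderiv_of_notMem_tsupport ℝ h, norm_zero]

/-- The nonlinearity `t |t|^{4/(n-2)}`. -/
noncomputable def critNonlinearity (n : ℕ) (t : ℝ) : ℝ := t * |t| ^ (4 / ((n : ℝ) - 2))

theorem continuous_critNonlinearity {n : ℕ} (hn : 3 ≤ n) : Continuous (critNonlinearity n) := by
  have := natCast_sub_two_pos hn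
  exact continuous_id.mul (continuous_abs.rpow_const fun _ => Or.inr (by positivity))

section Difference

variable {n : ℕ} {Ω : Set (Eu n)} {u₁ u₂ ζ : Eu n → ℝ}

theorem laplacian_sub_eq (hΩ : IsOpen Ω) (h₁ : IsSmoothSolution Ω u₁)
    (h₂ : IsSmoothSolution Ω u₂) {y : Eu n} (hy : y ∈ Ω) :
    Laplacian.laplacian (fun z => u₁ z - u₂ z) y =
      -(critNonlinearity n (u₁ y) - critNonlinearity n (u₂ y)) := by
  have h := (h₁.contDiffAt_two hΩ hy).laplacian_sub (h₂.contDiffAt_two hΩ hy)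
  have e₁ := h₁.equation y hy
  have e₂ := h₂.equation y hy
  unfold critNonlinearity
  change Laplacian.laplacian (u₁ - u₂) y = _
  rw [h]
  linarith

/-- The energy identity for a localized difference of two solutions. -/
theorem integral_gradient_mul_sub_sq (hn : 3 ≤ n) (hΩ : IsOpen Ω) (h₁ : IsSmoothSolution Ω u₁)
    (h₂ : IsSmoothSolution Ω u₂) (hζ : ContDiff ℝ ∞ ζ) (hζc : HasCompactSupport ζ)
    (hζs : tsupport ζ ⊆ Ω) :
    ∫ y, ‖gradient (fun z => ζ z * (u₁ z - u₂ z)) y‖ ^ 2 =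
      (∫ y, ζ y * (ζ y * (u₁ y - u₂ y) *
        (critNonlinearity n (u₁ y) - critNonlinearity n (u₂ y)))) +
      ∫ y, ‖gradient ζ y‖ ^ 2 * (u₁ y - u₂ y) ^ 2 := by
  have hζ1 : ContDiff ℝ 1 ζ := hζ.of_le (by norm_cast)
  obtain ⟨w, hw⟩ : ∃ w : Eu n → ℝ, w = fun z => u₁ z - u₂ z := ⟨_, rfl⟩
  have hw' : ∀ z, u₁ z - u₂ z = w z := fun z => by rw [hw]
  simp only [hw']
  have hwc : ContDiffOn ℝ ∞ w Ω := hw ▸ h₁.smooth.sub h₂.smooth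
  have hwA : ∀ y ∈ Ω, ContDiffAt ℝ 2 w y := fun y hy =>
    (hwc.contDiffAt (hΩ.mem_nhds hy)).of_le (by norm_cast)
  have hwd : ∀ y ∈ Ω, DifferentiableAt ℝ w y := fun y hy => (hwA y hy).differentiableAt (by norm_num)
  have hw1 : ContDiffOn ℝ 1 w Ω := hwc.of_le (by norm_cast)
  have hgw : ContDiffOn ℝ 1 (gradient w) Ω :=
    fun y hy => (contDiffAt_gradient (hwA y hy)).contDiffWithinAt
  have hF0 : ContDiff ℝ 1 fun y => ζ y • ((ζ y * w y) • gradient w y) :=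
    contDiff_smul_of_tsupport_subset hΩ hζ1 hζs ((hζ1.contDiffOn.mul hw1).smul hgw)
  have hFc0 : HasCompactSupport fun y => ζ y • ((ζ y * w y) • gradient w y) :=
    hζc.mono fun y hy h => hy (by simp only [h, zero_smul])
  have hFeq : (fun y => ζ y • ((ζ y * w y) • gradient w y)) =
      fun y => (ζ y ^ 2 * w y) • gradient w y := by
    ext1 y
    rw [smul_smul]
    congr 1
    ring
  rw [hFeq] at hF0 hFc0
  have hcn := continuous_critNonlinearity hn
  have hcont : ContinuousOn (fun y => ζ y * w y *
      (critNonlinearity n (u₁ y) - critNonlinearity n (u₂ y))) Ω :=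
    (hζ.continuous.continuousOn.mul hwc.continuousOn).mul
      ((hcn.comp_continuousOn h₁.continuousOn).sub (hcn.comp_continuousOn h₂.continuousOn))
  have hi1 := integrable_divergence hF0 hFc0
  have hi2 := integrable_mul_of_tsupport_subset hΩ hζ.continuous hζc hζs hcont
  have hgsupp : Function.support (fun y => ‖gradient ζ y‖ ^ 2) ⊆ tsupport ζ := by
    intro y hy
    by_contra h
    exact hy (by simp [gradient_eq_zero_of_notMem_tsupport h])
  have hi3 : Integrable fun y => ‖gradient ζ y‖ ^ 2 * w y ^ 2 :=
    integrable_mul_of_tsupport_subset hΩ ((continuous_gradient hζ1).norm.pow 2)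
      (HasCompactSupport.of_support_subset_isCompact hζc hgsupp)
      ((closure_minimal hgsupp (isClosed_tsupport ζ)).trans hζs) (hwc.continuousOn.pow 2)
  -- Pointwise, `|∇(ζw)|² = div(ζ² w ∇w) - ζ² w Δw + |∇ζ|² w²`; the equation replaces `Δw`, and the
  -- divergence integrates to zero.
  have hpt : ∀ y, ‖gradient (fun z => ζ z * w z) y‖ ^ 2 =
      divergence (fun y => (ζ y ^ 2 * w y) • gradient w y) y +
      (ζ y * (ζ y * w y * (critNonlinearity n (u₁ y) - critNonlinearity n (u₂ y))) +
        ‖gradient ζ y‖ ^ 2 * w y ^ 2) := by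
    intro y
    by_cases hy : y ∈ tsupport ζ
    · have hyΩ := hζs hy
      have hζd : DifferentiableAt ℝ ζ y := hζ1.differentiable (by norm_num) y
      have hwdy := hwd y hyΩ
      have hψ : HasFDerivAt (fun z => ζ z ^ 2 * w z) _ y :=
        (hζd.hasFDerivAt.pow 2).mul hwdy.hasFDerivAt
      rw [divergence_smul hψ.differentiableAt ((contDiffAt_gradient
        (hwA y hyΩ)).differentiableAt (by norm_num)), divergence_gradient (hwA y hyΩ), hψ.fderiv,
        gradient_mul hζd hwdy, hw, laplacian_sub_eq hΩ h₁ h₂ hyΩ, ← hw, norm_add_sq_real,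
        norm_smul, norm_smul, real_inner_smul_left, real_inner_smul_right]
      simp only [add_apply, smul_apply, ← inner_gradient, real_inner_self_eq_norm_sq,
        Real.norm_eq_abs, mul_pow, sq_abs, smul_eq_mul, nsmul_eq_mul, real_inner_comm (gradient w y)]
      push_cast
      ring
    · have h0 : ζ y = 0 := image_eq_zero_of_notMem_tsupport hy
      have h1 : (fun z => ζ z * w z) =ᶠ[𝓝 y] fun _ => 0 := by
        filter_upwards [notMem_tsupport_iff_eventuallyEq.1 hy] with z hz
        simp [hz]
      have h2 : (fun z => (ζ z ^ 2 * w z) • gradient w z) =ᶠ[𝓝 y] fun _ => 0 := by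
        filter_upwards [notMem_tsupport_iff_eventuallyEq.1 hy] with z hz
        simp [hz]
      rw [divergence_congr h2, gradient_eq_zero_of_notMem_tsupport hy, h0,
        gradient, h1.fderiv_eq]
      simp [divergence]
  rw [integral_congr_ae (Eventually.of_forall hpt), integral_add hi1 (show Integrable fun y => ζ y * (ζ y * w y *
      (critNonlinearity n (u₁ y) - critNonlinearity n (u₂ y))) + ‖gradient ζ y‖ ^ 2 * w y ^ 2 from
      hi2.add hi3),
    integral_divergence_eq_zero hF0 hFc0, zero_add, integral_add hi2 hi3]

/-- Hölder with exponents `n/2` and `n/(n-2)`: the critical mass of `u` becomes a factor in front of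
the Sobolev norm of `h`, which is where smallness enters. -/
theorem setIntegral_abs_rpow_mul_sq_le (hn : 3 ≤ n) {K : Set (Eu n)} (hK : IsCompact K)
    {u h : Eu n → ℝ} (hu : ContinuousOn u K) (hh : Continuous h) (hhc : HasCompactSupport h) :
    ∫ y in K, |u y| ^ (4 / ((n : ℝ) - 2)) * h y ^ 2 ≤
      (∫ y in K, |u y| ^ critExp n) ^ (2 / (n : ℝ)) *
        (∫ y, |h y| ^ critExp n) ^ (((n : ℝ) - 2) / n) := by
  have hn2 := natCast_sub_two_pos hn
  have hn0 : (0 : ℝ) < n := by linarith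
  have hq := critExp_pos hn
  have hcj := holderConjugate_critExp_half hn
  have hpow : ∀ t : ℝ, (|t| ^ (4 / ((n : ℝ) - 2))) ^ ((n : ℝ) / 2) = |t| ^ critExp n := by
    intro t
    rw [← Real.rpow_mul (abs_nonneg t), critExp]
    congr 1
    field_simp
    ring
  have hcu : ContinuousOn (fun y => |u y| ^ (4 / ((n : ℝ) - 2))) K :=
    hu.abs.rpow_const fun _ _ => Or.inr (by positivity)
  have hint := integrable_abs_rpow hh hhc hq
  have hf : MemLp (fun y => h y ^ 2) (ENNReal.ofReal ((n : ℝ) / (n - 2))) (volume.restrict K) := by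
    rw [← integrable_norm_rpow_iff (f := fun y => h y ^ 2) (hh.pow 2).aestronglyMeasurable (by simpa using hcj.pos)
      ENNReal.ofReal_ne_top, ENNReal.toReal_ofReal hcj.nonneg]
    refine (hint.integrableOn (s := K)).congr (Eventually.of_forall fun y => ?_)
    simp only [Real.norm_eq_abs]
    rw [abs_of_nonneg (sq_nonneg (h y)), sq_rpow_eq_abs_rpow_critExp]
  have hg : MemLp (fun y => |u y| ^ (4 / ((n : ℝ) - 2))) (ENNReal.ofReal ((n : ℝ) / 2))
      (volume.restrict K) := by
    rw [← integrable_norm_rpow_iff (hcu.aestronglyMeasurable hK.measurableSet)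
      (by simpa using hcj.symm.pos) ENNReal.ofReal_ne_top, ENNReal.toReal_ofReal hcj.symm.nonneg]
    have : IntegrableOn (fun y => |u y| ^ critExp n) K :=
      (hu.abs.rpow_const fun _ _ => Or.inr hq.le).integrableOn_compact hK
    refine Integrable.congr this (Eventually.of_forall fun y => ?_)
    simp only [Real.norm_eq_abs]
    rw [abs_of_nonneg (by positivity : 0 ≤ |u y| ^ (4 / ((n : ℝ) - 2))), hpow]
  have hH := integral_mul_le_Lp_mul_Lq_of_nonneg hcj (μ := volume.restrict K)
    (Eventually.of_forall fun y => sq_nonneg (h y))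
    (Eventually.of_forall fun y => by positivity) hf hg
  simp only [sq_rpow_eq_abs_rpow_critExp, hpow, one_div_div] at hH
  calc ∫ y in K, |u y| ^ (4 / ((n : ℝ) - 2)) * h y ^ 2
      = ∫ y in K, h y ^ 2 * |u y| ^ (4 / ((n : ℝ) - 2)) := by simp only [mul_comm]
    _ ≤ _ := hH
    _ ≤ _ := by
      rw [mul_comm]
      gcongr
      · exact Eventually.of_forall fun _ => by positivity
      · exact Measure.restrict_le_self

end Difference

/-- The localized difference of two solutions with small critical integral is controlled in the
energy norm by its `L²` norm. -/
theorem exists_smallness_const {n : ℕ} (hn : 3 ≤ n) : ∃ δ : ℝ, 0 < δ ∧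
    ∀ (Ω : Set (Eu n)) (u₁ u₂ ζ : Eu n → ℝ), IsOpen Ω → IsSmoothSolution Ω u₁ →
      IsSmoothSolution Ω u₂ → ContDiff ℝ ∞ ζ → HasCompactSupport ζ → tsupport ζ ⊆ Ω →
      ∫ y in tsupport ζ, |u₁ y| ^ critExp n ≤ δ → ∫ y in tsupport ζ, |u₂ y| ^ critExp n ≤ δ →
      ∫ y, ‖gradient (fun z => ζ z * (u₁ z - u₂ z)) y‖ ^ 2 ≤
        2 * ∫ y, ‖gradient ζ y‖ ^ 2 * (u₁ y - u₂ y) ^ 2 := by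
  have hn2 := natCast_sub_two_pos hn
  have hn0 : (0 : ℝ) < n := by linarith
  obtain ⟨C, hC, hS⟩ := exists_sobolev_const hn
  set p : ℝ := 4 / ((n : ℝ) - 2) with hp
  have hp0 : 0 < p := by positivity
  -- Each solution contributes at most `1/(4(p+1)C)` times the Sobolev term. After the factors `p +
  -- 1` and `C` the two together give `I ≤ (I + J)/2`, where `I + J` is the Dirichlet integral;
  -- hence `I + J ≤ 2J`.
  set δ : ℝ := (1 / (4 * (p + 1) * C)) ^ ((n : ℝ) / 2) with hδ
  have hδp : δ ^ (2 / (n : ℝ)) = 1 / (4 * (p + 1) * C) := by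
    rw [hδ, ← Real.rpow_mul (by positivity), div_mul_div_comm, mul_comm (n : ℝ),
      div_self (by positivity), Real.rpow_one]
  refine ⟨δ, by positivity, fun Ω u₁ u₂ ζ hΩ h₁ h₂ hζ hζc hζs hu₁ hu₂ => ?_⟩
  have hζ1 : ContDiff ℝ 1 ζ := hζ.of_le (by norm_cast)
  set K := tsupport ζ with hK
  have hKc : IsCompact K := hζc
  rw [integral_gradient_mul_sub_sq hn hΩ h₁ h₂ hζ hζc hζs]
  set h : Eu n → ℝ := fun z => ζ z * (u₁ z - u₂ z) with hh
  have hh1 : ContDiff ℝ 1 h :=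
    contDiff_smul_of_tsupport_subset hΩ hζ1 hζs ((h₁.smooth.sub h₂.smooth).of_le (by norm_cast))
  have hhc : HasCompactSupport h := hζc.mono fun y hy h0 => hy (by simp [hh, h0])
  have hSob := hS h hh1 hhc
  rw [integral_gradient_mul_sub_sq hn hΩ h₁ h₂ hζ hζc hζs] at hSob
  set I := ∫ y, ζ y * (ζ y * (u₁ y - u₂ y) *
        (critNonlinearity n (u₁ y) - critNonlinearity n (u₂ y))) with hI
  set J := ∫ y, ‖gradient ζ y‖ ^ 2 * (u₁ y - u₂ y) ^ 2 with hJ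
  have hJ0 : 0 ≤ J := integral_nonneg fun _ => by positivity
  set T := (∫ y, |h y| ^ critExp n) ^ (((n : ℝ) - 2) / n) with hT
  have hT0 : 0 ≤ T := Real.rpow_nonneg (integral_nonneg fun _ => by positivity) _
  have hbd : ∀ u, IsSmoothSolution Ω u → ∫ y in K, |u y| ^ critExp n ≤ δ →
      IntegrableOn (fun y => |u y| ^ p * h y ^ 2) K ∧
      ∫ y in K, |u y| ^ p * h y ^ 2 ≤ 1 / (4 * (p + 1) * C) * T := by
    intro u hu hle
    have hcu := hu.continuousOn.mono hζs
    refine ⟨((hcu.abs.rpow_const fun _ _ => Or.inr hp0.le).mul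
      (hh1.continuous.pow 2).continuousOn).integrableOn_compact hKc, ?_⟩
    refine (setIntegral_abs_rpow_mul_sq_le hn hKc hcu hh1.continuous hhc).trans ?_
    rw [← hδp]
    gcongr
  obtain ⟨i₁, b₁⟩ := hbd u₁ h₁ hu₁
  obtain ⟨i₂, b₂⟩ := hbd u₂ h₂ hu₂
  have hcn := continuous_critNonlinearity hn
  have hcont : ContinuousOn (fun y => ζ y * (u₁ y - u₂ y) *
      (critNonlinearity n (u₁ y) - critNonlinearity n (u₂ y))) Ω :=
    (hζ.continuous.continuousOn.mul (h₁.continuousOn.sub h₂.continuousOn)).mul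
      ((hcn.comp_continuousOn h₁.continuousOn).sub (hcn.comp_continuousOn h₂.continuousOn))
  have hIle : I ≤ (p + 1) * ((∫ y in K, |u₁ y| ^ p * h y ^ 2) + ∫ y in K, |u₂ y| ^ p * h y ^ 2) := by
    rw [← integral_add i₁ i₂, ← integral_const_mul, hI,
      ← setIntegral_eq_integral_of_forall_compl_eq_zero (s := K)]
    · refine integral_mono (integrable_mul_of_tsupport_subset hΩ hζ.continuous hζc hζs
        hcont).integrableOn ((i₁.add i₂).const_mul _) fun y => ?_
      have := mul_le_mul_of_nonneg_left (signed_rpow_sub_mul_le hp0 (u₁ y) (u₂ y))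
        (sq_nonneg (ζ y))
      simp only [critNonlinearity, hh]
      rw [← hp]
      nlinarith [this]
    · intro y hy
      rw [image_eq_zero_of_notMem_tsupport hy, zero_mul]
  have hfin : I ≤ 1 / 2 * (I + J) := by
    calc I ≤ (p + 1) * (1 / (4 * (p + 1) * C) * T + 1 / (4 * (p + 1) * C) * T) := by
          refine hIle.trans ?_
          gcongr
      _ = 1 / (2 * C) * T := by field_simp; ring
      _ ≤ 1 / (2 * C) * (C * (I + J)) := by gcongr
      _ = 1 / 2 * (I + J) := by field_simp
  linarith

end CriticalYamabe

/-! ### Rellich compactness through averages over small balls. -/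

namespace CriticalYamabe

open Set Metric

theorem sq_integral_le_integral_sq {α : Type*} [MeasurableSpace α] {μ : Measure α}
    [IsProbabilityMeasure μ] {f : α → ℝ} (hf : Integrable f μ)
    (hf2 : Integrable (fun a => f a ^ 2) μ) : (∫ a, f a ∂μ) ^ 2 ≤ ∫ a, f a ^ 2 ∂μ :=
  (even_two.convexOn_pow (𝕜 := ℝ)).map_integral_le (continuous_pow 2).continuousOn isClosed_univ
    (Eventually.of_forall fun _ => mem_univ _) hf hf2

theorem integrable_of_continuous_of_bounded {n : ℕ} {μ : Measure (Eu n)} [IsFiniteMeasure μ]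
    {f : Eu n → ℝ} (hf : Continuous f) (hc : ∃ C, ∀ x, ‖f x‖ ≤ C) : Integrable f μ := by
  obtain ⟨C, hC⟩ := hc
  exact Integrable.of_bound hf.aestronglyMeasurable C (Eventually.of_forall hC)

/-- `L²` modulus of continuity under translations. -/
theorem lintegral_translate_sub_sq_le {n : ℕ} {g : Eu n → ℝ} (hg : ContDiff ℝ 1 g) (h : Eu n) :
    ∫⁻ x, ENNReal.ofReal ((g (x + h) - g x) ^ 2) ≤
      ENNReal.ofReal (‖h‖ ^ 2) * ∫⁻ x, ENNReal.ofReal (‖gradient g x‖ ^ 2) := by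
  have hcg := continuous_gradient hg
  set μ : Measure ℝ := volume.restrict (Ioc 0 1) with hμ
  have hprob : IsProbabilityMeasure μ := ⟨by simp [hμ]⟩
  have hpt : ∀ x, ENNReal.ofReal ((g (x + h) - g x) ^ 2) ≤
      ∫⁻ t, ENNReal.ofReal (‖h‖ ^ 2 * ‖gradient g (x + t • h)‖ ^ 2) ∂μ := by
    intro x
    have hd : ∀ t : ℝ, HasDerivAt (fun t : ℝ => g (x + t • h)) (inner ℝ (gradient g (x + t • h)) h)
        t := by
      intro t
      have h1 : HasDerivAt (fun t : ℝ => x + t • h) h t := by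
        simpa using ((hasDerivAt_id t).smul_const h).const_add x
      have h2 := (hg.differentiable (by norm_num) (x + t • h)).hasFDerivAt.comp_hasDerivAt t h1
      rw [inner_gradient]
      exact h2
    have hct : Continuous fun t : ℝ => inner ℝ (gradient g (x + t • h)) h := by fun_prop
    -- The increment is an average of derivatives along the segment. Jensen and Cauchy–Schwarz bound
    -- its square; Tonelli and translation invariance finish.
    have hftc : g (x + h) - g x = ∫ t, inner ℝ (gradient g (x + t • h)) h ∂μ := by
      have := intervalIntegral.integral_eq_sub_of_hasDerivAt (fun t _ => hd t)
        (hct.intervalIntegrable 0 1)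
      rw [intervalIntegral.integral_of_le zero_le_one] at this
      simpa using this.symm
    have hint : ∀ f : ℝ → ℝ, Continuous f → Integrable f μ := fun f hf =>
      (hf.intervalIntegrable 0 1).1
    have h1 : (g (x + h) - g x) ^ 2 ≤ ∫ t, ‖h‖ ^ 2 * ‖gradient g (x + t • h)‖ ^ 2 ∂μ := by
      rw [hftc]
      refine (sq_integral_le_integral_sq (hint _ hct) (hint _ (hct.pow 2))).trans ?_
      refine integral_mono (hint _ (hct.pow 2)) (hint _ (by fun_prop)) fun t => ?_
      have := abs_real_inner_le_norm (gradient g (x + t • h)) h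
      calc inner ℝ (gradient g (x + t • h)) h ^ 2 = |inner ℝ (gradient g (x + t • h)) h| ^ 2 :=
            (sq_abs _).symm
        _ ≤ (‖gradient g (x + t • h)‖ * ‖h‖) ^ 2 := by gcongr
        _ = _ := by ring
    refine (ENNReal.ofReal_le_ofReal h1).trans ?_
    rw [ofReal_integral_eq_lintegral_ofReal (hint _ (by fun_prop))
      (Eventually.of_forall fun t => by positivity)]
  calc ∫⁻ x, ENNReal.ofReal ((g (x + h) - g x) ^ 2)
      ≤ ∫⁻ x, ∫⁻ t, ENNReal.ofReal (‖h‖ ^ 2 * ‖gradient g (x + t • h)‖ ^ 2) ∂μ :=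
        lintegral_mono hpt
    _ = ∫⁻ t, (∫⁻ x, ENNReal.ofReal (‖h‖ ^ 2 * ‖gradient g (x + t • h)‖ ^ 2)) ∂μ := by
        refine lintegral_lintegral_swap (Continuous.measurable ?_).aemeasurable
        unfold Function.uncurry
        exact ENNReal.continuous_ofReal.comp (by fun_prop)
    _ = ∫⁻ _ : ℝ, (ENNReal.ofReal (‖h‖ ^ 2) *
          ∫⁻ x, ENNReal.ofReal (‖gradient g x‖ ^ 2)) ∂μ := by
        refine lintegral_congr fun t => ?_
        have e : ∀ x, ENNReal.ofReal (‖h‖ ^ 2 * ‖gradient g (x + t • h)‖ ^ 2) =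
            ENNReal.ofReal (‖h‖ ^ 2) * ENNReal.ofReal (‖gradient g (x + t • h)‖ ^ 2) :=
          fun x => ENNReal.ofReal_mul (by positivity)
        simp only [e]
        rw [lintegral_const_mul _ (by fun_prop),
          lintegral_add_right_eq_self (fun x => ENNReal.ofReal (‖gradient g x‖ ^ 2)) (t • h)]
    _ = _ := by simp

/-- Averages over small balls approximate in `L²`. -/
theorem lintegral_sub_average_sq_le {n : ℕ} {g : Eu n → ℝ} (hg : ContDiff ℝ 1 g)
    (hc : HasCompactSupport g) {μ : Measure (Eu n)} [IsProbabilityMeasure μ] {ε : ℝ}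
    (hμ : ∀ᵐ h ∂μ, ‖h‖ ≤ ε) :
    ∫⁻ x, ENNReal.ofReal ((g x - ∫ h, g (x + h) ∂μ) ^ 2) ≤
      ENNReal.ofReal (ε ^ 2) * ∫⁻ x, ENNReal.ofReal (‖gradient g x‖ ^ 2) := by
  have hgc := hg.continuous
  obtain ⟨C, hC⟩ := hc.exists_bound_of_continuous hgc
  have hb1 : ∀ x, Integrable (fun h => g (x + h)) μ := fun x =>
    integrable_of_continuous_of_bounded (by fun_prop) ⟨C, fun h => hC _⟩
  have hb2 : ∀ x, Integrable (fun h => g (x + h) - g x) μ := fun x =>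
    (hb1 x).sub (integrable_const _)
  have hb3 : ∀ x, Integrable (fun h => (g (x + h) - g x) ^ 2) μ := fun x => by
    refine integrable_of_continuous_of_bounded (by fun_prop) ⟨(C + C) ^ 2, fun h => ?_⟩
    rw [norm_pow]
    gcongr
    exact (norm_sub_le _ _).trans (add_le_add (hC _) (hC _))
  have hpt : ∀ x, ENNReal.ofReal ((g x - ∫ h, g (x + h) ∂μ) ^ 2) ≤
      ∫⁻ h, ENNReal.ofReal ((g (x + h) - g x) ^ 2) ∂μ := by
    intro x
    have e : (g x - ∫ h, g (x + h) ∂μ) ^ 2 = (∫ h, (g (x + h) - g x) ∂μ) ^ 2 := by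
      rw [integral_sub (hb1 x) (integrable_const _)]
      simp
      ring
    rw [e]
    refine (ENNReal.ofReal_le_ofReal (sq_integral_le_integral_sq (hb2 x) (hb3 x))).trans ?_
    rw [ofReal_integral_eq_lintegral_ofReal (hb3 x) (Eventually.of_forall fun t => by positivity)]
  calc ∫⁻ x, ENNReal.ofReal ((g x - ∫ h, g (x + h) ∂μ) ^ 2)
      ≤ ∫⁻ x, ∫⁻ h, ENNReal.ofReal ((g (x + h) - g x) ^ 2) ∂μ := lintegral_mono hpt
    _ = ∫⁻ h, (∫⁻ x, ENNReal.ofReal ((g (x + h) - g x) ^ 2)) ∂μ := by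
        refine lintegral_lintegral_swap (Continuous.measurable ?_).aemeasurable
        unfold Function.uncurry
        exact ENNReal.continuous_ofReal.comp (by fun_prop)
    _ ≤ ∫⁻ _ : Eu n, (ENNReal.ofReal (ε ^ 2) *
          ∫⁻ x, ENNReal.ofReal (‖gradient g x‖ ^ 2)) ∂μ := by
        refine lintegral_mono_ae (hμ.mono fun h hh => ?_)
        refine (lintegral_translate_sub_sq_le hg h).trans ?_
        gcongr
    _ = _ := by simp

/-- Rellich's theorem, stated as a Cauchy criterion: a sequence of functions with supports in a
common compact set, bounded in `H¹`, whose averages over all balls converge, is Cauchy in `L²`. -/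
theorem tendsto_integral_sub_sq_of_bounded {n : ℕ} {w : ℕ → Eu n → ℝ} {K : Set (Eu n)}
    (hK : IsCompact K) (hw : ∀ i, ContDiff ℝ 1 (w i)) (hs : ∀ i, tsupport (w i) ⊆ K) {M : ℝ}
    (hM1 : ∀ i, ∫ x, w i x ^ 2 ≤ M) (hM2 : ∀ i, ∫ x, ‖gradient (w i) x‖ ^ 2 ≤ M)
    (hconv : ∀ x ε, ∃ l, Tendsto (fun i => ∫ y in ball x ε, w i y) atTop (𝓝 l)) :
    Tendsto (fun p : ℕ × ℕ => ∫ x, (w p.1 x - w p.2 x) ^ 2) atTop (𝓝 0) := by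
  have hcs : ∀ i, HasCompactSupport (w i) := fun i => hK.of_isClosed_subset (isClosed_tsupport _) (hs i)
  obtain ⟨g, hg⟩ : ∃ g : ℕ × ℕ → Eu n → ℝ, g = fun p x => w p.1 x - w p.2 x := ⟨_, rfl⟩
  have hg' : ∀ p x, w p.1 x - w p.2 x = g p x := fun p x => by rw [hg]
  simp only [hg']
  have hgd : ∀ p, ContDiff ℝ 1 (g p) := fun p => hg ▸ (hw p.1).sub (hw p.2)
  have hg0 : ∀ p x, x ∉ K → g p x = 0 := fun p x hx => by
    rw [← hg', image_eq_zero_of_notMem_tsupport fun h => hx (hs p.1 h),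
      image_eq_zero_of_notMem_tsupport fun h => hx (hs p.2 h), sub_zero]
  have hgc : ∀ p, HasCompactSupport (g p) := fun p => HasCompactSupport.intro hK (hg0 p)
  have hM0 : 0 ≤ M := (integral_nonneg fun _ => sq_nonneg _).trans (hM1 0)
  have hsqi : ∀ f : Eu n → ℝ, ContDiff ℝ 1 f → HasCompactSupport f → Integrable fun x => f x ^ 2 :=
    fun f hf hfc => (hf.continuous.pow 2).integrable_of_hasCompactSupport
      (hfc.mono fun x hx h => hx (by simp [h]))
  have hG1 : ∀ p, ∫ x, g p x ^ 2 ≤ 4 * M := by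
    intro p
    have h1 := hsqi _ (hw p.1) (hcs p.1)
    have h2 := hsqi _ (hw p.2) (hcs p.2)
    calc ∫ x, g p x ^ 2 ≤ ∫ x, (2 * w p.1 x ^ 2 + 2 * w p.2 x ^ 2) := by
          refine integral_mono (hsqi _ (hgd p) (hgc p)) ((h1.const_mul 2).add (h2.const_mul 2))
            fun x => ?_
          simp only [← hg']
          nlinarith [sq_nonneg (w p.1 x + w p.2 x)]
      _ = 2 * (∫ x, w p.1 x ^ 2) + 2 * ∫ x, w p.2 x ^ 2 := by
          rw [integral_add (h1.const_mul 2) (h2.const_mul 2), integral_const_mul,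
            integral_const_mul]
      _ ≤ 4 * M := by linarith [hM1 p.1, hM1 p.2]
  have hG2 : ∀ p, ∫⁻ x, ENNReal.ofReal (‖gradient (g p) x‖ ^ 2) ≤ ENNReal.ofReal (4 * M) := by
    intro p
    have h1 := integrable_gradient_sq (hw p.1) (hcs p.1)
    have h2 := integrable_gradient_sq (hw p.2) (hcs p.2)
    rw [← ofReal_integral_eq_lintegral_ofReal (integrable_gradient_sq (hgd p) (hgc p))
      (Eventually.of_forall fun t => by positivity)]
    refine ENNReal.ofReal_le_ofReal ?_
    calc ∫ x, ‖gradient (g p) x‖ ^ 2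
        ≤ ∫ x, (2 * ‖gradient (w p.1) x‖ ^ 2 + 2 * ‖gradient (w p.2) x‖ ^ 2) := by
          refine integral_mono (integrable_gradient_sq (hgd p) (hgc p))
            ((h1.const_mul 2).add (h2.const_mul 2)) fun x => ?_
          simp only [hg]
          rw [gradient_sub_apply ((hw p.1).differentiable (by norm_num) x)
            ((hw p.2).differentiable (by norm_num) x)]
          have := norm_sub_le (gradient (w p.1) x) (gradient (w p.2) x)
          have h3 := pow_le_pow_left₀ (norm_nonneg _) this 2
          nlinarith [sq_nonneg (‖gradient (w p.1) x‖ - ‖gradient (w p.2) x‖)]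
      _ = 2 * (∫ x, ‖gradient (w p.1) x‖ ^ 2) + 2 * ∫ x, ‖gradient (w p.2) x‖ ^ 2 := by
          rw [integral_add (h1.const_mul 2) (h2.const_mul 2), integral_const_mul,
            integral_const_mul]
      _ ≤ 4 * M := by linarith [hM2 p.1, hM2 p.2]
  -- At a fixed scale the averages of `w_i - w_j` tend to zero pointwise, are uniformly bounded and
  -- vanish off the `ε`-thickening of `K`, so dominated convergence applies.
  have havg : ∀ ε : ℝ, 0 < ε → Tendsto (fun p : ℕ × ℕ => ∫⁻ x, ENNReal.ofReal
      ((∫ h, g p (x + h) ∂(ProbabilityTheory.cond volume (ball (0 : Eu n) ε))) ^ 2))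
      atTop (𝓝 0) := by
    intro ε hε
    have hBpos : volume (ball (0 : Eu n) ε) ≠ 0 := (measure_ball_pos _ _ hε).ne'
    have hBfin : volume (ball (0 : Eu n) ε) ≠ ⊤ := measure_ball_lt_top.ne
    have hprob : IsProbabilityMeasure (ProbabilityTheory.cond volume (ball (0 : Eu n) ε)) :=
      ProbabilityTheory.cond_isProbabilityMeasure_of_finite hBpos hBfin
    set μ := ProbabilityTheory.cond volume (ball (0 : Eu n) ε) with hμ
    set b : ℝ := (volume (ball (0 : Eu n) ε))⁻¹.toReal with hb
    have hb0 : 0 ≤ b := ENNReal.toReal_nonneg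
    have hμint : ∀ f : Eu n → ℝ, ∫ h, f h ∂μ = b * ∫ h in ball 0 ε, f h := fun f => by
      rw [hμ, ProbabilityTheory.cond, integral_smul_measure, smul_eq_mul]
    have hμball : ∀ᵐ h ∂μ, h ∈ ball (0 : Eu n) ε := by
      rw [hμ]
      exact ProbabilityTheory.ae_cond_mem measurableSet_ball
    set K' := cthickening ε K
    have hK' : IsCompact K' := hK.cthickening
    have hval : ∀ p x, ∫ h, g p (x + h) ∂μ = b * ∫ y in ball x ε, g p y := by
      intro p x
      rw [hμint, ← integral_indicator measurableSet_ball, ← integral_indicator measurableSet_ball,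
        ← integral_add_left_eq_self ((ball x ε).indicator (g p)) x]
      congr 2
      ext h
      simp [indicator, dist_eq_norm]
    have hbd : ∀ p x, (∫ h, g p (x + h) ∂μ) ^ 2 ≤ b * (4 * M) := by
      intro p x
      have hgpc := (hgd p).continuous
      obtain ⟨C, hC⟩ := (hgc p).exists_bound_of_continuous hgpc
      have hi1 : Integrable (fun h => g p (x + h)) μ :=
        integrable_of_continuous_of_bounded (by fun_prop) ⟨C, fun h => hC _⟩
      have hi2 : Integrable (fun h => g p (x + h) ^ 2) μ := by
        refine integrable_of_continuous_of_bounded (by fun_prop) ⟨C ^ 2, fun h => ?_⟩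
        rw [norm_pow]
        gcongr
        exact hC _
      refine (sq_integral_le_integral_sq hi1 hi2).trans ?_
      rw [hμint]
      gcongr
      have hi3 := hsqi _ (hgd p) (hgc p)
      calc ∫ h in ball 0 ε, g p (x + h) ^ 2 ≤ ∫ h, g p (x + h) ^ 2 :=
            setIntegral_le_integral (hi3.comp_add_left x) (Eventually.of_forall fun _ => sq_nonneg _)
        _ = ∫ h, g p h ^ 2 := integral_add_left_eq_self (fun h => g p h ^ 2) x
        _ ≤ 4 * M := hG1 p
    have hsupp : ∀ p x, x ∉ K' → ∫ h, g p (x + h) ∂μ = 0 := by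
      intro p x hx
      refine integral_eq_zero_of_ae (hμball.mono fun h hh => hg0 p _ fun hmem => hx ?_)
      refine mem_cthickening_of_dist_le x (x + h) ε K hmem ?_
      rw [mem_ball_zero_iff] at hh
      simpa [dist_eq_norm] using hh.le
    have hlim : ∀ x, Tendsto (fun p : ℕ × ℕ => ∫ h, g p (x + h) ∂μ) atTop (𝓝 0) := by
      intro x
      obtain ⟨l, hl⟩ := hconv x ε
      have h1 : Tendsto (fun p : ℕ × ℕ => b * ((∫ y in ball x ε, w p.1 y) -
          ∫ y in ball x ε, w p.2 y)) atTop (𝓝 (b * (l - l))) := by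
        rw [← prod_atTop_atTop_eq]
        exact ((hl.comp tendsto_fst).sub (hl.comp tendsto_snd)).const_mul b
      rw [sub_self, mul_zero] at h1
      refine h1.congr fun p => ?_
      rw [hval, hg, integral_sub]
      · exact ((hw p.1).continuous.integrable_of_hasCompactSupport (hcs p.1)).integrableOn
      · exact ((hw p.2).continuous.integrable_of_hasCompactSupport (hcs p.2)).integrableOn
    have hdom := tendsto_lintegral_filter_of_dominated_convergence (μ := (volume : Measure (Eu n)))
      (l := (atTop : Filter (ℕ × ℕ)))
      (F := fun p x => ENNReal.ofReal ((∫ h, g p (x + h) ∂μ) ^ 2)) (f := fun _ => 0)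
      (K'.indicator fun _ => ENNReal.ofReal (b * (4 * M)))
      (Eventually.of_forall fun p => by
        have : StronglyMeasurable fun x => ∫ h, g p (x + h) ∂μ := by
          have hgpc := (hgd p).continuous
          exact StronglyMeasurable.integral_prod_right (f := fun x h => g p (x + h))
            (Continuous.stronglyMeasurable (by unfold Function.uncurry; fun_prop))
        exact (this.measurable.pow_const 2).ennreal_ofReal)
      (Eventually.of_forall fun p => Eventually.of_forall fun x => by
        by_cases hx : x ∈ K'
        · rw [indicator_of_mem hx]
          exact ENNReal.ofReal_le_ofReal (hbd p x)
        · rw [indicator_of_notMem hx, hsupp p x hx]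
          simp)
      (by
        rw [lintegral_indicator hK'.measurableSet, setLIntegral_const]
        exact ENNReal.mul_ne_top ENNReal.ofReal_ne_top hK'.measure_lt_top.ne)
      (Eventually.of_forall fun x => by
        have := ENNReal.tendsto_ofReal ((hlim x).pow 2)
        simpa using this)
    simpa using hdom
  -- Split `g` into its deviation from the average, controlled by `ε` and the gradient, and the
  -- average itself.
  have hmain : ∀ (ε : ℝ), 0 < ε → ∀ p, ENNReal.ofReal (∫ x, g p x ^ 2) ≤
      ENNReal.ofReal 2 * (ENNReal.ofReal (ε ^ 2) * ENNReal.ofReal (4 * M)) +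
        ENNReal.ofReal 2 * ∫⁻ x, ENNReal.ofReal
        ((∫ h, g p (x + h) ∂(ProbabilityTheory.cond volume (ball (0 : Eu n) ε))) ^ 2) := by
    intro ε hε p
    have hprob : IsProbabilityMeasure (ProbabilityTheory.cond volume (ball (0 : Eu n) ε)) :=
      ProbabilityTheory.cond_isProbabilityMeasure_of_finite (measure_ball_pos _ _ hε).ne'
        measure_ball_lt_top.ne
    have hgpc := (hgd p).continuous
    have hm : StronglyMeasurable fun x => ∫ h, g p (x + h)
        ∂(ProbabilityTheory.cond volume (ball (0 : Eu n) ε)) :=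
      StronglyMeasurable.integral_prod_right (f := fun x h => g p (x + h))
        (Continuous.stronglyMeasurable (by unfold Function.uncurry; fun_prop))
    have hnear := lintegral_sub_average_sq_le (hgd p) (hgc p) (ε := ε)
      (μ := ProbabilityTheory.cond volume (ball (0 : Eu n) ε))
      ((ProbabilityTheory.ae_cond_mem measurableSet_ball).mono fun h hh =>
        (mem_ball_zero_iff.1 hh).le)
    rw [ofReal_integral_eq_lintegral_ofReal (hsqi _ (hgd p) (hgc p))
      (Eventually.of_forall fun x => sq_nonneg _)]
    refine le_trans ?_ (add_le_add_left (mul_le_mul_right (hnear.trans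
      (mul_le_mul_right (hG2 p) _)) _) _)
    have hdm : Measurable fun x => ENNReal.ofReal ((g p x - ∫ h, g p (x + h)
        ∂(ProbabilityTheory.cond volume (ball (0 : Eu n) ε))) ^ 2) :=
      ((hgpc.measurable.sub hm.measurable).pow_const 2).ennreal_ofReal
    rw [← lintegral_const_mul _ hdm, ← lintegral_const_mul _
      (hm.measurable.pow_const 2).ennreal_ofReal, ← lintegral_add_left']
    · refine lintegral_mono fun x => ?_
      rw [← ENNReal.ofReal_mul (by norm_num),
        ← ENNReal.ofReal_mul (by norm_num), ← ENNReal.ofReal_add (by positivity) (by positivity)]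
      refine ENNReal.ofReal_le_ofReal ?_
      set a := ∫ h, g p (x + h) ∂(ProbabilityTheory.cond volume (ball (0 : Eu n) ε))
      nlinarith [sq_nonneg (g p x - 2 * a)]
    · exact (hdm.const_mul _).aemeasurable
  refine tendsto_order.2 ⟨fun a ha => Eventually.of_forall fun p =>
    ha.trans_le (integral_nonneg fun _ => sq_nonneg _), fun a ha => ?_⟩
  -- Makes the deviation term `8 M ε²` smaller than `a/2`; the `+ 1` covers `M = 0`. The averages
  -- contribute the other half.
  set ε : ℝ := Real.sqrt (a / (16 * (M + 1))) with hε
  have hε0 : 0 < ε := Real.sqrt_pos.2 (by positivity)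
  have hε2 : ε ^ 2 = a / (16 * (M + 1)) := Real.sq_sqrt (by positivity)
  have hev := (tendsto_order.1 (havg ε hε0)).2 (ENNReal.ofReal (a / 4))
    (ENNReal.ofReal_pos.2 (by positivity))
  filter_upwards [hev] with p hp
  have h1 := (hmain ε hε0 p).trans (add_le_add_right (mul_le_mul_right hp.le _) _)
  rw [← ENNReal.ofReal_mul (by positivity),
    ← ENNReal.ofReal_mul (by norm_num), ← ENNReal.ofReal_mul (by norm_num),
    ← ENNReal.ofReal_add (by positivity) (by positivity),
    ENNReal.ofReal_le_ofReal_iff (by positivity), hε2] at h1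
  have h2 : 2 * (a / (16 * (M + 1)) * (4 * M)) < a / 2 := by
    have : 2 * (a / (16 * (M + 1)) * (4 * M)) = a / 2 * (M / (M + 1)) := by field_simp; ring
    rw [this]
    have h3 : M / (M + 1) < 1 := by rw [div_lt_one (by positivity)]; linarith
    nlinarith
  linarith

end CriticalYamabe

/-! ### Energy density, energy bounds and energy measures. -/

namespace CriticalYamabe
open Set Metric

variable {n : ℕ}

/-- The energy density `½|A|² + (n-2)/(2n) |a|^{2n/(n-2)}`. -/
noncomputable def energyDensity (a : ℝ) (A : Eu n) : ℝ :=
  1 / 2 * ‖A‖ ^ 2 + ((n : ℝ) - 2) / (2 * n) * |a| ^ critExp n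

/-- `u` and `G` lie in `L² ∩ L^{2n/(n-2)}` and `L²` with integrals bounded by `M`. -/
structure HasEnergyBound (Ω : Set (Eu n)) (u : Eu n → ℝ) (G : Eu n → Eu n) (M : ℝ) : Prop where
  memL2 : InLpOn Ω 2 u
  memCrit : InLpOn Ω (critExp n) u
  gradMemL2 : InLpOn Ω 2 G
  integral_sq_le : ∫ x in Ω, u x ^ 2 ≤ M
  integral_abs_rpow_le : ∫ x in Ω, |u x| ^ critExp n ≤ M
  integral_norm_sq_le : ∫ x in Ω, ‖G x‖ ^ 2 ≤ M

theorem InLpOn.integrableOn_norm_rpow {F : Type*} [NormedAddCommGroup F] {Ω : Set (Eu n)} {p : ℝ}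
    {f : Eu n → F} (hp : 0 < p) (hf : InLpOn Ω p f) : IntegrableOn (fun x => ‖f x‖ ^ p) Ω := by
  have h := MemLp.integrable_norm_rpow hf (by simpa using hp) ENNReal.ofReal_ne_top
  simpa [IntegrableOn, ENNReal.toReal_ofReal hp.le] using h

theorem InLpOn.integral_norm_rpow_le {F : Type*} [NormedAddCommGroup F] {Ω : Set (Eu n)} {p : ℝ}
    {f : Eu n → F} {Λ : ℝ≥0} (hp : 0 < p) (hf : InLpOn Ω p f) (h : lpNormOn Ω p f ≤ Λ) :
    ∫ x in Ω, ‖f x‖ ^ p ≤ (Λ : ℝ) ^ p := by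
  have h1 := MemLp.eLpNorm_eq_integral_rpow_norm (by simpa using hp) ENNReal.ofReal_ne_top hf
  rw [lpNormOn, h1, ENNReal.toReal_ofReal hp.le] at h
  have hI : 0 ≤ ∫ x in Ω, ‖f x‖ ^ p := integral_nonneg fun x => by positivity
  have h2 : (∫ x in Ω, ‖f x‖ ^ p) ^ p⁻¹ ≤ (Λ : ℝ) := by
    rw [← ENNReal.ofReal_coe_nnreal] at h
    exact (ENNReal.ofReal_le_ofReal_iff Λ.2).1 h
  calc _ = ((∫ x in Ω, ‖f x‖ ^ p) ^ p⁻¹) ^ p := (Real.rpow_inv_rpow hI hp.ne').symm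
    _ ≤ _ := Real.rpow_le_rpow (by positivity) h2 hp.le

theorem InLpOn.integrableOn_norm_sq {F : Type*} [NormedAddCommGroup F] {Ω : Set (Eu n)}
    {f : Eu n → F} (hf : InLpOn Ω 2 f) : IntegrableOn (fun x => ‖f x‖ ^ 2) Ω := by
  simpa using hf.integrableOn_norm_rpow two_pos

theorem InLpOn.memLp_two {F : Type*} [NormedAddCommGroup F] {Ω : Set (Eu n)}
    {f : Eu n → F} (hf : InLpOn Ω 2 f) : MemLp f 2 (volume.restrict Ω) := by
  simpa [InLpOn] using hf

theorem _root_.MeasureTheory.MemLp.inLpOn_two {F : Type*} [NormedAddCommGroup F] {Ω : Set (Eu n)}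
    {f : Eu n → F} (hf : MemLp f 2 (volume.restrict Ω)) : InLpOn Ω 2 f := by
  simpa [InLpOn] using hf

theorem hasEnergyBound_of_norm_le (hn : 3 ≤ n) {Ω : Set (Eu n)} (hΩ : IsOpen Ω) {u : Eu n → ℝ}
    (hu : IsSmoothSolution Ω u) {Λ : ℝ≥0}
    (h : h1NormOn Ω u + lpNormOn Ω (critExp n) u ≤ Λ) :
    HasEnergyBound Ω u (gradient u) ((Λ : ℝ) ^ 2 + (Λ : ℝ) ^ critExp n) := by
  have hq := critExp_pos hn
  have h1 : h1NormOn Ω u ≤ Λ := le_trans le_self_add h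
  have h2 : lpNormOn Ω (critExp n) u ≤ Λ := le_trans le_add_self h
  have aux : ∀ a b : ℝ≥0∞, a ≤ (a ^ 2 + b ^ 2) ^ (1 / 2 : ℝ) := fun a b => by
    calc a = (a ^ 2) ^ (1 / 2 : ℝ) := by
          rw [← ENNReal.rpow_natCast, ← ENNReal.rpow_mul]; norm_num
      _ ≤ _ := ENNReal.rpow_le_rpow le_self_add (by norm_num)
  have h3 : lpNormOn Ω 2 u ≤ Λ := (aux _ _).trans h1
  have h4 : lpNormOn Ω 2 (gradient u) ≤ Λ := by
    refine (aux _ (lpNormOn Ω 2 u)).trans ?_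
    rw [add_comm]; exact h1
  have m1 : AEStronglyMeasurable u (volume.restrict Ω) :=
    hu.continuousOn.aestronglyMeasurable hΩ.measurableSet
  have m2 : AEStronglyMeasurable (gradient u) (volume.restrict Ω) :=
    (hu.continuousOn_gradient hΩ).aestronglyMeasurable hΩ.measurableSet
  have i1 : InLpOn Ω 2 u := ⟨m1, h3.trans_lt ENNReal.coe_lt_top⟩
  have i2 : InLpOn Ω (critExp n) u := ⟨m1, h2.trans_lt ENNReal.coe_lt_top⟩
  have i3 : InLpOn Ω 2 (gradient u) := ⟨m2, h4.trans_lt ENNReal.coe_lt_top⟩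
  have p1 : 0 ≤ (Λ : ℝ) ^ 2 := by positivity
  have p2 : 0 ≤ (Λ : ℝ) ^ critExp n := by positivity
  refine ⟨i1, i2, i3, ?_, ?_, ?_⟩
  · have := i1.integral_norm_rpow_le two_pos h3
    simp only [Real.rpow_ofNat, Real.norm_eq_abs, sq_abs] at this
    linarith
  · have := i2.integral_norm_rpow_le hq h2
    simp only [Real.norm_eq_abs] at this
    linarith
  · have := i3.integral_norm_rpow_le two_pos h4
    simp only [Real.rpow_ofNat] at this
    linarith

/-- Read off from integrability of the limit itself. The size of the bound never matters, so no
lower semicontinuity of norms is needed. -/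
theorem WeakLimitOn.exists_hasEnergyBound {Ω : Set (Eu n)} {u : ℕ → Eu n → ℝ}
    {v : Eu n → ℝ} {G : Eu n → Eu n} (h : WeakLimitOn Ω u v G) :
    ∃ M, HasEnergyBound Ω v G M :=
  ⟨max (∫ x in Ω, v x ^ 2) (max (∫ x in Ω, |v x| ^ critExp n) (∫ x in Ω, ‖G x‖ ^ 2)),
    h.memL2, h.memCrit, h.gradMemL2, by simp, by simp, by simp⟩

variable {Ω : Set (Eu n)} {u a b : Eu n → ℝ} {G A B : Eu n → Eu n} {M M' : ℝ}

theorem energyDensity_nonneg (hn : 3 ≤ n) (a : ℝ) (A : Eu n) : 0 ≤ energyDensity a A := by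
  have := natCast_sub_two_pos hn
  unfold energyDensity
  positivity

namespace HasEnergyBound

theorem integrableOn_sq (h : HasEnergyBound Ω u G M) : IntegrableOn (fun x => u x ^ 2) Ω := by
  simpa using h.memL2.integrableOn_norm_sq

theorem integrableOn_abs_rpow (hn : 3 ≤ n) (h : HasEnergyBound Ω u G M) :
    IntegrableOn (fun x => |u x| ^ critExp n) Ω := by
  simpa using h.memCrit.integrableOn_norm_rpow (critExp_pos hn)

theorem integrableOn_energyDensity (hn : 3 ≤ n) (h : HasEnergyBound Ω u G M) :
    IntegrableOn (fun x => energyDensity (u x) (G x)) Ω :=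
  (h.gradMemL2.integrableOn_norm_sq.const_mul _).add ((h.integrableOn_abs_rpow hn).const_mul _)

theorem integral_energyDensity_le (hn : 3 ≤ n) (h : HasEnergyBound Ω u G M) :
    ∫ x in Ω, energyDensity (u x) (G x) ≤ (1 / 2 + ((n : ℝ) - 2) / (2 * n)) * M := by
  have := natCast_sub_two_pos hn
  unfold energyDensity
  rw [integral_add (h.gradMemL2.integrableOn_norm_sq.const_mul _)
    ((h.integrableOn_abs_rpow hn).const_mul _), integral_const_mul, integral_const_mul, add_mul]
  gcongr
  · exact h.integral_norm_sq_le
  · exact h.integral_abs_rpow_le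

theorem isFiniteMeasure (hn : 3 ≤ n) (h : HasEnergyBound Ω u G M) :
    IsFiniteMeasure (energyMeasure Ω u G) :=
  isFiniteMeasure_withDensity_ofReal (h.integrableOn_energyDensity hn).2

theorem integral_energyMeasure (hn : 3 ≤ n) (h : HasEnergyBound Ω u G M) (φ : Eu n → ℝ) :
    ∫ x, φ x ∂(energyMeasure Ω u G) = ∫ x in Ω, φ x * energyDensity (u x) (G x) := by
  have hm : AEMeasurable (fun x => ENNReal.ofReal (energyDensity (u x) (G x)))
      (volume.restrict Ω) := (h.integrableOn_energyDensity hn).1.aemeasurable.ennreal_ofReal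
  have := integral_withDensity_eq_integral_toReal_smul₀ hm
    (Eventually.of_forall fun x => ENNReal.ofReal_lt_top) φ
  refine Eq.trans this (integral_congr_ae (Eventually.of_forall fun x => ?_))
  simp only [ENNReal.toReal_ofReal (energyDensity_nonneg hn _ _), smul_eq_mul]
  ring

end HasEnergyBound

theorem energyMeasure_singleton (hn : 3 ≤ n) (Ω : Set (Eu n)) (u : Eu n → ℝ) (G : Eu n → Eu n)
    (x : Eu n) : energyMeasure Ω u G {x} = 0 := by
  have := nontrivial_eu hn
  refine (withDensity_absolutelyContinuous (volume.restrict Ω) _).trans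
    Measure.absolutelyContinuous_restrict ?_
  exact measure_singleton x

theorem energyMeasure_compl (hΩ : MeasurableSet Ω) (u : Eu n → ℝ) (G : Eu n → Eu n) :
    energyMeasure Ω u G Ωᶜ = 0 := by
  refine withDensity_absolutelyContinuous (volume.restrict Ω) _ ?_
  rw [Measure.restrict_apply hΩ.compl]; simp

/-- Both terms of the energy density are convex, so it lies above its tangent plane; the
normalisation `(n-2)/(2n) * q = 1` makes the slope in `a` exactly the nonlinearity. -/
theorem energyDensity_add_le (hn : 3 ≤ n) (a b : ℝ) (A B : Eu n) :
    energyDensity a A + (inner ℝ A (B - A) + critNonlinearity n a * (b - a)) ≤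
      energyDensity b B := by
  have h2 := natCast_sub_two_pos hn
  have hq : 1 < critExp n := by linarith [two_lt_critExp hn]
  have h1 := abs_rpow_tangent_le hq a b
  have hc := coeff_mul_critExp hn
  have hc0 : 0 ≤ ((n : ℝ) - 2) / (2 * n) := by positivity
  rw [critExp_sub_two hn] at h1
  have h3 := mul_le_mul_of_nonneg_left h1 hc0
  have h4 : ‖B‖ ^ 2 = ‖A‖ ^ 2 + 2 * inner ℝ A (B - A) + ‖B - A‖ ^ 2 := by
    rw [← norm_add_sq_real]; simp
  have h5 : 0 ≤ ‖B - A‖ ^ 2 := by positivity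
  unfold energyDensity critNonlinearity
  have h6 : ((n : ℝ) - 2) / (2 * n) * (|a| ^ critExp n +
      critExp n * (a * |a| ^ (4 / ((n : ℝ) - 2))) * (b - a)) =
      ((n : ℝ) - 2) / (2 * n) * |a| ^ critExp n + (a * |a| ^ (4 / ((n : ℝ) - 2))) * (b - a) := by
    calc _ = ((n : ℝ) - 2) / (2 * n) * |a| ^ critExp n + (((n : ℝ) - 2) / (2 * n) * critExp n) *
        ((a * |a| ^ (4 / ((n : ℝ) - 2))) * (b - a)) := by ring
      _ = _ := by rw [hc, one_mul]
  linarith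

/-- The nonlinearity has modulus `|u|^((n+2)/(n-2))`, hence lies in the dual of `L^q` and is
admissible as a test function for weak convergence. -/
theorem HasEnergyBound.memLp_critNonlinearity (hn : 3 ≤ n) (h : HasEnergyBound Ω u G M) :
    InLpOn Ω (2 * (n : ℝ) / ((n : ℝ) + 2)) (fun x => critNonlinearity n (u x)) := by
  have h2 := natCast_sub_two_pos hn
  have hs : (0 : ℝ) < ((n : ℝ) + 2) / ((n : ℝ) - 2) := by positivity
  have h1 := MemLp.norm_rpow_div h.memCrit (ENNReal.ofReal (((n : ℝ) + 2) / ((n : ℝ) - 2)))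
  rw [← ENNReal.ofReal_div_of_pos hs, ENNReal.toReal_ofReal hs.le] at h1
  have e : critExp n / (((n : ℝ) + 2) / ((n : ℝ) - 2)) = 2 * (n : ℝ) / ((n : ℝ) + 2) := by
    unfold critExp; field_simp
  rw [e] at h1
  refine h1.congr_norm ((continuous_critNonlinearity hn).comp_aestronglyMeasurable h.memL2.1)
    (Eventually.of_forall fun x => ?_)
  have e2 : ((n : ℝ) + 2) / ((n : ℝ) - 2) = 1 + 4 / ((n : ℝ) - 2) := by field_simp; ring
  have hp : 0 ≤ 4 / ((n : ℝ) - 2) := by positivity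
  rw [critNonlinearity, norm_mul, Real.norm_eq_abs (|u x| ^ (4 / ((n : ℝ) - 2))), e2,
    Real.norm_eq_abs (u x), Real.norm_eq_abs,
    Real.rpow_add_of_nonneg (abs_nonneg _) zero_le_one hp, Real.rpow_one,
    abs_of_nonneg (mul_nonneg (abs_nonneg _) (Real.rpow_nonneg (abs_nonneg _) _)),
    abs_of_nonneg (Real.rpow_nonneg (abs_nonneg _) _)]

end CriticalYamabe

/-! ### Weak convergence and convexity: gain and loss of energy in the limit. -/

namespace CriticalYamabe
open Set Metric

variable {n : ℕ} {Ω : Set (Eu n)} {a b : Eu n → ℝ} {A B : Eu n → Eu n} {M M' C : ℝ} {φ : Eu n → ℝ}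

theorem critNonlinearity_sub_mul_nonneg (hn : 3 ≤ n) (s t : ℝ) :
    0 ≤ (critNonlinearity n s - critNonlinearity n t) * (s - t) := by
  have hq : 1 < critExp n := by linarith [two_lt_critExp hn]
  have h1 := abs_rpow_tangent_le hq s t
  have h2 := abs_rpow_tangent_le hq t s
  rw [critExp_sub_two hn] at h1 h2
  unfold critNonlinearity
  have h3 : 0 ≤ critExp n * ((s * |s| ^ (4 / ((n : ℝ) - 2)) - t * |t| ^ (4 / ((n : ℝ) - 2))) *
      (s - t)) := by linarith
  exact nonneg_of_mul_nonneg_right h3 (by linarith)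

theorem holderConjugate_critExp (hn : 3 ≤ n) :
    (critExp n).HolderConjugate (2 * (n : ℝ) / ((n : ℝ) + 2)) := by
  have h2 := natCast_sub_two_pos hn
  rw [Real.holderConjugate_iff]
  refine ⟨by linarith [two_lt_critExp hn], ?_⟩
  have : (n : ℝ) ≠ 0 := by linarith
  unfold critExp
  field_simp
  ring

theorem InLpOn.integrableOn_mul_of_critExp (hn : 3 ≤ n) {f g : Eu n → ℝ}
    (hf : InLpOn Ω (critExp n) f) (hg : InLpOn Ω (2 * (n : ℝ) / ((n : ℝ) + 2)) g) :
    IntegrableOn (fun x => f x * g x) Ω := by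
  have := (holderConjugate_critExp hn).ennrealOfReal
  exact MemLp.integrable_mul hf hg

theorem InLpOn.integrableOn_inner {f g : Eu n → Eu n} (hf : InLpOn Ω 2 f) (hg : InLpOn Ω 2 g) :
    IntegrableOn (fun x => inner ℝ (f x) (g x)) Ω := by
  have h : IntegrableOn (fun x => ‖f x‖ * ‖g x‖) Ω :=
    MemLp.integrable_mul (p := 2) (q := 2) hf.memLp_two.norm hg.memLp_two.norm
  refine Integrable.mono h (hf.1.inner hg.1) (Eventually.of_forall fun x => ?_)
  rw [norm_mul, norm_norm, norm_norm]
  exact norm_inner_le_norm _ _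

theorem InLpOn.bdd_smul {F : Type*} [NormedAddCommGroup F] [NormedSpace ℝ F] {p : ℝ}
    {f : Eu n → F} (hφ : Continuous φ) (hC : ∀ x, |φ x| ≤ C) (hf : InLpOn Ω p f) :
    InLpOn Ω p (fun x => φ x • f x) := by
  refine MemLp.of_le_mul (c := C) hf (hφ.aestronglyMeasurable.smul hf.1)
    (Eventually.of_forall fun x => ?_)
  rw [norm_smul]
  exact mul_le_mul_of_nonneg_right (hC x) (norm_nonneg _)

/-- The first-order part of the energy at `(a, A)` in the direction `(b - a, B - A)`,
weighted by `φ`. -/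
noncomputable def crossTerm (Ω : Set (Eu n)) (φ a : Eu n → ℝ) (A : Eu n → Eu n) (b : Eu n → ℝ)
    (B : Eu n → Eu n) : ℝ :=
  ∫ x in Ω, φ x * (inner ℝ (A x) (B x - A x) + critNonlinearity n (a x) * (b x - a x))

theorem crossTerm_self (Ω : Set (Eu n)) (φ a : Eu n → ℝ) (A : Eu n → Eu n) :
    crossTerm Ω φ a A a A = 0 := by
  simp [crossTerm]

section

variable (hn : 3 ≤ n) (hφ : Continuous φ) (hC : ∀ x, |φ x| ≤ C)
  (ha : HasEnergyBound Ω a A M) (hb : HasEnergyBound Ω b B M')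

include hn hφ hC ha hb

theorem crossTerm_integrable_aux :
    IntegrableOn (fun x => inner ℝ (B x) (φ x • A x)) Ω ∧
      IntegrableOn (fun x => b x * (φ x * critNonlinearity n (a x))) Ω :=
  ⟨hb.gradMemL2.integrableOn_inner (ha.gradMemL2.bdd_smul hφ hC),
    hb.memCrit.integrableOn_mul_of_critExp hn ((ha.memLp_critNonlinearity hn).bdd_smul hφ hC)⟩

theorem integrableOn_crossTerm :
    IntegrableOn (fun x => φ x * (inner ℝ (A x) (B x - A x) +
      critNonlinearity n (a x) * (b x - a x))) Ω := by
  have h1 := crossTerm_integrable_aux hn hφ hC ha hb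
  have h2 := crossTerm_integrable_aux hn hφ hC ha ha
  refine (((h1.1.sub h2.1).add h1.2).sub h2.2).congr (Eventually.of_forall fun x => ?_)
  simp only [Pi.sub_apply, Pi.add_apply, inner_smul_right, inner_sub_right,
    real_inner_comm (B x) (A x)]
  ring

/-- Isolates the parts linear in `b` and `B`, to which weak convergence applies with `a` and `A`
fixed. -/
theorem crossTerm_eq :
    crossTerm Ω φ a A b B = (∫ x in Ω, inner ℝ (B x) (φ x • A x)) -
      (∫ x in Ω, inner ℝ (A x) (φ x • A x)) +
      (∫ x in Ω, b x * (φ x * critNonlinearity n (a x))) -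
      ∫ x in Ω, a x * (φ x * critNonlinearity n (a x)) := by
  have h1 := crossTerm_integrable_aux hn hφ hC ha hb
  have h2 := crossTerm_integrable_aux hn hφ hC ha ha
  have e1 := integral_sub h1.1 h2.1
  have e2 := integral_add (h1.1.sub h2.1) h1.2
  have e3 := integral_sub ((h1.1.sub h2.1).add h1.2) h2.2
  simp only [Pi.sub_apply, Pi.add_apply] at e1 e2 e3
  rw [← e1, ← e2, ← e3, crossTerm]
  refine integral_congr_ae (Eventually.of_forall fun x => ?_)
  simp only [inner_smul_right, inner_sub_right,
    real_inner_comm (B x) (A x)]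
  ring

omit hb in
theorem integrableOn_mul_energyDensity :
    IntegrableOn (fun x => φ x * energyDensity (a x) (A x)) Ω :=
  (ha.integrableOn_energyDensity hn).bdd_mul hφ.aestronglyMeasurable
    (c := C) (Eventually.of_forall hC)

theorem integral_add_crossTerm_le (h0 : ∀ x, 0 ≤ φ x) :
    (∫ x, φ x ∂(energyMeasure Ω a A)) + crossTerm Ω φ a A b B ≤
      ∫ x, φ x ∂(energyMeasure Ω b B) := by
  have i1 := integrableOn_mul_energyDensity hn hφ hC ha
  have i2 := integrableOn_mul_energyDensity hn hφ hC hb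
  have i3 := integrableOn_crossTerm hn hφ hC ha hb
  rw [ha.integral_energyMeasure hn, hb.integral_energyMeasure hn, crossTerm, ← integral_add i1 i3]
  refine integral_mono (i1.add i3) i2 fun x => ?_
  beta_reduce
  rw [← mul_add]
  exact mul_le_mul_of_nonneg_left (energyDensity_add_le hn _ _ _ _) (h0 x)

/-- The first-order terms from two base points add up to minus a monotone quadratic quantity,
exactly what the estimate for differences of solutions controls. -/
theorem crossTerm_add_crossTerm :
    crossTerm Ω φ a A b B + crossTerm Ω φ b B a A =
      -∫ x in Ω, φ x * (‖A x - B x‖ ^ 2 +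
        (critNonlinearity n (a x) - critNonlinearity n (b x)) * (a x - b x)) := by
  rw [crossTerm, crossTerm, ← integral_add (integrableOn_crossTerm hn hφ hC ha hb)
    (integrableOn_crossTerm hn hφ hC hb ha), ← integral_neg]
  refine integral_congr_ae (Eventually.of_forall fun x => ?_)
  simp only [← real_inner_self_eq_norm_sq, inner_sub_right, inner_sub_left,
    real_inner_comm (B x) (A x)]
  ring

end

theorem WeakLimitOn.tendsto_crossTerm (hn : 3 ≤ n) (hφ : Continuous φ) (hC : ∀ x, |φ x| ≤ C)
    {u : ℕ → Eu n → ℝ} {v : Eu n → ℝ} {G : Eu n → Eu n} (h : WeakLimitOn Ω u v G)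
    (hu : ∀ i, HasEnergyBound Ω (u i) (gradient (u i)) M') (ha : HasEnergyBound Ω a A M) :
    Tendsto (fun i => crossTerm Ω φ a A (u i) (gradient (u i))) atTop
      (𝓝 (crossTerm Ω φ a A v G)) := by
  obtain ⟨Mv, hv⟩ := h.exists_hasEnergyBound
  rw [crossTerm_eq hn hφ hC ha hv]
  simp_rw [fun i => crossTerm_eq hn hφ hC ha (hu i)]
  have h1 := h.tendstoGrad _ (ha.gradMemL2.bdd_smul hφ hC)
  have h2 := h.tendstoCrit _ ((ha.memLp_critNonlinearity hn).bdd_smul hφ hC)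
  exact ((h1.sub_const _).add h2).sub_const _

/-- Weak lower semicontinuity of the energy. -/
theorem WeakLimitOn.integral_energyMeasure_le (hn : 3 ≤ n) (hφ : Continuous φ)
    (hc : HasCompactSupport φ) (hs : tsupport φ ⊆ Ω) (h0 : ∀ x, 0 ≤ φ x)
    {u : ℕ → Eu n → ℝ} {v : Eu n → ℝ} {G : Eu n → Eu n} {η : Measure (Eu n)}
    (h : WeakLimitOn Ω u v G) (hu : ∀ i, HasEnergyBound Ω (u i) (gradient (u i)) M')
    (hη : MeasureLimitOn Ω (fun i => energyMeasure Ω (u i) (gradient (u i))) η) :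
    ∫ x, φ x ∂(energyMeasure Ω v G) ≤ ∫ x, φ x ∂η := by
  obtain ⟨Mv, hv⟩ := h.exists_hasEnergyBound
  obtain ⟨C, hC⟩ := hc.exists_bound_of_continuous hφ
  have h1 := h.tendsto_crossTerm hn hφ hC hu hv
  rw [crossTerm_self] at h1
  have h2 := h1.const_add (∫ x, φ x ∂(energyMeasure Ω v G))
  rw [add_zero] at h2
  exact le_of_tendsto_of_tendsto' h2 (hη.tendsto φ hφ hc hs) fun i =>
    integral_add_crossTerm_le hn hφ hC hv (hu i) h0

/-- If the mixed second-order terms of the sequence are asymptotically small, there is no loss of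
energy in the limit. -/
theorem WeakLimitOn.le_integral_energyMeasure (hn : 3 ≤ n) (hφ : Continuous φ)
    (hc : HasCompactSupport φ) (hs : tsupport φ ⊆ Ω) (h0 : ∀ x, 0 ≤ φ x)
    {u : ℕ → Eu n → ℝ} {v : Eu n → ℝ} {G : Eu n → Eu n} {η : Measure (Eu n)}
    (h : WeakLimitOn Ω u v G) (hu : ∀ i, HasEnergyBound Ω (u i) (gradient (u i)) M')
    (hη : MeasureLimitOn Ω (fun i => energyMeasure Ω (u i) (gradient (u i))) η)
    (hsmall : ∀ ε > 0, ∃ N, ∀ i ≥ N, ∀ j ≥ N,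
      ∫ x in Ω, φ x * (‖gradient (u i) x - gradient (u j) x‖ ^ 2 +
        (critNonlinearity n (u i x) - critNonlinearity n (u j x)) * (u i x - u j x)) ≤ ε) :
    ∫ x, φ x ∂η ≤ ∫ x, φ x ∂(energyMeasure Ω v G) := by
  obtain ⟨Mv, hv⟩ := h.exists_hasEnergyBound
  obtain ⟨C, hC⟩ := hc.exists_bound_of_continuous hφ
  refine le_of_forall_pos_le_add fun ε hε => ?_
  obtain ⟨N, hN⟩ := hsmall ε hε
  -- Freeze the index `N`. Convexity at `u_j` and smallness of the symmetrised cross term bound the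
  -- cross term from `u_N` to `u_j` below by `E(u_j) - E(u_N) - ε`, with `E` the weighted energy.
  -- Let `j → ∞` and use convexity at `u_N` towards `v`.
  have h1 := h.tendsto_crossTerm hn hφ hC hu (hu N)
  have h2 := (hη.tendsto φ hφ hc hs).sub_const
    (ε + ∫ x, φ x ∂(energyMeasure Ω (u N) (gradient (u N))))
  have h3 := le_of_tendsto_of_tendsto h2 h1 (by
    filter_upwards [eventually_ge_atTop N] with j hj
    have e1 := crossTerm_add_crossTerm hn hφ hC (hu N) (hu j)
    have e2 := hN N le_rfl j hj
    have e3 := integral_add_crossTerm_le hn hφ hC (hu j) (hu N) h0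
    linarith)
  have h4 := integral_add_crossTerm_le hn hφ hC (hu N) hv h0
  linarith

end CriticalYamabe

/-! ### Local strong convergence in `L²`. -/

namespace CriticalYamabe
open Set Metric

variable {n : ℕ} {Ω : Set (Eu n)} {M : ℝ} {χ : Eu n → ℝ} {u : ℕ → Eu n → ℝ} {v : Eu n → ℝ}
  {G : Eu n → Eu n}

theorem integral_le_of_le_on {f g : Eu n → ℝ} (hΩ : IsOpen Ω) (hg : IntegrableOn g Ω)
    (h0 : ∀ x, 0 ≤ f x) (hle : ∀ x ∈ Ω, f x ≤ g x) (hf : ∀ x ∉ Ω, f x = 0) :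
    ∫ x, f x ≤ ∫ x in Ω, g x := by
  rw [← setIntegral_eq_integral_of_forall_compl_eq_zero hf]
  exact integral_mono_of_nonneg (Eventually.of_forall h0) hg
    (ae_restrict_of_forall_mem hΩ.measurableSet hle)

/-- Local strong `L²` compactness of a weakly convergent sequence. -/
theorem WeakLimitOn.tendsto_integral_mul_sub_sq (hΩ : IsOpen Ω)
    (hχ : ContDiff ℝ ∞ χ) (hχc : HasCompactSupport χ) (hχs : tsupport χ ⊆ Ω)
    (hsol : ∀ i, IsSmoothSolution Ω (u i))
    (h : WeakLimitOn Ω u v G) (hu : ∀ i, HasEnergyBound Ω (u i) (gradient (u i)) M) :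
    Tendsto (fun p : ℕ × ℕ => ∫ x, (χ x * u p.1 x - χ x * u p.2 x) ^ 2) atTop (𝓝 0) := by
  have hχ1 : ContDiff ℝ 1 χ := hχ.of_le (by norm_cast)
  obtain ⟨C, hC⟩ := hχc.exists_bound_of_continuous hχ.continuous
  obtain ⟨D, hD⟩ := (hasCompactSupport_gradient hχc).exists_bound_of_continuous
    (continuous_gradient hχ1)
  have hz : ∀ x, x ∉ Ω → χ x = 0 := fun x hx =>
    image_eq_zero_of_notMem_tsupport fun h => hx (hχs h)
  have hgz : ∀ x, x ∉ Ω → gradient χ x = 0 := fun x hx =>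
    gradient_eq_zero_of_notMem_tsupport fun h => hx (hχs h)
  have hM : 0 ≤ M := (integral_nonneg fun _ => sq_nonneg _).trans (hu 0).integral_sq_le
  have hsup : ∀ i, tsupport (fun x => χ x * u i x) ⊆ tsupport χ := fun i =>
    closure_mono fun x hx hx' => hx (by simp [hx'])
  refine tendsto_integral_sub_sq_of_bounded (w := fun i x => χ x * u i x) hχc.isCompact
    (fun i => ?_) hsup (M := 2 * C ^ 2 * M + 2 * D ^ 2 * M) (fun i => ?_) (fun i => ?_) ?_
  · exact (contDiff_smul_of_tsupport_subset hΩ hχ hχs (hsol i).smooth).of_le (by norm_cast)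
  · refine (integral_le_of_le_on hΩ ((hu i).integrableOn_sq.const_mul (C ^ 2))
      (fun x => sq_nonneg _) (fun x _ => ?_) fun x hx => by simp [hz x hx]).trans ?_
    · rw [mul_pow]
      exact mul_le_mul_of_nonneg_right (sq_le_sq' (abs_le.1 (hC x)).1 (abs_le.1 (hC x)).2)
        (sq_nonneg _)
    · rw [integral_const_mul]
      have := mul_le_mul_of_nonneg_left (hu i).integral_sq_le (sq_nonneg C)
      nlinarith [mul_nonneg (sq_nonneg C) hM, mul_nonneg (sq_nonneg D) hM]
  · refine (integral_le_of_le_on hΩ (((hu i).gradMemL2.integrableOn_norm_sq.const_mul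
      (2 * C ^ 2)).add ((hu i).integrableOn_sq.const_mul (2 * D ^ 2)))
      (fun x => sq_nonneg _) (fun x hx => ?_) fun x hx => ?_).trans ?_
    · rw [gradient_mul (hχ1.differentiable (by norm_num) x)
        (((hsol i).contDiffAt_one hΩ hx).differentiableAt (by norm_num))]
      have h1 : ‖χ x • gradient (u i) x‖ ≤ C * ‖gradient (u i) x‖ := by
        rw [norm_smul]; exact mul_le_mul_of_nonneg_right (hC x) (norm_nonneg _)
      have h2 : ‖u i x • gradient χ x‖ ≤ D * |u i x| := by
        rw [norm_smul, mul_comm]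
        exact mul_le_mul_of_nonneg_right (hD x) (norm_nonneg _)
      have h3 := norm_add_le (χ x • gradient (u i) x) (u i x • gradient χ x)
      have h4 := pow_le_pow_left₀ (norm_nonneg _) (h3.trans (add_le_add h1 h2)) 2
      simp only [Pi.add_apply]
      have h5 : |u i x| ^ 2 = u i x ^ 2 := sq_abs _
      nlinarith [sq_nonneg (C * ‖gradient (u i) x‖ - D * |u i x|)]
    · have : x ∉ tsupport (fun x => χ x * u i x) := fun h => hx (hχs (hsup i h))
      rw [gradient_eq_zero_of_notMem_tsupport this]; simp
    · simp only [Pi.add_apply]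
      rw [integral_add ((hu i).gradMemL2.integrableOn_norm_sq.const_mul _)
        ((hu i).integrableOn_sq.const_mul _), integral_const_mul, integral_const_mul]
      gcongr
      · exact (hu i).integral_norm_sq_le
      · exact (hu i).integral_sq_le
  · intro x ε
    -- The ball integrals required by Rellich's criterion are pairings with this fixed `L²`
    -- function.
    have hψ : InLpOn Ω 2 ((ball x ε).indicator χ) := by
      refine MemLp.inLpOn_two ?_
      exact ((hχ.continuous.memLp_of_hasCompactSupport hχc).restrict Ω).indicator measurableSet_ball
    refine ⟨_, (h.tendstoL2 _ hψ).congr fun i => ?_⟩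
    rw [← integral_indicator measurableSet_ball, setIntegral_eq_integral_of_forall_compl_eq_zero]
    · refine integral_congr_ae (Eventually.of_forall fun y => ?_)
      by_cases hy : y ∈ ball x ε <;> simp [hy, mul_comm]
    · intro y hy
      by_cases hy' : y ∈ ball x ε <;> simp [hy', hz y hy]

end CriticalYamabe

/-! ### No loss of energy below a threshold. -/

namespace CriticalYamabe
open Set Metric

/-- `δ` is a smallness threshold for the `L^{2n/(n-2)}` mass of the sequence on a ball, below which
there is no loss of energy in the limit on the ball of half the radius. -/
def IsCompactnessConst (n : ℕ) (δ : ℝ) : Prop :=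
  ∀ (Ω : Set (Eu n)) (u : ℕ → Eu n → ℝ) (v : Eu n → ℝ) (G : Eu n → Eu n) (η : Measure (Eu n))
    (M : ℝ) (x : Eu n) (s : ℝ) (φ : Eu n → ℝ), IsOpen Ω → (∀ i, IsSmoothSolution Ω (u i)) →
    (∀ i, HasEnergyBound Ω (u i) (gradient (u i)) M) → WeakLimitOn Ω u v G →
    MeasureLimitOn Ω (fun i => energyMeasure Ω (u i) (gradient (u i))) η →
    0 < s → closedBall x s ⊆ Ω → (∀ᶠ i in atTop, ∫ y in ball x s, |u i y| ^ critExp n ≤ δ) →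
    Continuous φ → HasCompactSupport φ → tsupport φ ⊆ ball x (s / 2) → (∀ y, 0 ≤ φ y) →
    ∫ y, φ y ∂η ≤ ∫ y, φ y ∂(energyMeasure Ω v G)

/-- Localised by a cutoff `ζ` equal to `1` on the half ball, the difference `u_i - u_j` has
Dirichlet integral at most `2 ∫ |∇ζ|² (u_i - u_j)²`. A second cutoff `χ`, equal to `1` on the
support of `ζ`, lets local `L²` convergence send this to zero, which verifies the criterion of
`le_integral_energyMeasure`. -/
theorem exists_isCompactnessConst {n : ℕ} (hn : 3 ≤ n) : ∃ δ : ℝ, 0 < δ ∧ IsCompactnessConst n δ := by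
  obtain ⟨δ, hδ, hcac⟩ := exists_smallness_const hn
  refine ⟨δ, hδ, fun Ω u v G η M x s φ hΩ hsol hu h hη hs hball hsm hφ hφc hφs h0 => ?_⟩
  have hsub : ∀ t, t ≤ s → closedBall x t ⊆ Ω := fun t ht => (closedBall_subset_closedBall ht).trans hball
  have hφΩ : tsupport φ ⊆ Ω := hφs.trans (ball_subset_closedBall.trans (hsub _ (by linarith)))
  refine h.le_integral_energyMeasure hn hφ hφc hφΩ h0 hu hη fun ε hε => ?_
  obtain ⟨N₀, hN₀⟩ := eventually_atTop.1 hsm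
  obtain ⟨C, hC⟩ := hφc.exists_bound_of_continuous hφ
  obtain ⟨bζ, hbζ⟩ : ∃ b : ContDiffBump x, b = ⟨s / 2, 3 * s / 4, by linarith, by linarith⟩ := ⟨_, rfl⟩
  obtain ⟨bχ, hbχ⟩ : ∃ b : ContDiffBump x, b = ⟨3 * s / 4, 7 * s / 8, by linarith, by linarith⟩ :=
    ⟨_, rfl⟩
  obtain ⟨ζ, hζe⟩ : ∃ ζ : Eu n → ℝ, ζ = bζ := ⟨_, rfl⟩
  obtain ⟨χ, hχe⟩ : ∃ χ : Eu n → ℝ, χ = bχ := ⟨_, rfl⟩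
  have hζ : ContDiff ℝ ∞ ζ := hζe ▸ bζ.contDiff
  have hχ : ContDiff ℝ ∞ χ := hχe ▸ bχ.contDiff
  have hζ1 : ContDiff ℝ 1 ζ := hζ.of_le (by norm_cast)
  have hζt : tsupport ζ = closedBall x (3 * s / 4) := by rw [hζe, bζ.tsupport_eq, hbζ]
  have hχt : tsupport χ = closedBall x (7 * s / 8) := by rw [hχe, bχ.tsupport_eq, hbχ]
  have hζc : HasCompactSupport ζ := hζe ▸ bζ.hasCompactSupport
  have hχc : HasCompactSupport χ := hχe ▸ bχ.hasCompactSupport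
  have hζs : tsupport ζ ⊆ Ω := hζt ▸ hsub _ (by linarith)
  have hχs : tsupport χ ⊆ Ω := hχt ▸ hsub _ (by linarith)
  have hζone : ∀ y ∈ closedBall x (s / 2), ζ y = 1 := fun y hy => by
    rw [hζe]; exact bζ.one_of_mem_closedBall (by rw [hbζ]; exact hy)
  have hχone : ∀ y ∈ closedBall x (3 * s / 4), χ y = 1 := fun y hy => by
    rw [hχe]; exact bχ.one_of_mem_closedBall (by rw [hbχ]; exact hy)
  obtain ⟨D, hD⟩ := (hasCompactSupport_gradient hζc).exists_bound_of_continuous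
    (continuous_gradient hζ1)
  have hR := h.tendsto_integral_mul_sub_sq hΩ hχ hχc hχs hsol hu
  have hC0 : 0 ≤ C := (norm_nonneg _).trans (hC x)
  -- The factor `3`: with `I = K + J` and `I ≤ 2J` one gets `I + K ≤ 3J`. The factors `C` and `D²`
  -- bound `φ` and `|∇ζ|²`.
  have hR' := hR.const_mul (3 * C * D ^ 2)
  rw [mul_zero] at hR'
  obtain ⟨⟨N₁, N₂⟩, hN⟩ := eventually_atTop.1 (hR'.eventually (eventually_le_nhds hε))
  refine ⟨max N₀ (max N₁ N₂), fun i hi j hj => ?_⟩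
  simp only [max_le_iff, ge_iff_le] at hi hj
  have hJ := hN (i, j) ⟨hi.2.1, hj.2.2⟩
  have hδi : ∀ k, N₀ ≤ k → ∫ y in tsupport ζ, |u k y| ^ critExp n ≤ δ := fun k hk => by
    refine le_trans (setIntegral_mono_set ((hu k).integrableOn_abs_rpow hn |>.mono_set
      (ball_subset_closedBall.trans hball)) (Eventually.of_forall fun y => by positivity)
      (Eventually.of_forall ?_)) (hN₀ k hk)
    rw [hζt]
    exact closedBall_subset_ball (by linarith)
  have hI := hcac Ω (u i) (u j) ζ hΩ (hsol i) (hsol j) hζ hζc hζs (hδi i hi.1) (hδi j hj.1)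
  have hIK := integral_gradient_mul_sub_sq hn hΩ (hsol i) (hsol j) hζ hζc hζs
  have hci := (hsol i).continuousOn
  have hcj := (hsol j).continuousOn
  have hfc := continuous_critNonlinearity hn
  have hJle : ∫ y, ‖gradient ζ y‖ ^ 2 * (u i y - u j y) ^ 2 ≤
      D ^ 2 * ∫ y, (χ y * u i y - χ y * u j y) ^ 2 := by
    rw [← integral_const_mul]
    refine integral_mono_of_nonneg (Eventually.of_forall fun y => by positivity) ?_
      (Eventually.of_forall fun y => ?_)
    · have hd : Continuous fun y => χ y * u i y - χ y * u j y :=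
        (continuous_mul_of_tsupport_subset hΩ hχ.continuous hχs hci).sub
          (continuous_mul_of_tsupport_subset hΩ hχ.continuous hχs hcj)
      exact (continuous_const.mul (hd.pow 2)).integrable_of_hasCompactSupport
        (hχc.mono fun y hy h => hy (by simp [h]))
    · by_cases hy : y ∈ closedBall x (3 * s / 4)
      · simp only [hχone y hy, one_mul]
        exact mul_le_mul_of_nonneg_right (pow_le_pow_left₀ (norm_nonneg _) (hD y) 2) (sq_nonneg _)
      · simp only [gradient_eq_zero_of_notMem_tsupport (hζt ▸ hy)]
        simp only [norm_zero, ne_eq, OfNat.ofNat_ne_zero, not_false_eq_true, zero_pow, zero_mul]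
        positivity
  obtain ⟨I, hIe⟩ : ∃ I, I = ∫ y, ‖gradient (fun z => ζ z * (u i z - u j z)) y‖ ^ 2 := ⟨_, rfl⟩
  obtain ⟨K, hKe⟩ : ∃ K, K = ∫ y, ζ y * (ζ y * (u i y - u j y) *
        (critNonlinearity n (u i y) - critNonlinearity n (u j y))) := ⟨_, rfl⟩
  obtain ⟨J, hJe⟩ : ∃ J, J = ∫ y, ‖gradient ζ y‖ ^ 2 * (u i y - u j y) ^ 2 := ⟨_, rfl⟩
  have hmain : ∫ y in Ω, φ y * (‖gradient (u i) y - gradient (u j) y‖ ^ 2 +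
        (critNonlinearity n (u i y) - critNonlinearity n (u j y)) * (u i y - u j y)) ≤
        C * (I + K) := by
    have hwd : ContDiff ℝ 1 fun z => ζ z * (u i z - u j z) :=
      (contDiff_smul_of_tsupport_subset hΩ hζ hζs ((hsol i).smooth.sub (hsol j).smooth)).of_le
        (by norm_cast)
    have i1 : Integrable fun y => ‖gradient (fun z => ζ z * (u i z - u j z)) y‖ ^ 2 :=
      integrable_gradient_sq hwd (hζc.mono fun y hy h => hy (by simp [h]))
    have i2 : Integrable fun y => ζ y * (ζ y * (u i y - u j y) *
        (critNonlinearity n (u i y) - critNonlinearity n (u j y))) :=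
      integrable_mul_of_tsupport_subset hΩ hζ.continuous hζc hζs
        ((hζ.continuous.continuousOn.mul (hci.sub hcj)).mul
          ((hfc.comp_continuousOn hci).sub (hfc.comp_continuousOn hcj)))
    rw [hIe, hKe, ← integral_add i1 i2, ← integral_const_mul,
      setIntegral_eq_integral_of_forall_compl_eq_zero fun y hy => by
        rw [image_eq_zero_of_notMem_tsupport fun h => hy (hφΩ h), zero_mul]]
    -- Monotonicity of the nonlinearity makes the integrand nonnegative, so `φ` may be replaced by
    -- its bound `C` where `ζ = 1`.
    have hmono := fun y => critNonlinearity_sub_mul_nonneg hn (u i y) (u j y)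
    refine integral_mono_of_nonneg (Eventually.of_forall fun y =>
      mul_nonneg (h0 y) (add_nonneg (sq_nonneg _) (hmono y))) ((i1.add i2).const_mul C)
      (Eventually.of_forall fun y => ?_)
    have hm2 : ζ y * (ζ y * (u i y - u j y) *
        (critNonlinearity n (u i y) - critNonlinearity n (u j y))) =
        ζ y ^ 2 * ((critNonlinearity n (u i y) - critNonlinearity n (u j y)) * (u i y - u j y)) := by
      ring
    simp only [hm2]
    by_cases hy : y ∈ tsupport φ
    · have hyb := hφs hy
      have hyΩ := hφΩ hy
      have hev : (fun z => ζ z * (u i z - u j z)) =ᶠ[𝓝 y] fun z => u i z - u j z := by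
        filter_upwards [isOpen_ball.mem_nhds hyb] with z hz
        rw [hζone z (ball_subset_closedBall hz), one_mul]
      rw [hev.gradient_eq, gradient_sub_apply
        (((hsol i).contDiffAt_one hΩ hyΩ).differentiableAt (by norm_num))
        (((hsol j).contDiffAt_one hΩ hyΩ).differentiableAt (by norm_num)),
        hζone y (ball_subset_closedBall hyb), one_pow, one_mul]
      exact mul_le_mul_of_nonneg_right ((le_abs_self _).trans (hC y))
        (add_nonneg (sq_nonneg _) (hmono y))
    · rw [image_eq_zero_of_notMem_tsupport hy, zero_mul]
      exact mul_nonneg hC0 (add_nonneg (sq_nonneg _) (mul_nonneg (sq_nonneg _) (hmono y)))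
  rw [← hIe, ← hJe] at hI
  rw [← hIe, ← hJe, ← hKe] at hIK
  rw [← hJe] at hJle
  have h1 : C * (I + K) ≤ C * (3 * J) := mul_le_mul_of_nonneg_left (by linarith) hC0
  have h2 := mul_le_mul_of_nonneg_left hJle (by positivity : 0 ≤ 3 * C)
  simp only at hJ
  nlinarith

end CriticalYamabe

/-! ### From test functions to inequalities between measures. -/

namespace CriticalYamabe
open Set Metric

section Cutoff

variable {X : Type*} [MeasurableSpace X] {μ : Measure X} {φ : X → ℝ}

theorem integrable_of_continuous_of_measure_tsupport_lt_top [TopologicalSpace X]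
    [BorelSpace X] (hφ : Continuous φ) (hc : HasCompactSupport φ) (hμ : μ (tsupport φ) < ⊤) : Integrable φ μ := by
  obtain ⟨C, hC⟩ := hc.exists_bound_of_continuous hφ
  rw [← integrableOn_iff_integrable_of_support_subset (subset_tsupport φ)]
  exact Measure.integrableOn_of_bounded hμ.ne hφ.measurable.aestronglyMeasurable
    (Eventually.of_forall hC)

theorem measure_le_ofReal_integral {K : Set X} (hK : MeasurableSet K) (hφ : Integrable φ μ)
    (h0 : ∀ x, 0 ≤ φ x) (h1 : ∀ x ∈ K, φ x = 1) : μ K ≤ ENNReal.ofReal (∫ x, φ x ∂μ) := by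
  rw [ofReal_integral_eq_lintegral_ofReal hφ (Eventually.of_forall h0), ← lintegral_indicator_one hK]
  refine lintegral_mono fun x => ?_
  by_cases hx : x ∈ K <;> simp [hx, h1]

theorem ofReal_integral_le_measure {V : Set X} (hφ : Integrable φ μ)
    (h0 : ∀ x, 0 ≤ φ x) (h1 : ∀ x, φ x ≤ 1) (hV : ∀ x ∉ V, φ x = 0) (hm : MeasurableSet V) :
    ENNReal.ofReal (∫ x, φ x ∂μ) ≤ μ V := by
  rw [ofReal_integral_eq_lintegral_ofReal hφ (Eventually.of_forall h0), ← lintegral_indicator_one hm]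
  refine lintegral_mono fun x => ?_
  by_cases hx : x ∈ V <;> simp [hx, h1, hV]

end Cutoff

/-- Cutoffs and outer regularity of `μ₂` give the inequality on compact sets; inner regularity of
`μ₁` extends it to measurable ones. -/
theorem measure_le_of_integral_le {n : ℕ} {μ₁ μ₂ : Measure (Eu n)} [IsFiniteMeasure μ₁]
    [IsFiniteMeasure μ₂] {U : Set (Eu n)} (hU : IsOpen U)
    (h : ∀ φ : Eu n → ℝ, Continuous φ → HasCompactSupport φ → tsupport φ ⊆ U → (∀ x, 0 ≤ φ x) →
      ∫ x, φ x ∂μ₁ ≤ ∫ x, φ x ∂μ₂) {A : Set (Eu n)} (hA : MeasurableSet A) (hAU : A ⊆ U) :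
    μ₁ A ≤ μ₂ A := by
  have hK : ∀ K, IsCompact K → K ⊆ U → μ₁ K ≤ μ₂ K := fun K hK hKU => by
    refine le_of_forall_gt fun r hr => ?_
    obtain ⟨V, hKV, hV, hVr⟩ := hK.exists_isOpen_lt_of_lt r hr
    obtain ⟨φ, h1, hc, hs, h01⟩ := exists_continuousMap_one_of_isCompact_subset_isOpen hK
      (hV.inter hU) (subset_inter hKV hKU)
    have hint : ∀ μ : Measure (Eu n), IsFiniteMeasure μ → Integrable φ μ := fun μ _ =>
      integrable_of_continuous_of_measure_tsupport_lt_top φ.continuous hc (measure_lt_top _ _)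
    refine lt_of_le_of_lt ?_ hVr
    calc μ₁ K ≤ ENNReal.ofReal (∫ x, φ x ∂μ₁) :=
          measure_le_ofReal_integral hK.measurableSet (hint _ inferInstance) (fun x => (h01 x).1) h1
      _ ≤ ENNReal.ofReal (∫ x, φ x ∂μ₂) := ENNReal.ofReal_le_ofReal
          (h φ φ.continuous hc (hs.trans inter_subset_right) fun x => (h01 x).1)
      _ ≤ μ₂ V := ofReal_integral_le_measure (hint _ inferInstance) (fun x => (h01 x).1)
          (fun x => (h01 x).2) (fun x hx => image_eq_zero_of_notMem_tsupport fun hx' =>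
            hx (hs hx').1) hV.measurableSet
  rw [hA.measure_eq_iSup_isCompact_of_ne_top (measure_ne_top _ _)]
  exact iSup₂_le fun K hKA => iSup_le fun hKc =>
    (hK K hKc (hKA.trans hAU)).trans (measure_mono hKA)

variable {n : ℕ} {Ω : Set (Eu n)} {u : ℕ → Eu n → ℝ} {v : Eu n → ℝ} {G : Eu n → Eu n}
  {η : Measure (Eu n)} {M : ℝ}

/-- Cutoffs bound `η` on compact subsets of `Ω`, and `Ω` is exhausted by these. This finiteness
leaves only finitely many heavy atoms and provides the upper bound for `Θ`. -/
theorem MeasureLimitOn.measure_univ_le (hn : 3 ≤ n) (hΩ : IsOpen Ω)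
    (hu : ∀ i, HasEnergyBound Ω (u i) (gradient (u i)) M)
    (hη : MeasureLimitOn Ω (fun i => energyMeasure Ω (u i) (gradient (u i))) η) :
    η univ ≤ ENNReal.ofReal ((1 / 2 + ((n : ℝ) - 2) / (2 * n)) * M) := by
  have hKle : ∀ K, IsCompact K → K ⊆ Ω →
      η K ≤ ENNReal.ofReal ((1 / 2 + ((n : ℝ) - 2) / (2 * n)) * M) := fun K hK hKΩ => by
    obtain ⟨φ, h1, hc, hs, h01⟩ := exists_continuousMap_one_of_isCompact_subset_isOpen hK hΩ hKΩ
    have hint := integrable_of_continuous_of_measure_tsupport_lt_top φ.continuous hc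
      (hη.finite_compact _ hc hs)
    refine (measure_le_ofReal_integral hK.measurableSet hint (fun x => (h01 x).1) h1).trans
      (ENNReal.ofReal_le_ofReal (le_of_tendsto' (hη.tendsto φ φ.continuous hc hs) fun i => ?_))
    rw [(hu i).integral_energyMeasure hn]
    refine le_trans (integral_mono_of_nonneg (Eventually.of_forall fun x =>
      mul_nonneg (h01 x).1 (energyDensity_nonneg hn _ _)) ((hu i).integrableOn_energyDensity hn)
      (Eventually.of_forall fun x => ?_)) ((hu i).integral_energyDensity_le hn)
    exact mul_le_of_le_one_left (energyDensity_nonneg hn _ _) (h01 x).2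
  have hσ : IsSigmaCompact Ω := by
    have := hΩ.locallyCompactSpace
    exact isSigmaCompact_iff_sigmaCompactSpace.2 inferInstance
  obtain ⟨K, hK, hKΩ⟩ := hσ
  have h1 : η univ ≤ η Ω := by
    rw [← union_compl_self Ω]
    exact (measure_union_le _ _).trans (by rw [hη.compl_null, add_zero])
  refine h1.trans ?_
  rw [← hKΩ, measure_iUnion_eq_iSup_accumulate]
  refine iSup_le fun i => hKle _ ?_ ?_
  · exact (finite_le_nat i).isCompact_biUnion fun j _ => hK j
  · exact iUnion₂_subset fun j _ => hKΩ ▸ subset_iUnion K j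

theorem MeasureLimitOn.isFiniteMeasure (hn : 3 ≤ n) (hΩ : IsOpen Ω)
    (hu : ∀ i, HasEnergyBound Ω (u i) (gradient (u i)) M)
    (hη : MeasureLimitOn Ω (fun i => energyMeasure Ω (u i) (gradient (u i))) η) :
    IsFiniteMeasure η :=
  ⟨(hη.measure_univ_le hn hΩ hu).trans_lt ENNReal.ofReal_lt_top⟩

/-- Weak lower semicontinuity in terms of measures; it makes the truncated subtraction defining the
defect measure a genuine one. -/
theorem WeakLimitOn.energyMeasure_le (hn : 3 ≤ n) (hΩ : IsOpen Ω) (h : WeakLimitOn Ω u v G)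
    (hu : ∀ i, HasEnergyBound Ω (u i) (gradient (u i)) M)
    (hη : MeasureLimitOn Ω (fun i => energyMeasure Ω (u i) (gradient (u i))) η) :
    energyMeasure Ω v G ≤ η := by
  have := hη.isFiniteMeasure hn hΩ hu
  obtain ⟨Mv, hv⟩ := h.exists_hasEnergyBound
  have := hv.isFiniteMeasure hn
  refine Measure.le_iff.2 fun A hA => ?_
  calc energyMeasure Ω v G A ≤ energyMeasure Ω v G (A ∩ Ω) + energyMeasure Ω v G (A \ Ω) := by
        conv_lhs => rw [← inter_union_sdiff A Ω]
        exact measure_union_le _ _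
    _ = energyMeasure Ω v G (A ∩ Ω) := by
        have h0 : energyMeasure Ω v G (A \ Ω) = 0 :=
          measure_mono_null (fun x hx => hx.2) (energyMeasure_compl hΩ.measurableSet v G)
        rw [h0, add_zero]
    _ ≤ η (A ∩ Ω) := measure_le_of_integral_le hΩ (fun φ hφ hc hs h0 =>
        h.integral_energyMeasure_le hn hφ hc hs h0 hu hη) (hA.inter hΩ.measurableSet)
        inter_subset_right
    _ ≤ η A := measure_mono inter_subset_left

end CriticalYamabe

/-! ### The defect measure near points inside and outside the concentration set. -/

namespace CriticalYamabe
open Set Metric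

variable {n : ℕ} {Ω : Set (Eu n)} {u : ℕ → Eu n → ℝ} {v : Eu n → ℝ} {G : Eu n → Eu n}
  {η : Measure (Eu n)} {M δ ε₀ r₀ : ℝ} {x : Eu n}

theorem WeakLimitOn.comp {k : ℕ → ℕ} (h : WeakLimitOn Ω u v G) (hk : StrictMono k) :
    WeakLimitOn Ω (fun i => u (k i)) v G where
  memL2 := h.memL2
  memCrit := h.memCrit
  gradMemL2 := h.gradMemL2
  weakGradient := h.weakGradient
  tendstoL2 ψ hψ := (h.tendstoL2 ψ hψ).comp hk.tendsto_atTop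
  tendstoGrad ψ hψ := (h.tendstoGrad ψ hψ).comp hk.tendsto_atTop
  tendstoCrit ψ hψ := (h.tendstoCrit ψ hψ).comp hk.tendsto_atTop

theorem MeasureLimitOn.comp {μ : ℕ → Measure (Eu n)} {k : ℕ → ℕ} (h : MeasureLimitOn Ω μ η)
    (hk : StrictMono k) : MeasureLimitOn Ω (fun i => μ (k i)) η where
  compl_null := h.compl_null
  finite_compact := h.finite_compact
  tendsto φ h1 h2 h3 := (h.tendsto φ h1 h2 h3).comp hk.tendsto_atTop

theorem HasEnergyBound.setIntegral_le {w : Eu n → ℝ} {A : Eu n → Eu n} {S : Set (Eu n)}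
    (hn : 3 ≤ n) (h : HasEnergyBound Ω w A M) (hS : S ⊆ Ω) :
    1 / 2 * ∫ y in S, ‖A y‖ ^ 2 ≤ ∫ y in S, energyDensity (w y) (A y) ∧
      ((n : ℝ) - 2) / (2 * n) * ∫ y in S, |w y| ^ critExp n ≤
        ∫ y in S, energyDensity (w y) (A y) := by
  have := natCast_sub_two_pos hn
  have i1 := h.gradMemL2.integrableOn_norm_sq.mono_set hS
  have i2 := (h.integrableOn_abs_rpow hn).mono_set hS
  have e : ∫ y in S, energyDensity (w y) (A y) = 1 / 2 * (∫ y in S, ‖A y‖ ^ 2) +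
      ((n : ℝ) - 2) / (2 * n) * ∫ y in S, |w y| ^ critExp n := by
    unfold energyDensity
    rw [integral_add (i1.const_mul _) (i2.const_mul _), integral_const_mul, integral_const_mul]
  have h1 : 0 ≤ ∫ y in S, ‖A y‖ ^ 2 := integral_nonneg fun y => by positivity
  have h2 : 0 ≤ ((n : ℝ) - 2) / (2 * n) * ∫ y in S, |w y| ^ critExp n :=
    mul_nonneg (by positivity) (integral_nonneg fun y => by positivity)
  rw [e]
  constructor <;> linarith

section

variable (hn : 3 ≤ n) (hΩ : IsOpen Ω) (hsol : ∀ i, IsSmoothSolution Ω (u i))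
  (hu : ∀ i, HasEnergyBound Ω (u i) (gradient (u i)) M)
  (h : WeakLimitOn Ω u v G)
  (hη : MeasureLimitOn Ω (fun i => energyMeasure Ω (u i) (gradient (u i))) η)

include hn hΩ hu hη

/-- Near a point of small `η`-mass the energies are eventually small. -/
theorem exists_ball_energy_lt {τ r₁ : ℝ} (hx : x ∈ Ω) (hτ : η {x} < ENNReal.ofReal τ)
    (hr₁ : 0 < r₁) : ∃ s, 0 < s ∧ s < r₁ ∧ closedBall x s ⊆ Ω ∧
      ∀ᶠ i in atTop, ∫ y in ball x s, energyDensity (u i y) (gradient (u i) y) < τ := by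
  have := hη.isFiniteMeasure hn hΩ hu
  obtain ⟨V, hxV, hV, hVτ⟩ := ({x} : Set (Eu n)).exists_isOpen_lt_of_lt _ hτ
  obtain ⟨t, ht, htV⟩ := nhds_basis_ball.mem_iff.1
    ((hV.inter hΩ).mem_nhds ⟨hxV rfl, hx⟩)
  have hmin : 0 < min t r₁ := lt_min ht hr₁
  have hst : min t r₁ / 2 < t := by linarith [min_le_left t r₁]
  have hsub : closedBall x (min t r₁ / 2) ⊆ ball x t := closedBall_subset_ball hst
  refine ⟨min t r₁ / 2, by linarith, by linarith [min_le_right t r₁],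
    hsub.trans (htV.trans inter_subset_right), ?_⟩
  obtain ⟨φ, h1, hc, hs, h01⟩ := exists_continuousMap_one_of_isCompact_subset_isOpen
    (isCompact_closedBall x (min t r₁ / 2)) isOpen_ball hsub
  have hsΩ : tsupport φ ⊆ Ω := hs.trans (htV.trans inter_subset_right)
  have hint := integrable_of_continuous_of_measure_tsupport_lt_top φ.continuous hc
    (measure_lt_top η _)
  have hlt : ∫ y, φ y ∂η < τ := by
    have h2 := (ofReal_integral_le_measure hint (fun y => (h01 y).1) (fun y => (h01 y).2)
      (fun y hy => image_eq_zero_of_notMem_tsupport fun hy' => hy (htV (hs hy')).1)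
      hV.measurableSet).trans_lt hVτ
    by_contra hcon
    exact absurd (ENNReal.ofReal_le_ofReal (not_lt.1 hcon)) (not_le.2 h2)
  filter_upwards [(hη.tendsto φ φ.continuous hc hsΩ).eventually_lt_const hlt] with i hi
  refine lt_of_le_of_lt ?_ hi
  obtain ⟨C, hC⟩ := HasCompactSupport.exists_bound_of_continuous hc φ.continuous
  have hint2 := integrableOn_mul_energyDensity hn φ.continuous hC (hu i)
  rw [(hu i).integral_energyMeasure hn]
  have hbΩ : ball x (min t r₁ / 2) ⊆ Ω :=
    ball_subset_closedBall.trans (hsub.trans (htV.trans inter_subset_right))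
  calc ∫ y in ball x (min t r₁ / 2), energyDensity (u i y) (gradient (u i) y)
      = ∫ y in ball x (min t r₁ / 2), φ y * energyDensity (u i y) (gradient (u i) y) :=
        setIntegral_congr_fun measurableSet_ball fun y hy => by
          simp [h1 (ball_subset_closedBall hy)]
    _ ≤ _ := setIntegral_mono_set hint2 (Eventually.of_forall fun y =>
        mul_nonneg (h01 y).1 (energyDensity_nonneg hn _ _)) (Eventually.of_forall hbΩ)

include h

theorem defectMeasure_apply {S : Set (Eu n)} (hS : MeasurableSet S) :
    defectMeasure Ω η v G S = η S - energyMeasure Ω v G S := by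
  obtain ⟨Mv, hv⟩ := h.exists_hasEnergyBound
  have := hv.isFiniteMeasure hn
  exact Measure.sub_apply hS (h.energyMeasure_le hn hΩ hu hη)

theorem defectMeasure_singleton (x : Eu n) : defectMeasure Ω η v G {x} = η {x} := by
  rw [defectMeasure_apply hn hΩ hu h hη (measurableSet_singleton x), energyMeasure_singleton hn,
    tsub_zero]

include hsol

theorem defectMeasure_ball_eq_zero (hδ : IsCompactnessConst n δ) {s : ℝ} (hs : 0 < s)
    (hsub : closedBall x s ⊆ Ω)
    (hsm : ∀ᶠ i in atTop, ∫ y in ball x s, |u i y| ^ critExp n ≤ δ) :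
    defectMeasure Ω η v G (ball x (s / 2)) = 0 := by
  have := hη.isFiniteMeasure hn hΩ hu
  obtain ⟨Mv, hv⟩ := h.exists_hasEnergyBound
  have := hv.isFiniteMeasure hn
  rw [defectMeasure_apply hn hΩ hu h hη measurableSet_ball, tsub_eq_zero_iff_le]
  exact measure_le_of_integral_le isOpen_ball (fun φ hφ hc hs' h0 =>
    hδ Ω u v G η M x s φ hΩ hsol hu h hη hs hsub hsm hφ hc hs' h0) measurableSet_ball subset_rfl

/-- The defect measure vanishes near points of small `η`-mass. -/
theorem exists_defectMeasure_eq_zero_of_measure_lt (hδ : IsCompactnessConst n δ) (hx : x ∈ Ω)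
    (hlt : η {x} < ENNReal.ofReal (((n : ℝ) - 2) / (2 * n) * δ)) :
    ∃ U ∈ 𝓝 x, defectMeasure Ω η v G U = 0 := by
  have h2 := natCast_sub_two_pos hn
  have hn0 : (0 : ℝ) < n := by linarith
  obtain ⟨s, hs, -, hsub, hev⟩ := exists_ball_energy_lt hn hΩ hu hη hx hlt one_pos
  refine ⟨ball x (s / 2), ball_mem_nhds x (by linarith),
    defectMeasure_ball_eq_zero hn hΩ hsol hu h hη hδ hs hsub ?_⟩
  filter_upwards [hev] with i hi
  have := ((hu i).setIntegral_le hn (ball_subset_closedBall.trans hsub)).2.trans hi.le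
  exact le_of_mul_le_mul_left this (by positivity)

omit h in
/-- The measure `η` charges every point of the concentration set. -/
theorem measure_singleton_ne_zero (hε₀ : 0 < ε₀) (hr₀ : 0 < r₀)
    (hx : x ∈ concentrationSet Ω u ε₀ r₀) : η {x} ≠ 0 := by
  intro h0
  have h2 := natCast_sub_two_pos hn
  have hn0 : (0 : ℝ) < n := by linarith
  obtain ⟨c₀, hc₀⟩ : ∃ c₀, c₀ = ((n : ℝ) - 2) / (2 * n) := ⟨_, rfl⟩
  have hc₀p : 0 < c₀ := by rw [hc₀]; positivity
  -- An upper bound for the monotone energy at radius `s/2` when the energy on `B(x,s)` is below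
  -- `τ`. It is continuous with `b 0 = 0`, so a small `τ` contradicts membership in the
  -- concentration set.
  obtain ⟨b, hb⟩ : ∃ b : ℝ → ℝ, b = fun τ => τ + ((n : ℝ) - 2) / 4 *
    (holderConst n * (τ / c₀) ^ (((n : ℝ) - 2) / n)) := ⟨_, rfl⟩
  have hbc : Continuous b := by
    rw [hb]
    exact continuous_id.add (continuous_const.mul (continuous_const.mul
      ((continuous_id.div_const _).rpow_const fun _ => Or.inr (by positivity))))
  have hb0 : b 0 = 0 := by
    rw [hb]
    simp [Real.zero_rpow (by positivity : ((n : ℝ) - 2) / n ≠ 0)]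
  have hev : ∀ᶠ τ in 𝓝[>] (0 : ℝ), b τ < ε₀ :=
    (hbc.continuousAt.tendsto.mono_left nhdsWithin_le_nhds).eventually_lt_const (by rwa [hb0])
  obtain ⟨τ, hτε, hτ⟩ := (hev.and self_mem_nhdsWithin).exists
  have hτ0 : 0 < τ := hτ
  obtain ⟨s, hs, hsr, hsub, hevs⟩ := exists_ball_energy_lt hn hΩ hu hη hx.1
    (by rw [h0]; exact ENNReal.ofReal_pos.2 hτ0) hr₀
  have hsub2 : closedBall x (2 * (s / 2)) ⊆ Ω := by rwa [mul_div_cancel₀ s two_ne_zero]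
  have hlim := hx.2 (s / 2) (by linarith) (by linarith)
    ((closedBall_subset_closedBall (by linarith)).trans hsub)
  have hle : ∀ᶠ i in atTop, (monotoneEnergy (u i) x (s / 2) : EReal) ≤ (b τ : EReal) := by
    filter_upwards [hevs] with i hi
    have h3 := (hsol i).monotoneEnergy_le_of_integrals hn hΩ (half_pos hs) hsub2
    rw [mul_div_cancel₀ s two_ne_zero] at h3
    obtain ⟨h4, h5⟩ := (hu i).setIntegral_le hn (ball_subset_closedBall.trans hsub)
    rw [← hc₀] at h5
    have h6 : ∫ y in ball x s, |u i y| ^ critExp n ≤ τ / c₀ := by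
      rw [le_div_iff₀' hc₀p]; linarith
    have h7 : (∫ y in ball x s, |u i y| ^ critExp n) ^ (((n : ℝ) - 2) / n) ≤
        (τ / c₀) ^ (((n : ℝ) - 2) / n) :=
      Real.rpow_le_rpow (integral_nonneg fun y => by positivity) h6 (by positivity)
    have h8 := mul_le_mul_of_nonneg_left h7 (holderConst_nonneg n)
    have h9 := mul_le_mul_of_nonneg_left h8 (by positivity : 0 ≤ ((n : ℝ) - 2) / 4)
    rw [EReal.coe_le_coe_iff, hb]
    linarith
  have h10 : liminf (fun i => (monotoneEnergy (u i) x (s / 2) : EReal)) atTop ≤ (b τ : EReal) :=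
    liminf_le_of_frequently_le' hle.frequently
  exact absurd (EReal.coe_le_coe_iff.1 (hlim.trans h10)) (not_le.2 hτε)

/-- The defect measure vanishes near points outside the concentration set. -/
theorem exists_defectMeasure_eq_zero_of_notMem (hδ : IsCompactnessConst n δ) (hδ0 : 0 < δ)
    (hε₀ : ε₀ ≤ δ / (2 * n)) (hx : x ∈ Ω) (hxS : x ∉ concentrationSet Ω u ε₀ r₀) :
    ∃ U ∈ 𝓝 x, defectMeasure Ω η v G U = 0 := by
  have h2 := natCast_sub_two_pos hn
  have hn0 : (0 : ℝ) < n := by linarith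
  simp only [concentrationSet, mem_ofPred_eq, not_and, not_forall, not_le] at hxS
  obtain ⟨r, hr, -, hsub, hlim⟩ := hxS hx
  -- The lower limit yields only a subsequence. That is enough: it has the same limits `v` and `η`,
  -- hence the same defect measure.
  have hfr : ∃ᶠ i in atTop, monotoneEnergy (u i) x r < ε₀ :=
    (frequently_lt_of_liminf_lt (by isBoundedDefault) hlim).mono fun i hi =>
      EReal.coe_lt_coe_iff.1 hi
  obtain ⟨k, hk, hkε⟩ := extraction_of_frequently_atTop hfr
  have hM : 0 ≤ M := (integral_nonneg fun _ => sq_nonneg _).trans (hu 0).integral_sq_le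
  obtain ⟨K, hK⟩ : ∃ K, K = holderConst n * M ^ (((n : ℝ) - 2) / n) := ⟨_, rfl⟩
  have hK0 : 0 ≤ K := by rw [hK]; exact mul_nonneg (holderConst_nonneg n) (by positivity)
  -- With `log (r/(2s)) = L` the error `n K/(4L)` is at most `δ/2`, and `n ε₀ ≤ δ/2` by the choice
  -- of threshold. The `+ 1` keeps `L` positive if `K = 0`.
  obtain ⟨L, hL⟩ : ∃ L, L = n * K / (2 * δ) + 1 := ⟨_, rfl⟩
  have hL0 : 0 < L := by rw [hL]; positivity
  obtain ⟨s, hs⟩ : ∃ s, s = r / 2 * Real.exp (-L) := ⟨_, rfl⟩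
  have hs0 : 0 < s := by rw [hs]; positivity
  have hexp : Real.exp (-L) < 1 := Real.exp_zero ▸ Real.exp_lt_exp.2 (by linarith)
  have h2s : 2 * s < r := by rw [hs]; nlinarith
  have hlog : Real.log (r / (2 * s)) = L := by
    have : r / (2 * s) = Real.exp L := by
      rw [hs, Real.exp_neg]; field_simp
    rw [this, Real.log_exp]
  refine ⟨ball x (s / 2), ball_mem_nhds x (by linarith),
    defectMeasure_ball_eq_zero hn hΩ (fun i => hsol (k i)) (fun i => hu (k i)) (h.comp hk)
      (hη.comp hk) hδ hs0 ((closedBall_subset_closedBall (by linarith)).trans hsub)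
      (Eventually.of_forall fun i => ?_)⟩
  have h3 := (hsol (k i)).integral_abs_rpow_le hn hΩ hs0 h2s hsub
  rw [hlog] at h3
  have hbΩ : ball x (2 * s) ⊆ Ω :=
    (ball_subset_closedBall.trans (closedBall_subset_closedBall h2s.le)).trans hsub
  have h4 : ∫ y in ball x (2 * s), |u (k i) y| ^ critExp n ≤ M :=
    (setIntegral_mono_set ((hu (k i)).integrableOn_abs_rpow hn) (Eventually.of_forall fun y => by
      positivity) (Eventually.of_forall hbΩ)).trans (hu (k i)).integral_abs_rpow_le
  have h5 : holderConst n * (∫ y in ball x (2 * s), |u (k i) y| ^ critExp n) ^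
      (((n : ℝ) - 2) / n) ≤ K := by
    rw [hK]
    exact mul_le_mul_of_nonneg_left (Real.rpow_le_rpow (integral_nonneg fun y => by positivity) h4
      (by positivity)) (holderConst_nonneg n)
  refine h3.trans ?_
  have h6 := div_le_div_of_nonneg_right h5 (by positivity : 0 ≤ 4 * L)
  have h7 : n * (K / (4 * L)) ≤ δ / 2 := by
    have : 2 * δ * L = n * K + 2 * δ := by rw [hL]; field_simp
    rw [← mul_div_assoc, div_le_iff₀ (by positivity)]
    linarith
  have h8 : n * ε₀ ≤ δ / 2 := by
    calc n * ε₀ ≤ n * (δ / (2 * n)) := mul_le_mul_of_nonneg_left hε₀ hn0.le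
      _ = δ / 2 := by field_simp
  have h9 := hkε i
  calc _ ≤ n * (ε₀ + K / (4 * L)) := mul_le_mul_of_nonneg_left (by linarith) hn0.le
    _ ≤ δ := by linarith

end

end CriticalYamabe

/-! ### Atomic structure of the defect measure. -/

namespace CriticalYamabe
open Set Metric

theorem _root_.MeasureTheory.Measure.ext_of_finite_support {X : Type*} [MeasurableSpace X]
    [MeasurableSingletonClass X] {μ₁ μ₂ : Measure X} {F : Set X} (hF : F.Finite)
    (h₁ : μ₁ Fᶜ = 0) (h₂ : μ₂ Fᶜ = 0) (h : ∀ x ∈ F, μ₁ {x} = μ₂ {x}) : μ₁ = μ₂ := by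
  ext A hA
  have hfin : (A ∩ F).Finite := hF.subset inter_subset_right
  have hcompl : ∀ μ : Measure X, μ Fᶜ = 0 → μ A = ∑ x ∈ hfin.toFinset, μ {x} := fun μ hμ => by
    rw [sum_measure_singleton, hfin.coe_toFinset]
    exact (measure_inter_conull' (measure_mono_null (fun x hx => hx.2) hμ)).symm
  rw [hcompl _ h₁, hcompl _ h₂]
  exact Finset.sum_congr rfl fun x hx => h x (hfin.mem_toFinset.1 hx).2

section Atomic

variable {X : Type*} [MetricSpace X] {f : X → ℝ} {F : Set X}

/-- Near any `x` the other points of `F` can be avoided, so nearby values are `0 ≤ f x`. -/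
theorem upperSemicontinuous_of_eq_zero_off_finite (hF : F.Finite) (h0 : ∀ x, 0 ≤ f x)
    (hf : ∀ x ∉ F, f x = 0) : UpperSemicontinuous f := by
  intro x y hy
  filter_upwards [(hF.subset (sdiff_subset (t := {x}))).isClosed.isOpen_compl.mem_nhds
    (fun h => h.2 rfl)] with z hz
  by_cases hzx : z = x
  · rwa [hzx]
  · rw [hf z fun h => hz ⟨h, hzx⟩]
    exact (h0 x).trans_lt hy

variable [MeasurableSpace X] [BorelSpace X]

/-- Zero-dimensional Hausdorff measure gives each point mass `1`, so the density is the mass of the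
atom. -/
theorem _root_.MeasureTheory.Measure.eq_withDensity_hausdorffMeasure_zero {ν : Measure X}
    [IsFiniteMeasure ν] (hF : F.Finite) (hν : ν Fᶜ = 0) :
    ν = (μH[0].restrict F).withDensity fun x => ENNReal.ofReal (ν {x}).toReal := by
  refine Measure.ext_of_finite_support hF hν ?_ fun x hx => ?_
  · refine withDensity_absolutelyContinuous _ _ ?_
    rw [Measure.restrict_apply hF.measurableSet.compl, compl_inter_self, measure_empty]
  · rw [withDensity_apply _ (measurableSet_singleton x), lintegral_singleton,
      Measure.restrict_apply (measurableSet_singleton x),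
      inter_eq_left.2 (singleton_subset_iff.2 hx), Measure.hausdorffMeasure_zero_singleton, mul_one,
      ENNReal.ofReal_toReal (measure_ne_top _ _)]

theorem measurable_of_eq_zero_off_finite (hF : F.Finite) (hf : ∀ x ∉ F, f x = 0) :
    Measurable f :=
  (measurable_const (a := (0 : ℝ))).measurable_of_countable_ne
    (hF.countable.mono fun x hx => by_contra fun h => hx (hf x h).symm)

end Atomic

variable {n : ℕ} {Ω : Set (Eu n)} {u : ℕ → Eu n → ℝ} {v : Eu n → ℝ} {G : Eu n → Eu n}
  {η : Measure (Eu n)} {M δ ε₀ r₀ : ℝ} {x : Eu n}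

/-- The points that carry at least the mass `a` of `η`. -/
def atomSet (Ω : Set (Eu n)) (η : Measure (Eu n)) (a : ℝ) : Set (Eu n) :=
  {x | x ∈ Ω ∧ ENNReal.ofReal a ≤ η {x}}

theorem finite_atomSet [IsFiniteMeasure η] {a : ℝ} (ha : 0 < a) : (atomSet Ω η a).Finite := by
  refine Set.Finite.subset (Measure.finite_const_le_meas_of_disjoint_iUnion η
    (ENNReal.ofReal_pos.2 ha) (As := fun x : Eu n => {x}) (fun x => measurableSet_singleton x)
    (fun x y hxy => by simpa using hxy) (measure_ne_top _ _)) fun x hx => hx.2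

section

variable (hn : 3 ≤ n) (hΩ : IsOpen Ω) (hsol : ∀ i, IsSmoothSolution Ω (u i))
  (hu : ∀ i, HasEnergyBound Ω (u i) (gradient (u i)) M)
  (h : WeakLimitOn Ω u v G)
  (hη : MeasureLimitOn Ω (fun i => energyMeasure Ω (u i) (gradient (u i))) η)
  (hδ : IsCompactnessConst n δ)

include hn hΩ hsol hu h hη hδ

theorem mem_support_defectMeasure_iff (hδ0 : 0 < δ) (hx : x ∈ Ω) :
    x ∈ (defectMeasure Ω η v G).support ↔
      x ∈ atomSet Ω η (((n : ℝ) - 2) / (2 * n) * δ) := by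
  have h2 := natCast_sub_two_pos hn
  have hn0 : (0 : ℝ) < n := by linarith
  constructor
  · intro hxs
    by_contra hcon
    have hlt : η {x} < ENNReal.ofReal (((n : ℝ) - 2) / (2 * n) * δ) :=
      not_le.1 fun hle => hcon ⟨hx, hle⟩
    exact Measure.notMem_support_iff_exists.2
      (exists_defectMeasure_eq_zero_of_measure_lt hn hΩ hsol hu h hη hδ hx hlt) hxs
  · intro hxa
    by_contra hcon
    obtain ⟨U, hU, hU0⟩ := Measure.notMem_support_iff_exists.1 hcon
    have h3 : η {x} = 0 := by
      rw [← defectMeasure_singleton hn hΩ hu h hη x]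
      exact measure_mono_null (singleton_subset_iff.2 (mem_of_mem_nhds hU)) hU0
    have h4 := hxa.2
    rw [h3, nonpos_iff_eq_zero, ENNReal.ofReal_eq_zero] at h4
    exact absurd h4 (not_le.2 (by positivity))

/-- An energy gap: a point of the concentration set carries some `η`-mass, hence lies in the support
of the defect measure, hence carries at least the fixed amount. In particular the set does not
depend on the admissible `ε₀` and `r₀`. -/
theorem concentrationSet_eq_atomSet (hδ0 : 0 < δ) (hε₀ : 0 < ε₀) (hε₀' : ε₀ ≤ δ / (2 * n))
    (hr₀ : 0 < r₀) :
    concentrationSet Ω u ε₀ r₀ = atomSet Ω η (((n : ℝ) - 2) / (2 * n) * δ) := by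
  ext x
  constructor
  · intro hx
    rw [← mem_support_defectMeasure_iff hn hΩ hsol hu h hη hδ hδ0 hx.1]
    by_contra hcon
    obtain ⟨U, hU, hU0⟩ := Measure.notMem_support_iff_exists.1 hcon
    refine measure_singleton_ne_zero hn hΩ hsol hu hη hε₀ hr₀ hx ?_
    rw [← defectMeasure_singleton hn hΩ hu h hη x]
    exact measure_mono_null (singleton_subset_iff.2 (mem_of_mem_nhds hU)) hU0
  · intro hx
    by_contra hcon
    have hxΩ := hx.1
    rw [← mem_support_defectMeasure_iff hn hΩ hsol hu h hη hδ hδ0 hxΩ] at hx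
    exact Measure.notMem_support_iff_exists.2
      (exists_defectMeasure_eq_zero_of_notMem hn hΩ hsol hu h hη hδ hδ0 hε₀' hxΩ hcon) hx

theorem defectMeasure_compl_atomSet (hδ0 : 0 < δ) :
    defectMeasure Ω η v G (atomSet Ω η (((n : ℝ) - 2) / (2 * n) * δ))ᶜ = 0 := by
  refine measure_mono_null (t := Ωᶜ ∪ Ω \ atomSet Ω η (((n : ℝ) - 2) / (2 * n) * δ))
    (fun x hx => ?_) (measure_union_null ?_ ?_)
  · by_cases hxΩ : x ∈ Ω
    · exact Or.inr ⟨hxΩ, hx⟩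
    · exact Or.inl hxΩ
  · rw [defectMeasure_apply hn hΩ hu h hη hΩ.measurableSet.compl, hη.compl_null, zero_tsub]
  · refine measure_null_of_locally_null _ fun x hx => ?_
    obtain ⟨U, hU, hU0⟩ := Measure.notMem_support_iff_exists.1 fun hxs => hx.2
      ((mem_support_defectMeasure_iff hn hΩ hsol hu h hη hδ hδ0 hx.1).1 hxs)
    exact ⟨U, mem_nhdsWithin_of_mem_nhds hU, hU0⟩

end

end CriticalYamabe

/-! ### Choice of the constants and conclusion. -/

open CriticalYamabe in
theorem lemma1p4 (n : ℕ) (hn : 3 ≤ n) :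
    ∃ εbar : ℝ, 0 < εbar ∧
    ∀ Ω : Set (Eu n), IsOpen Ω →
    ∃ c : ℝ, 0 < c ∧
    ∀ Λ : ℝ≥0, ∃ C : ℝ, 0 < C ∧
    ∀ (ε₀ r₀ : ℝ), 0 < ε₀ → ε₀ ≤ εbar → 0 < r₀ →
    ∀ (u : ℕ → Eu n → ℝ) (v : Eu n → ℝ) (G : Eu n → Eu n) (η : Measure (Eu n)),
      (∀ i, IsSmoothSolution Ω (u i)) →
      (∀ i, h1NormOn Ω (u i) + lpNormOn Ω (critExp n) (u i) ≤ Λ) →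
      WeakLimitOn Ω u v G →
      MeasureLimitOn Ω (fun i => energyMeasure Ω (u i) (gradient (u i))) η →
      energyMeasure Ω v G + defectMeasure Ω η v G = η ∧
      concentrationSet Ω u ε₀ r₀ ⊆ (defectMeasure Ω η v G).support ∧
      (defectMeasure Ω η v G).support ∩ Ω ⊆ concentrationSet Ω u ε₀ r₀ ∧
      ∃ Θ : Eu n → ℝ, Measurable Θ ∧ UpperSemicontinuousOn Θ Ω ∧
        defectMeasure Ω η v G =
          (μH[0].restrict (concentrationSet Ω u ε₀ r₀)).withDensity
            (fun x => ENNReal.ofReal (Θ x)) ∧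
        ∀ᵐ x ∂(μH[0].restrict (concentrationSet Ω u ε₀ r₀)), c * ε₀ < Θ x ∧ Θ x < C := by
  obtain ⟨δ, hδ0, hδ⟩ := exists_isCompactnessConst hn
  have h2 := natCast_sub_two_pos hn
  have hn0 : (0 : ℝ) < n := by linarith
  obtain ⟨a, ha⟩ : ∃ a, a = ((n : ℝ) - 2) / (2 * n) * δ := ⟨_, rfl⟩
  have ha0 : 0 < a := by rw [ha]; positivity
  have hεbar : 0 < δ / (2 * n) := by positivity
  -- Here `c = a/(2 εbar)`, that is `(n-2)/2`, so `c ε₀ ≤ a/2 < a`, and `a` bounds every atom from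
  -- below. `C` is the bound for the total mass of `η`, plus `1` for strictness. Neither depends on
  -- `Ω`.
  refine ⟨δ / (2 * n), hεbar, fun Ω hΩ => ⟨a / (2 * (δ / (2 * n))), by positivity, fun Λ =>
    ⟨(1 / 2 + ((n : ℝ) - 2) / (2 * n)) * ((Λ : ℝ) ^ 2 + (Λ : ℝ) ^ critExp n) + 1, by positivity,
      fun ε₀ r₀ hε₀ hε₀' hr₀ u v G η hsol hΛ h hη => ?_⟩⟩⟩
  have hu := fun i => hasEnergyBound_of_norm_le hn hΩ (hsol i) (hΛ i)
  have hle := h.energyMeasure_le hn hΩ hu hη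
  have hfin := hη.isFiniteMeasure hn hΩ hu
  obtain ⟨Mv, hv⟩ := h.exists_hasEnergyBound
  have hvfin := hv.isFiniteMeasure hn
  have hνfin : IsFiniteMeasure (defectMeasure Ω η v G) := isFiniteMeasure_of_le η Measure.sub_le
  have hsupp : ∀ x ∈ Ω, (x ∈ (defectMeasure Ω η v G).support ↔ x ∈ atomSet Ω η a) := fun x hx =>
    ha ▸ mem_support_defectMeasure_iff hn hΩ hsol hu h hη hδ hδ0 hx
  have hcompl : defectMeasure Ω η v G (atomSet Ω η a)ᶜ = 0 :=
    ha ▸ defectMeasure_compl_atomSet hn hΩ hsol hu h hη hδ hδ0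
  have hF : (atomSet Ω η a).Finite := finite_atomSet ha0
  have hzero : ∀ x ∉ atomSet Ω η a, (defectMeasure Ω η v G {x}).toReal = 0 := fun x hx => by
    rw [measure_mono_null (Set.singleton_subset_iff.2 hx) hcompl, ENNReal.toReal_zero]
  rw [concentrationSet_eq_atomSet hn hΩ hsol hu h hη hδ hδ0 hε₀ hε₀' hr₀, ← ha]
  refine ⟨?_, fun x hx => (hsupp x hx.1).2 hx, fun x hx => (hsupp x hx.2).1 hx.1,
    fun x => (defectMeasure Ω η v G {x}).toReal, measurable_of_eq_zero_off_finite hF hzero,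
    (upperSemicontinuous_of_eq_zero_off_finite hF (fun x => ENNReal.toReal_nonneg)
      hzero).upperSemicontinuousOn Ω,
    Measure.eq_withDensity_hausdorffMeasure_zero hF hcompl,
    ae_restrict_of_forall_mem hF.measurableSet fun x hx => ⟨?_, ?_⟩⟩
  · rw [add_comm]
    exact Measure.sub_add_cancel_of_le hle
  · beta_reduce
    rw [defectMeasure_singleton hn hΩ hu h hη]
    have h3 : a ≤ (η {x}).toReal := (ENNReal.ofReal_le_iff_le_toReal (measure_ne_top _ _)).1 hx.2
    calc a / (2 * (δ / (2 * n))) * ε₀ ≤ a / (2 * (δ / (2 * n))) * (δ / (2 * n)) :=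
          mul_le_mul_of_nonneg_left hε₀' (by positivity)
      _ = a / 2 := by field_simp
      _ < a := half_lt_self ha0
      _ ≤ _ := h3
  · beta_reduce
    rw [defectMeasure_singleton hn hΩ hu h hη]
    have h3 := (measure_mono (Set.subset_univ {x})).trans (hη.measure_univ_le hn hΩ hu)
    exact (ENNReal.toReal_le_of_le_ofReal (by positivity) h3).trans_lt (lt_add_one _)
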